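/- **Setting.** Let $\mathcal M^4\subset\mathbb R^D$ be a four-dimensional brane, described in local coordinates $y^\mu$ on an open set $U\subset\mathbb R^4$ by smooth Cartesian embedding functions $x^a:U\to\mathbb R$, $a=1,\dots,D$. Let $\eta_{ab}=\mathrm{diag}(\pm1,\dots,\pm1)$ be the flat metric of $\mathbb R^D$ (any signature); Latin indices are moved with it. Assume that the induced metric $g_{\mu\nu}=\eta_{ab}\,\partial_\mu x^a\partial_\nu x^b$ is non-degenerate. Let $\theta^{\mu\nu}$ be a smooth non-degenerate (real, or complexified) Poisson tensor on $U$, with $\{f,h\}=\theta^{\mu\nu}\partial_\mu f\,\partial_\nu h$, and let the smooth function $\sigma$ be such that $$G^{\mu\nu}=e^{-\sigma}\theta^{\mu\rho}\theta^{\nu\kappa}g_{\rho\kappa},\qquad e^{-\sigma}=\frac{\sqrt{\det(\theta^{-1}_{\mu\nu})}}{\sqrt{\det (G_{\mu\nu})}}$$ (the second relation is only needed in squared form). Put $\eta=\tfrac14e^{\sigma}(Gg)$, $(Gg)=G^{\mu\nu}g_{\mu\nu}$, $(GgG)^{\mu\nu}=G^{\mu\rho}g_{\rho\kappa}G^{\kappa\nu}$,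 $(GgGg)=G^{\mu\nu}g_{\nu\rho}G^{\rho\kappa}g_{\kappa\mu}$. Here $g^{\mu\nu}$ is the inverse of $g_{\mu\nu}$, all other Greek indices are moved with $G$, $\nabla$ is the Levi-Civita connection of $G$, $\Box_G=G^{\mu\nu}\nabla_\mu\partial_\nu$, and $R_{\mu\nu}[G]$, $R[G]$ are the Ricci tensor and scalar curvature of $G$ (positive on round spheres). For matrices (elements of an associative algebra) $X^a$ put $$H^{ab}=\tfrac12\big([X^a,X^c][X^b,X_c]+[X^b,X_c][X^a,X^c]\big),\qquad \Box\Phi=[X^a,[X_a,\Phi]].$$ The semi-classical limit $\sim$ replaces $X^a$ by $x^a$ and commutators by $i\{\cdot,\cdot\}$. Precisely: let $A$ be a quantization of $(U,\theta)$, that is, an associative unital $\mathbb C$-algebra with a central non-zero-divisor $\hbar$ and a unital $\mathbb C$-algebra homomorphism "symbol" from $A$ to smooth functions on $U$ which kills $\hbar$, such that each commutator $[\Phi,\Psi]$ equals $i\hbar\,c$ for some $c\in A$ with $\mathrm{symbol}(c)=\{\mathrm{symbol}(\Phi),\mathrm{symbol}(\Psi)\}$. An expression $E$ built from $k$ commutators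 satisfies $E\sim f$ if $E=\hbar^k b$ with $\mathrm{symbol}(b)=f$. **Theorem.** If $X^a\sim x^a$, i.e. $\mathrm{symbol}(X^a)=x^a$ (here $k=6$), then $$\begin{aligned} H^{ab}\Box H_{ab}&+2\,\Box X^c\,H^{ab}[X_a,[X_b,X_c]]\\ \sim\;-e^{3\sigma}\Big(&(GgGg)\,e^{-\sigma}\Box_Ge^{\sigma}+8e^{-2\sigma}\big(\partial_\alpha\eta\,\partial^\alpha\eta-\eta^2\,\partial_\alpha\sigma\,\partial^\alpha\sigma\big)-\tfrac32\nabla_\nu g^{\mu\beta}\nabla^\nu g_{\mu\beta}+2\nabla^\mu g_{\mu\beta}\nabla_\alpha g^{\alpha\beta}\\ &+(Gg)R_{\mu\nu}[G](GgG)^{\mu\nu}-2R[G]-2\nabla_{\nu}\big(G^{\mu\nu}g_{\mu\beta}\nabla_\alpha g^{\alpha\beta}\big)-G_{\mu\beta}\nabla_\alpha g^{\mu\rho}\nabla_\rho g^{\alpha\beta}\\ &+2e^{-\sigma}\nabla_\beta g^{\alpha\beta}\,\partial_\alpha\eta-4e^{-\sigma}\eta\,\nabla_\mu g^{\mu\alpha}\,\partial_\alpha\sigma+2g^{\mu\nu}G_{\mu\alpha}\nabla_\beta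 g^{\alpha\beta}\,\partial_\nu\sigma\Big). \end{aligned}$$ The same equality holds when the left-hand side is read directly with $X^a$ replaced by $x^a$ and every commutator by $i\{\cdot,\cdot\}$. In particular the limit does not depend on the embedding: two branes on $U$ (possibly in spaces $\mathbb R^D$, $\mathbb R^{D'}$ of different dimension and signature, and with different Poisson tensors) with the same $g$, $G$ and $e^\sigma$ have the same limit. -/

import Mathlib

open scoped ContDiff BigOperators

noncomputable section

namespace MatrixBrane

/-! ### Coordinates, partial derivatives, Poisson brackets -/

/-- Local coordinates on the four-dimensional brane. -/
abbrev Coord : Type := Fin 4 → ℝ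

/-- Components of a two-index tensor field in the local coordinates. -/
abbrev TensorField : Type := Coord → Matrix (Fin 4) (Fin 4) ℂ

/-- The partial derivative `∂_μ f`. -/
def pd (μ : Fin 4) (f : Coord → ℂ) (y : Coord) : ℂ :=
  fderiv ℝ f y (Pi.single μ 1)

/-- `{f, h} = θ^{μν} ∂_μ f ∂_ν h`. -/
def poissonBracket (θ : TensorField) (f h : Coord → ℂ) (y : Coord) : ℂ :=
  ∑ μ, ∑ ν, θ y μ ν * pd μ f y * pd ν h y

/-! ### The brane and its metrics -/

/-- The Cartesian embedding function `x^a`, as a complex valued function. -/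
def embFun {D : ℕ} (x : Fin D → Coord → ℝ) (a : Fin D) (y : Coord) : ℂ := (x a y : ℂ)

/-- The induced metric `g_{μν} = η_{ab} ∂_μ x^a ∂_ν x^b`, where `η = diag(ε)`. -/
def inducedMetric {D : ℕ} (ε : Fin D → ℝ) (x : Fin D → Coord → ℝ) : TensorField :=
  fun y => Matrix.of fun μ ν =>
    ∑ a, (ε a : ℂ) * pd μ (embFun x a) y * pd ν (embFun x a) y

/-- The inverse effective metric `G^{μν} = e^{-σ} θ^{μρ} θ^{νκ} g_{ρκ}`. -/
def effectiveMetricInv (θ g : TensorField) (σ : Coord → ℂ) : TensorField :=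
  fun y => Matrix.of fun μ ν =>
    Complex.exp (-σ y) * ∑ ρ, ∑ κ, θ y μ ρ * θ y ν κ * g y ρ κ

/-- A four-dimensional brane in a local chart `U`: an embedding `x` into flat `ℝ^D` with metric
`diag(ε)` whose induced metric is non-degenerate, a non-degenerate (possibly complexified) Poisson
tensor `θ`, and the scalar `σ` determined by `e^{-σ} = ρ / √det(G_{μν})`, `ρ = √det(θ⁻¹_{μν})`
(the relation is squared, so that no branch of the square root has to be fixed). -/
structure IsBrane {D : ℕ} (U : Set Coord) (ε : Fin D → ℝ) (x : Fin D → Coord → ℝ)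
    (θ : TensorField) (σ : Coord → ℂ) : Prop where
  isOpen : IsOpen U
  signature : ∀ a, ε a = 1 ∨ ε a = -1
  smooth_x : ∀ a, ContDiffOn ℝ ∞ (x a) U
  smooth_θ : ∀ μ ν, ContDiffOn ℝ ∞ (fun y => θ y μ ν) U
  smooth_σ : ContDiffOn ℝ ∞ σ U
  metric_nondeg : ∀ y ∈ U, (inducedMetric ε x y).det ≠ 0
  antisymm : ∀ y ∈ U, ∀ μ ν, θ y μ ν = -θ y ν μ
  jacobi : ∀ y ∈ U, ∀ μ ν ρ, ∑ κ, (θ y μ κ * pd κ (fun z => θ z ν ρ) y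
    + θ y ν κ * pd κ (fun z => θ z ρ μ) y + θ y ρ κ * pd κ (fun z => θ z μ ν) y) = 0
  nondeg : ∀ y ∈ U, (θ y).det ≠ 0
  scale : ∀ y ∈ U, Complex.exp (-σ y) ^ 2
    * ((effectiveMetricInv θ (inducedMetric ε x) σ y)⁻¹).det = ((θ y)⁻¹).det

/-! ### Matrix expressions

They are written for an arbitrary bracket on an algebra `B`: the commutator of an algebra of
matrices or operators, or its classical counterpart `i {·,·}` on functions. Latin indices are
lowered with `η = diag(ε)`. -/

section MatrixExpressions

variable {B : Type*} [Ring B] [Algebra ℂ B] {D : ℕ}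

/-- `H^{ab} = ½ ([X^a,X^c][X^b,X_c] + [X^b,X_c][X^a,X^c])`. -/
def matH (br : B → B → B) (ε : Fin D → ℝ) (X : Fin D → B) (a b : Fin D) : B :=
  (1 / 2 : ℂ) • ∑ c, (ε c : ℂ) •
    (br (X a) (X c) * br (X b) (X c) + br (X b) (X c) * br (X a) (X c))

/-- `□ Φ = [X^a,[X_a,Φ]]`. -/
def matBox (br : B → B → B) (ε : Fin D → ℝ) (X : Fin D → B) (Φ : B) : B :=
  ∑ a, (ε a : ℂ) • br (X a) (br (X a) Φ)

/-- `H^{ab} □ H_{ab} + 2 □X^c H^{ab} [X_a,[X_b,X_c]]`. -/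
def matCombination (br : B → B → B) (ε : Fin D → ℝ) (X : Fin D → B) : B :=
  (∑ a, ∑ b, ((ε a : ℂ) * (ε b : ℂ)) • (matH br ε X a b * matBox br ε X (matH br ε X a b)))
  + (2 : ℂ) • ∑ a, ∑ b, ∑ c, ((ε a : ℂ) * (ε b : ℂ) * (ε c : ℂ)) •
      (matBox br ε X (X c) * matH br ε X a b * br (X a) (br (X b) (X c)))

end MatrixExpressions

/-- What replaces the commutator in the semi-classical limit: `i {f, h}`. -/
def classicalBracket (θ : TensorField) (f h : Coord → ℂ) : Coord → ℂ :=
  fun y => Complex.I * poissonBracket θ f h y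

/-- `H^{ab} □ H_{ab} + 2 □X^c H^{ab} [X_a,[X_b,X_c]]` with every matrix `X^a` replaced by the
function `x^a` and every commutator by `i` times the Poisson bracket. -/
def classicalCombination {D : ℕ} (ε : Fin D → ℝ) (x : Fin D → Coord → ℝ) (θ : TensorField) :
    Coord → ℂ :=
  matCombination (classicalBracket θ) ε (embFun x)

/-! ### Quantized Poisson manifolds and the semi-classical limit -/

/-- A quantization of the Poisson structure `θ` on `U` by an algebra `A` of matrices or operators
with deformation parameter `hbar`: `Φ ∼ symbol Φ` is multiplicative, and
`[Φ,Ψ] = i hbar (an element with symbol {symbol Φ, symbol Ψ})`.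
Not every function has to be a symbol, so `A` may be an algebra of chosen observables, or quantize
a larger manifold in which `U` is a chart. -/
structure Quantization (U : Set Coord) (θ : TensorField) (A : Type*) [Ring A] [Algebra ℂ A] where
  hbar : A
  hbar_central : ∀ a, hbar * a = a * hbar
  hbar_regular : ∀ a, hbar * a = 0 → a = 0
  symbol : A → Coord → ℂ
  symbol_smooth : ∀ a, ContDiffOn ℝ ∞ (symbol a) U
  symbol_hbar : ∀ y ∈ U, symbol hbar y = 0
  symbol_one : ∀ y ∈ U, symbol 1 y = 1
  symbol_add : ∀ a b, ∀ y ∈ U, symbol (a + b) y = symbol a y + symbol b y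
  symbol_smul : ∀ (c : ℂ) (a : A), ∀ y ∈ U, symbol (c • a) y = c * symbol a y
  symbol_mul : ∀ a b, ∀ y ∈ U, symbol (a * b) y = symbol a y * symbol b y
  commutator : ∀ a b, ∃ c, a * b - b * a = hbar * (Complex.I • c) ∧
    ∀ y ∈ U, symbol c y = poissonBracket θ (symbol a) (symbol b) y

/-- An expression `a` built from `k` commutators has the semi-classical limit `f`:
`a = hbar ^ k * b` with `b ∼ f`. (The element `b` is unique, as `hbar` is not a zero divisor.) -/
def Quantization.HasSemiclassicalLimit {U : Set Coord} {θ : TensorField} {A : Type*} [Ring A]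
    [Algebra ℂ A] (Q : Quantization U θ A) (k : ℕ) (a : A) (f : Coord → ℂ) : Prop :=
  ∃ b, a = Q.hbar ^ k * b ∧ ∀ y ∈ U, Q.symbol b y = f y

/-! ### Geometry of the effective metric

In this section `P` is the inverse metric `G^{μν}`, so that `G_{μν} = (P y)⁻¹ μ ν`;
`∇` is the Levi-Civita connection of `G`. -/

/-- `Γ^α_{μν}[G] = ½ G^{αβ} (∂_μ G_{βν} + ∂_ν G_{βμ} - ∂_β G_{μν})`. -/
def christoffel (P : TensorField) (α μ ν : Fin 4) (y : Coord) : ℂ :=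
  (1 / 2) * ∑ β, P y α β * (pd μ (fun z => (P z)⁻¹ β ν) y + pd ν (fun z => (P z)⁻¹ β μ) y
    - pd β (fun z => (P z)⁻¹ μ ν) y)

/-- `∇_μ T_{αβ}`. -/
def covDerivLower (P T : TensorField) (μ α β : Fin 4) (y : Coord) : ℂ :=
  pd μ (fun z => T z α β) y
    - ∑ κ, christoffel P κ μ α y * T y κ β - ∑ κ, christoffel P κ μ β y * T y α κ

/-- `∇_μ T^{αβ}`. -/
def covDerivUpper (P T : TensorField) (μ α β : Fin 4) (y : Coord) : ℂ :=
  pd μ (fun z => T z α β) y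
    + ∑ κ, christoffel P α μ κ y * T y κ β + ∑ κ, christoffel P β μ κ y * T y α κ

/-- `∇_μ V^μ`. -/
def divergence (P : TensorField) (V : Fin 4 → Coord → ℂ) (y : Coord) : ℂ :=
  ∑ μ, (pd μ (V μ) y + ∑ κ, christoffel P μ μ κ y * V κ y)

/-- `□_G f = G^{μν} ∇_μ ∂_ν f`. -/
def laplacian (P : TensorField) (f : Coord → ℂ) (y : Coord) : ℂ :=
  ∑ μ, ∑ ν, P y μ ν * (pd μ (pd ν f) y - ∑ κ, christoffel P κ μ ν y * pd κ f y)

/-- The curvature tensor `R_{ρκν}^τ[G]`, with `[∇_ρ, ∇_κ] V_ν = R_{ρκν}^τ V_τ`. -/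
def riemann (P : TensorField) (ρ κ ν τ : Fin 4) (y : Coord) : ℂ :=
  pd κ (christoffel P τ ρ ν) y - pd ρ (christoffel P τ κ ν) y
    + ∑ ι, (christoffel P ι ρ ν y * christoffel P τ ι κ y
      - christoffel P ι κ ν y * christoffel P τ ι ρ y)

/-- `R_{ρν}[G] = R_{ρκν}^κ[G]`; it is positive on round spheres. -/
def ricci (P : TensorField) (ρ ν : Fin 4) (y : Coord) : ℂ := ∑ κ, riemann P ρ κ ν κ y

/-- `R[G] = G^{ρν} R_{ρν}[G]`. -/
def scalarCurv (P : TensorField) (y : Coord) : ℂ := ∑ ρ, ∑ ν, P y ρ ν * ricci P ρ ν y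

/-- `G^{μν} ∂_μ u ∂_ν v`. -/
def gradDot (P : TensorField) (u v : Coord → ℂ) (y : Coord) : ℂ :=
  ∑ μ, ∑ ν, P y μ ν * pd μ u y * pd ν v y

/-- `(Gg) = G^{μν} g_{μν}`. -/
def traceGg (P g : TensorField) (y : Coord) : ℂ := ∑ μ, ∑ ν, P y μ ν * g y μ ν

/-- `η = ¼ e^σ (Gg)`. -/
def etaScalar (P g : TensorField) (σ : Coord → ℂ) (y : Coord) : ℂ :=
  (1 / 4) * Complex.exp (σ y) * traceGg P g y

/-- The inverse `g^{μν}` of the induced metric. -/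
def invMetric (g : TensorField) : TensorField := fun y => (g y)⁻¹

/-- The vector field `∇_α g^{αβ}`. -/
def divInvMetric (P g : TensorField) (β : Fin 4) (y : Coord) : ℂ :=
  ∑ α, covDerivUpper P (invMetric g) α α β y

/-- The intrinsic scalar
`(GgGg) e^{-σ} □_G e^σ + 8 e^{-2σ} (∂_αη ∂^αη - η² ∂_ασ ∂^ασ) - 3/2 ∇_ν g^{μβ} ∇^ν g_{μβ}`
`+ 2 ∇^μ g_{μβ} ∇_α g^{αβ} + (Gg) R_{μν}[G] (GgG)^{μν} - 2 R[G]`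
`- 2 ∇_ν (G^{μν} g_{μβ} ∇_α g^{αβ}) - G_{μβ} ∇_α g^{μρ} ∇_ρ g^{αβ}`
`+ 2 e^{-σ} ∇_β g^{αβ} ∂_α η - 4 e^{-σ} η ∇_β g^{βα} ∂_α σ + 2 g^{μν} G_{μα} ∇_β g^{αβ} ∂_ν σ`,
where `g^{μν}` is the inverse of `g_{μν}`, and all other indices are moved with `G`. -/
def intrinsicScalar (P g : TensorField) (σ : Coord → ℂ) (y : Coord) : ℂ :=
  (P y * g y * P y * g y).trace * Complex.exp (-σ y)
      * laplacian P (fun z => Complex.exp (σ z)) y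
    + 8 * Complex.exp (-2 * σ y) * (gradDot P (etaScalar P g σ) (etaScalar P g σ) y
        - etaScalar P g σ y ^ 2 * gradDot P σ σ y)
    - (3 / 2) * ∑ ν, ∑ κ, ∑ μ, ∑ β, P y ν κ * covDerivUpper P (invMetric g) ν μ β y
        * covDerivLower P g κ μ β y
    + 2 * ∑ μ, ∑ κ, ∑ β, P y μ κ * covDerivLower P g κ μ β y * divInvMetric P g β y
    + traceGg P g y * ∑ μ, ∑ ν, ricci P μ ν y * (P y * g y * P y) μ ν
    - 2 * scalarCurv P y
    - 2 * divergence P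
        (fun ν z => ∑ μ, ∑ β, P z μ ν * g z μ β * divInvMetric P g β z) y
    - ∑ μ, ∑ β, ∑ α, ∑ ρ, (P y)⁻¹ μ β * covDerivUpper P (invMetric g) α μ ρ y
        * covDerivUpper P (invMetric g) ρ α β y
    + 2 * Complex.exp (-σ y) * ∑ α, divInvMetric P g α y * pd α (etaScalar P g σ) y
    - 4 * Complex.exp (-σ y) * etaScalar P g σ y * ∑ α, divInvMetric P g α y * pd α σ y
    + 2 * ∑ μ, ∑ ν, ∑ α, invMetric g y μ ν * (P y)⁻¹ μ α * divInvMetric P g α y * pd ν σ y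

end MatrixBrane

end

namespace MatrixBrane
open Matrix Finset
set_option linter.unusedSectionVars false

/-! ### Derivations and determinants -/

section
variable {R : Type*} [CommRing R] [Algebra ℂ R] {n : Type*} [Fintype n] [DecidableEq n]

/-! The computation takes place in a commutative ℂ-algebra with commuting derivations `∂_μ`. Smooth
functions on `U` form such an algebra, so analysis enters only in transferring pointwise data to it.
Write `E = e^σ`, `P = G^{μν}`, `t = (Gg)`, `S = (GgGg)`, `K_a = ∇∂x^a`, `V = ∑ □x_a dx^a`, and
`G^{ab}` for the `P`-inner product of `dx^a` and `dx^b`.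

The Jacobi identity and the normalisation of `σ` give `∇_μ(e^{-σ}θ^{μν}) = 0` (`sum_upD_poisson`).
Hence the matrix Laplacian becomes `-E □_G` (`sum_pbr_pbr`). The matrix `H^{ab}` becomes `-E G^{ab}`
by the definition of `G`. The left-hand side is therefore `-E² (G^{ab} □(E G_{ab}) + 2 □x^c G^{ab}
{x_a,{x_b,x_c}})`.

Expanding it (`sum_inner_mul_lap`, `sum_inner_mul_pbr_pbr`) leaves three sums that still see the
embedding: `∑ □x_a tr(PgP K_a)`, `∑ tr(P K_a PgP K_a)` and the cross sum `tau`. The first two enter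
only through their difference. A Bochner argument (`hess_bochner`, `sum_hess_bochner`) turns this
difference into divergences, a Ricci term and contractions of `∇g`. The sum `tau` is a combination
of two quadratic invariants of `∇g` (`two_mul_twistSq`). Finally `V` is intrinsic, since contracting
`∇g` gives `V + ½dt` (`sum_lowD_indMet`).

Dimension four enters through a Cayley–Hamilton identity: `(gθ)²` satisfies a quadratic equation
(`sq_asym_mul_symm`), and the normalisation of `σ` fixes its constant term. Hence `g⁻¹ = ½tP - PgP`,
so that `∇_α g^{αβ} = -V^β` and `dS = t dt`. With these relations the stated scalar reduces to the
expression found above (`four_mul_intr`, `matCombination_eq`).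

For the semi-classical limit, the relation "`a = ħ^k b` and `b` has symbol `r`" respects sums,
products and brackets, and is therefore inherited by the whole expression (`matCombination_rel`). -/

theorem derivation_prod (D : Derivation ℂ R R) {ι : Type*} [DecidableEq ι] (s : Finset ι)
    (f : ι → R) : D (∏ i ∈ s, f i) = ∑ i ∈ s, (∏ j ∈ s.erase i, f j) * D (f i) := by
  induction s using Finset.induction_on with
  | empty => simp
  | insert a s ha ih =>
    rw [Finset.prod_insert ha, Derivation.leibniz, ih, Finset.sum_insert ha,
      Finset.erase_insert ha, smul_eq_mul, smul_eq_mul, add_comm, Finset.mul_sum]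
    congr 1
    refine Finset.sum_congr rfl fun i hi => ?_
    rw [Finset.erase_insert_of_ne (by rintro rfl; exact ha hi), Finset.prod_insert
      (fun h => ha (Finset.mem_of_mem_erase h)), mul_assoc]

/-- Jacobi's formula. -/
theorem derivation_det (D : Derivation ℂ R R) (M : Matrix n n R) :
    D M.det = (M.adjugate * M.map D).trace := by
  -- By Cramer's rule each diagonal entry is the determinant with one column differentiated, so the
  -- trace is the Leibniz expansion by columns.
  have h : ∀ i, (M.adjugate * M.map D) i i = (M.updateCol i (fun k => D (M k i))).det := by
    intro i
    rw [← cramer_apply, cramer_eq_adjugate_mulVec]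
    rfl
  rw [trace]
  simp only [diag_apply, h, det_apply, map_sum]
  rw [Finset.sum_comm]
  refine Finset.sum_congr rfl fun σ _ => ?_
  rw [← Finset.smul_sum]
  have : D (σ.sign • ∏ i, M (σ i) i) = σ.sign • D (∏ i, M (σ i) i) := by
    rcases Int.units_eq_one_or σ.sign with h | h <;> simp [h]
  rw [this, derivation_prod]
  congr 1
  refine Finset.sum_congr rfl fun i _ => ?_
  rw [← Finset.mul_prod_erase _ _ (Finset.mem_univ i), mul_comm]
  simp only [updateCol_self]
  congr 1
  refine Finset.prod_congr rfl fun j hj => ?_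
  rw [updateCol_ne (Finset.ne_of_mem_erase hj)]

end

/-! ### Pfaffians and the four-dimensional Cayley–Hamilton identity -/

section Pfaffian
variable {R : Type*} [CommRing R]

/-- The Pfaffian of an antisymmetric 4×4 matrix. -/
def pf (A : Matrix (Fin 4) (Fin 4) R) : R := A 0 1 * A 2 3 - A 0 2 * A 1 3 + A 0 3 * A 1 2

/-- The dual of an antisymmetric 4×4 matrix. -/
def dual (A : Matrix (Fin 4) (Fin 4) R) : Matrix (Fin 4) (Fin 4) R :=
  !![0, A 2 3, -A 1 3, A 1 2; -A 2 3, 0, A 0 3, -A 0 2; A 1 3, -A 0 3, 0, A 0 1;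
    -A 1 2, A 0 2, -A 0 1, 0]

/-- An antisymmetric 4×4 matrix with zero diagonal. -/
def asym (a b c d e f : R) : Matrix (Fin 4) (Fin 4) R :=
  !![0, a, b, c; -a, 0, d, e; -b, -d, 0, f; -c, -e, -f, 0]

/-- With 2 invertible, antisymmetry kills the diagonal. Six free entries remain, and the identities
below become polynomial identities in them. -/
theorem eq_asym (h2 : IsUnit (2 : R)) {A : Matrix (Fin 4) (Fin 4) R} (hA : Aᵀ = -A) :
    A = asym (A 0 1) (A 0 2) (A 0 3) (A 1 2) (A 1 3) (A 2 3) := by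
  have h : ∀ i j, A j i = -A i j := fun i j => congrFun (congrFun hA i) j
  have h0 : ∀ i, A i i = 0 := fun i => by
    apply h2.mul_left_cancel
    linear_combination h i i
  ext i j
  fin_cases i <;> fin_cases j <;> simp [asym, h0] <;> exact h _ _

theorem mul_dual (h2 : IsUnit (2 : R)) {A : Matrix (Fin 4) (Fin 4) R} (hA : Aᵀ = -A) :
    A * dual A = -pf A • 1 := by
  rw [eq_asym h2 hA]
  ext i j
  fin_cases i <;> fin_cases j <;>
    simp [asym, dual, pf, Matrix.mul_apply, Fin.sum_univ_four] <;> ring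

theorem dual_dual (h2 : IsUnit (2 : R)) {A : Matrix (Fin 4) (Fin 4) R} (hA : Aᵀ = -A) :
    dual (dual A) = A := by
  rw [eq_asym h2 hA]
  simp [asym, dual]

theorem dual_add (A B : Matrix (Fin 4) (Fin 4) R) : dual (A + B) = dual A + dual B := by
  ext i j
  fin_cases i <;> fin_cases j <;> simp [dual] <;> ring

theorem trace_mul_dual (h2 : IsUnit (2 : R)) {A B : Matrix (Fin 4) (Fin 4) R} (hA : Aᵀ = -A)
    (hB : Bᵀ = -B) : (A * dual B).trace = -2 * (pf (A + B) - pf A - pf B) := by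
  rw [eq_asym h2 hA, eq_asym h2 hB]
  generalize A 0 1 = a₁, A 0 2 = a₂, A 0 3 = a₃, A 1 2 = a₄, A 1 3 = a₅, A 2 3 = a₆,
    B 0 1 = b₁, B 0 2 = b₂, B 0 3 = b₃, B 1 2 = b₄, B 1 3 = b₅, B 2 3 = b₆
  simp [asym, dual, pf, Fin.sum_univ_four, Matrix.trace]
  ring

/-- Polarisation of `mul_dual`: expand it at `A + B` and identify the scalar by `trace_mul_dual`. -/
theorem mul_dual_add (h2 : IsUnit (2 : R)) {A B : Matrix (Fin 4) (Fin 4) R} (hA : Aᵀ = -A)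
    (hB : Bᵀ = -B) : (2 : R) • (A * dual B + B * dual A) = (A * dual B).trace • 1 := by
  have h := mul_dual h2 (A := A + B) (by rw [Matrix.transpose_add, hA, hB, neg_add])
  rw [dual_add, Matrix.add_mul, Matrix.mul_add, Matrix.mul_add, mul_dual h2 hA,
    mul_dual h2 hB] at h
  rw [trace_mul_dual h2 hA hB]
  have h' : A * dual B + B * dual A = -(pf (A + B) - pf A - pf B) • 1 := by
    rw [neg_smul, sub_smul, sub_smul]
    rw [neg_smul, neg_smul, neg_smul] at h
    rw [← sub_eq_zero] at h ⊢
    rw [← h]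
    abel
  rw [h', smul_smul]
  congr 1
  ring

theorem det_eq_pf_sq (h2 : IsUnit (2 : R)) {A : Matrix (Fin 4) (Fin 4) R} (hA : Aᵀ = -A) :
    A.det = pf A ^ 2 := by
  rw [eq_asym h2 hA]
  simp [asym, pf, Matrix.det_succ_row_zero, Fin.sum_univ_succ, Fin.succAbove]
  ring

theorem pf_congr (h2 : IsUnit (2 : R)) {A : Matrix (Fin 4) (Fin 4) R} (hA : Aᵀ = -A)
    (g : Matrix (Fin 4) (Fin 4) R) : pf (g * A * gᵀ) = g.det * pf A := by
  rw [eq_asym h2 hA]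
  simp [asym, pf, Matrix.det_succ_row_zero, Fin.sum_univ_succ, Fin.succAbove, Matrix.mul_apply]
  ring

/-- The Cayley–Hamilton theorem for the product of an antisymmetric and a symmetric 4×4 matrix,
in terms of the square of the product. -/
theorem sq_asym_mul_symm (h2 : IsUnit (2 : R)) {A g : Matrix (Fin 4) (Fin 4) R} (hA : Aᵀ = -A)
    (hg : gᵀ = g) (hdA : IsUnit A.det) (hdg : IsUnit g.det) :
    (2 : R) • ((g * A * g * A) * (g * A * g * A)) + (2 * A.det * g.det) • 1
      = (g * A * g * A).trace • (g * A * g * A) := by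
  have hB : (g * A * g)ᵀ = -(g * A * g) := by
    simp [Matrix.transpose_mul, hA, hg, Matrix.mul_assoc]
  have hD : (dual A)ᵀ = -dual A := by
    ext i j
    fin_cases i <;> fin_cases j <;> simp [dual]
  have hX : IsUnit (g * A * g).det := by
    rw [Matrix.det_mul, Matrix.det_mul]
    exact (hdg.mul hdA).mul hdg
  -- Polarising at `gAg` and `dual A` gives `gAgA + dual A * dual (gAg) = ½ tr(gAgA)`. After
  -- multiplication by `gAgA` the second summand collapses to `pf A * pf (gAg) = det A * det g`.
  have key := mul_dual_add h2 hB hD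
  rw [dual_dual h2 hA] at key
  have e1 := mul_dual h2 hA
  have e2 := mul_dual h2 hB
  have e3 : pf (g * A * g) = g.det * pf A := by
    rw [← pf_congr h2 hA g, hg]
  have e4 := det_eq_pf_sq h2 hA
  -- `dual A * dual (g A g) * (g A g A)` is a multiple of `1`
  have e5 : dual (g * A * g) * (g * A * g) = -pf (g * A * g) • 1 := by
    have := (Matrix.isUnit_iff_isUnit_det _).2 hX
    apply this.mul_left_cancel
    rw [← Matrix.mul_assoc, e2]
    simp
  have e6 : dual A * A = -pf A • 1 := by
    have := (Matrix.isUnit_iff_isUnit_det _).2 hdA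
    apply this.mul_left_cancel
    rw [← Matrix.mul_assoc, e1]
    simp
  have e7 := congrArg (· * (g * A * g * A)) key
  simp only [Matrix.smul_mul, Matrix.add_mul, Matrix.one_mul] at e7
  rw [← e7, smul_add]
  congr 1
  rw [Matrix.mul_assoc (dual A), ← Matrix.mul_assoc (dual (g * A * g)), e5]
  simp only [Matrix.smul_mul, Matrix.one_mul, Matrix.mul_smul, e6, smul_smul]
  rw [e3, e4]
  congr 1
  ring
end Pfaffian

/-! ### Covariant derivatives, divergence and Laplacian over an algebra with derivations -/

section Tensor
variable {R : Type*} [CommRing R] [Algebra ℂ R] {n : Type*} [Fintype n]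

/-- The element `½` of a `ℂ`-algebra. -/
noncomputable def half (R : Type*) [CommRing R] [Algebra ℂ R] : R := algebraMap ℂ R (1 / 2)

theorem two_mul_half : 2 * half R = 1 := by
  rw [half, ← map_ofNat (algebraMap ℂ R) 2, ← map_mul]
  norm_num

theorem isUnit_two : IsUnit (2 : R) := IsUnit.of_mul_eq_one _ two_mul_half

theorem derivation_half (D : Derivation ℂ R R) : D (half R) = 0 := D.map_algebraMap _

theorem map_mul_derivation (D : Derivation ℂ R R) (M N : Matrix n n R) :
    (M * N).map D = M.map D * N + M * N.map D := by
  ext i j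
  simp only [Matrix.map_apply, Matrix.mul_apply, Matrix.add_apply, map_sum, Derivation.leibniz,
    smul_eq_mul, Finset.sum_add_distrib]
  rw [add_comm]
  congr 1
  exact Finset.sum_congr rfl fun _ _ => mul_comm _ _

theorem map_smul_derivation (D : Derivation ℂ R R) (f : R) (N : Matrix n n R) :
    (f • N).map D = D f • N + f • N.map D := by
  ext i j
  simp
  ring

theorem map_one_derivation [DecidableEq n] (D : Derivation ℂ R R) : (1 : Matrix n n R).map D = 0 := by
  ext i j
  simp [Matrix.one_apply, apply_ite D]

theorem map_trace_derivation (D : Derivation ℂ R R) (M : Matrix n n R) :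
    D M.trace = (M.map D).trace := by
  simp [Matrix.trace]

theorem derivation_dotProduct (D : Derivation ℂ R R) (u v : n → R) :
    D (u ⬝ᵥ v) = (D ∘ u) ⬝ᵥ v + u ⬝ᵥ (D ∘ v) := by
  simp only [dotProduct, map_sum, Derivation.leibniz, smul_eq_mul, Finset.sum_add_distrib,
    Function.comp_apply]
  rw [add_comm]
  congr 1
  exact Finset.sum_congr rfl fun _ _ => mul_comm _ _

theorem derivation_mulVec (D : Derivation ℂ R R) (M : Matrix n n R) (v : n → R) :
    D ∘ (M *ᵥ v) = M.map D *ᵥ v + M *ᵥ (D ∘ v) := by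
  ext i
  exact derivation_dotProduct D _ _

/-- The differential of `f`. -/
def grad (d : n → Derivation ℂ R R) (f : R) : n → R := fun μ => d μ f

variable (d : n → Derivation ℂ R R) (Γ : n → n → n → R)

/-- `(Γ_μ)^α_κ`. -/
def conn (μ : n) : Matrix n n R := Matrix.of fun α κ => Γ α μ κ

/-- `∇_μ T_{αβ}`. -/
def lowD (μ : n) (T : Matrix n n R) : Matrix n n R :=
  Matrix.of fun α β => d μ (T α β) - ∑ κ, Γ κ μ α * T κ β - ∑ κ, Γ κ μ β * T α κ

/-- `∇_μ T^{αβ}`. -/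
def upD (μ : n) (T : Matrix n n R) : Matrix n n R :=
  Matrix.of fun α β => d μ (T α β) + ∑ κ, Γ α μ κ * T κ β + ∑ κ, Γ β μ κ * T α κ

/-- `∇_μ u_ν`. -/
def cov (u : n → R) : Matrix n n R := Matrix.of fun μ ν => d μ (u ν) - ∑ κ, Γ κ μ ν * u κ

/-- `∇_μ W^μ`. -/
def divg (W : n → R) : R := ∑ μ, (d μ (W μ) + ∑ κ, Γ μ μ κ * W κ)

/-- `∇_μ ∂_ν f`. -/
def hess (f : R) : Matrix n n R := cov d Γ (grad d f)

/-- `G^{μν} ∇_μ ∂_ν f`. -/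
def lap (P : Matrix n n R) (f : R) : R := ∑ μ, ∑ ν, P μ ν * (d μ (d ν f) - ∑ κ, Γ κ μ ν * d κ f)

theorem lowD_eq (μ : n) (T : Matrix n n R) :
    lowD d Γ μ T = T.map (d μ) - (conn Γ μ)ᵀ * T - T * conn Γ μ := by
  ext α β
  simp only [lowD, conn, Matrix.of_apply, Matrix.sub_apply, Matrix.map_apply, Matrix.mul_apply,
    Matrix.transpose_apply]
  congr 1
  exact Finset.sum_congr rfl fun _ _ => mul_comm _ _

theorem upD_eq (μ : n) (T : Matrix n n R) :
    upD d Γ μ T = T.map (d μ) + conn Γ μ * T + T * (conn Γ μ)ᵀ := by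
  ext α β
  simp only [upD, conn, Matrix.of_apply, Matrix.add_apply, Matrix.map_apply, Matrix.mul_apply,
    Matrix.transpose_apply]
  congr 1
  exact Finset.sum_congr rfl fun _ _ => mul_comm _ _

/-- The connection terms of a contracted pair of upper and lower indices cancel, so the Leibniz rule
survives contraction. -/
theorem upD_mul (μ : n) (A T B : Matrix n n R) :
    upD d Γ μ (A * T * B) = upD d Γ μ A * T * B + A * lowD d Γ μ T * B + A * T * upD d Γ μ B := by
  simp only [upD_eq, lowD_eq, map_mul_derivation]
  noncomm_ring

theorem upD_smul (μ : n) (f : R) (A : Matrix n n R) :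
    upD d Γ μ (f • A) = d μ f • A + f • upD d Γ μ A := by
  simp only [upD_eq, map_smul_derivation, smul_add, Matrix.smul_mul, Matrix.mul_smul]
  abel

theorem upD_sub (μ : n) (A B : Matrix n n R) :
    upD d Γ μ (A - B) = upD d Γ μ A - upD d Γ μ B := by
  have : (A - B).map (d μ) = A.map (d μ) - B.map (d μ) := by ext i j; simp
  simp only [upD_eq, this]
  noncomm_ring

theorem trace_upD_mul (μ : n) (A T : Matrix n n R) :
    d μ (A * T).trace = (upD d Γ μ A * T).trace + (A * lowD d Γ μ T).trace := by
  rw [map_trace_derivation, map_mul_derivation, ← Matrix.trace_add]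
  simp only [upD_eq, lowD_eq]
  simp only [Matrix.mul_sub, Matrix.add_mul, Matrix.trace_add, Matrix.trace_sub]
  have h := Matrix.trace_mul_comm (A * T) (conn Γ μ)
  simp only [Matrix.mul_assoc] at h ⊢
  rw [h]
  ring

theorem derivation_mulVec_cov (M : Matrix n n R) (u : n → R) (μ : n) :
    d μ ∘ (M *ᵥ u) + conn Γ μ *ᵥ (M *ᵥ u) = upD d Γ μ M *ᵥ u + M *ᵥ (cov d Γ u μ) := by
  have : cov d Γ u μ = d μ ∘ u - (conn Γ μ)ᵀ *ᵥ u := by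
    ext ν
    simp [cov, conn, mulVec, dotProduct]
  rw [derivation_mulVec, this, upD_eq]
  simp only [Matrix.add_mulVec, Matrix.mulVec_sub, Matrix.mulVec_mulVec]
  abel

theorem divg_eq (W : n → R) : divg d Γ W = ∑ μ, (d μ ∘ W + conn Γ μ *ᵥ W) μ := rfl

theorem divg_mulVec (M : Matrix n n R) (u : n → R) :
    divg d Γ (M *ᵥ u) = ∑ μ, (M *ᵥ cov d Γ u μ) μ + ∑ μ, (upD d Γ μ M *ᵥ u) μ := by
  simp only [divg_eq, derivation_mulVec_cov d Γ M u]
  simp only [Pi.add_apply, Finset.sum_add_distrib]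
  rw [add_comm]

theorem divg_add (V W : n → R) : divg d Γ (V + W) = divg d Γ V + divg d Γ W := by
  simp only [divg, Pi.add_apply, map_add, mul_add, Finset.sum_add_distrib]
  ring

theorem divg_smul (f : R) (W : n → R) :
    divg d Γ (f • W) = f * divg d Γ W + grad d f ⬝ᵥ W := by
  simp only [divg, Pi.smul_apply, smul_eq_mul, Derivation.leibniz, Finset.mul_sum, mul_add,
    Finset.sum_add_distrib, grad, dotProduct]
  simp only [mul_left_comm f, mul_comm (W _)]
  ring

theorem divg_sum {ι : Type*} (s : Finset ι) (c : ι → ℂ) (W : ι → n → R) :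
    divg d Γ (∑ a ∈ s, c a • W a) = ∑ a ∈ s, c a • divg d Γ (W a) := by
  simp only [divg, Finset.sum_apply, Pi.smul_apply, map_sum, Derivation.map_smul, Finset.smul_sum,
    Finset.mul_sum, mul_smul_comm, Finset.sum_add_distrib, smul_add]
  congr 1
  · rw [Finset.sum_comm]
  · rw [Finset.sum_comm]
    simp only [Finset.sum_comm (s := univ) (t := s)]
    exact Finset.sum_congr rfl fun _ _ => Finset.sum_comm

theorem lap_eq (P : Matrix n n R) (f : R) : lap d Γ P f = ∑ μ, (P *ᵥ hess d Γ f μ) μ := rfl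

variable {d Γ}

theorem hess_symm (hd : ∀ μ ν f, d μ (d ν f) = d ν (d μ f)) (hΓ : ∀ α μ ν, Γ α μ ν = Γ α ν μ)
    (f : R) : (hess d Γ f)ᵀ = hess d Γ f := by
  ext μ ν
  simp only [hess, cov, grad, Matrix.transpose_apply, Matrix.of_apply]
  rw [hd]
  simp only [hΓ _ μ ν]

theorem hess_symm_apply (hd : ∀ μ ν f, d μ (d ν f) = d ν (d μ f))
    (hΓ : ∀ α μ ν, Γ α μ ν = Γ α ν μ) (f : R) (μ ν : n) :
    hess d Γ f μ ν = hess d Γ f ν μ := congrFun (congrFun (hess_symm hd hΓ f) ν) μ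

theorem lap_eq_trace {P : Matrix n n R} (hd : ∀ μ ν f, d μ (d ν f) = d ν (d μ f))
    (hΓ : ∀ α μ ν, Γ α μ ν = Γ α ν μ) (f : R) : lap d Γ P f = (P * hess d Γ f).trace := by
  rw [lap_eq]
  refine Finset.sum_congr rfl fun μ _ => ?_
  rw [Matrix.diag_apply, Matrix.mul_apply]
  refine Finset.sum_congr rfl fun ν _ => ?_
  rw [hess_symm_apply hd hΓ]

/-- A parallel `P` passes through the divergence. In this form linearity and the product rule for
`□` follow from those of `divg`. -/
theorem lap_eq_divg {P : Matrix n n R} (hP : ∀ μ, upD d Γ μ P = 0) (f : R) :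
    lap d Γ P f = divg d Γ (P *ᵥ grad d f) := by
  rw [divg_mulVec, lap_eq]
  simp [hP, hess]

theorem grad_mul (f h : R) : grad d (f * h) = f • grad d h + h • grad d f := by
  ext μ; simp [grad]

theorem lap_mul {P : Matrix n n R} (hPt : Pᵀ = P) (hP : ∀ μ, upD d Γ μ P = 0) (f h : R) :
    lap d Γ P (f * h) = f * lap d Γ P h + h * lap d Γ P f + 2 * (grad d f ⬝ᵥ P *ᵥ grad d h) := by
  have e : grad d h ⬝ᵥ P *ᵥ grad d f = grad d f ⬝ᵥ P *ᵥ grad d h := by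
    rw [dotProduct_comm, dotProduct_mulVec, ← mulVec_transpose, hPt]
  simp only [lap_eq_divg hP, grad_mul, Matrix.mulVec_add, Matrix.mulVec_smul, divg_add, divg_smul,
    e]
  ring

end Tensor

theorem sum_rotate {α β γ M : Type*} [Fintype α] [Fintype β] [Fintype γ] [AddCommMonoid M]
    (f : α → β → γ → M) : ∑ i, ∑ j, ∑ k, f i j k = ∑ k, ∑ i, ∑ j, f i j k := by
  rw [Finset.sum_comm]
  simp only [Finset.sum_comm (f := fun i k => f i _ k)]
  rw [Finset.sum_comm]
  exact Finset.sum_congr rfl fun _ _ => Finset.sum_comm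

/-! ### Levi-Civita connection, curvature and a Bochner identity -/

section Curvature
variable {R : Type*} [CommRing R] [Algebra ℂ R] {n : Type*} [Fintype n]
variable (d : n → Derivation ℂ R R)

/-- The Christoffel symbols `Γ^α_{μν}` of the metric `Q` with inverse `P`. -/
noncomputable def chr (P Q : Matrix n n R) (α μ ν : n) : R :=
  half R * ∑ β, P α β * (d μ (Q β ν) + d ν (Q β μ) - d β (Q μ ν))

/-- The curvature tensor `R_{ρκν}^τ`. -/
def riem (Γ : n → n → n → R) (ρ κ ν τ : n) : R :=
  d κ (Γ τ ρ ν) - d ρ (Γ τ κ ν) + ∑ ι, (Γ ι ρ ν * Γ τ ι κ - Γ ι κ ν * Γ τ ι ρ)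

/-- The Ricci tensor. -/
def ric (Γ : n → n → n → R) : Matrix n n R := Matrix.of fun ρ ν => ∑ κ, riem d Γ ρ κ ν κ

variable {d}

theorem chr_symm {P Q : Matrix n n R} (hQ : Qᵀ = Q) (α μ ν : n) :
    chr d P Q α μ ν = chr d P Q α ν μ := by
  have h : ∀ i j, Q i j = Q j i := fun i j => congrFun (congrFun hQ j) i
  simp only [chr]
  congr 1
  refine Finset.sum_congr rfl fun β _ => ?_
  rw [h μ ν]
  ring

theorem lower_chr [DecidableEq n] {P Q : Matrix n n R} (hQP : Q * P = 1) (α μ ν : n) :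
    ∑ κ, Q α κ * chr d P Q κ μ ν = half R * (d μ (Q α ν) + d ν (Q α μ) - d α (Q μ ν)) := by
  simp only [chr, mul_left_comm _ (half R), ← Finset.mul_sum]
  congr 1
  have : ∀ u : n → R, Q *ᵥ (P *ᵥ u) = u := fun u => by
    rw [Matrix.mulVec_mulVec, hQP, Matrix.one_mulVec]
  exact congrFun (this fun β => d μ (Q β ν) + d ν (Q β μ) - d β (Q μ ν)) α

theorem lowD_metric [DecidableEq n] {P Q : Matrix n n R} (hQ : Qᵀ = Q) (hQP : Q * P = 1)
    (μ : n) : lowD d (chr d P Q) μ Q = 0 := by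
  have h : ∀ i j, Q i j = Q j i := fun i j => congrFun (congrFun hQ j) i
  ext α β
  simp only [lowD, Matrix.of_apply, Matrix.zero_apply]
  have e1 := lower_chr (d := d) hQP β μ α
  have e2 := lower_chr (d := d) hQP α μ β
  have e3 : ∑ κ, chr d P Q κ μ α * Q κ β = ∑ κ, Q β κ * chr d P Q κ μ α :=
    Finset.sum_congr rfl fun κ _ => by rw [h κ β, mul_comm]
  have e4 : ∑ κ, chr d P Q κ μ β * Q α κ = ∑ κ, Q α κ * chr d P Q κ μ β :=
    Finset.sum_congr rfl fun κ _ => mul_comm _ _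
  rw [e3, e4, e1, e2, h β α, h μ α, h μ β]
  linear_combination (-d μ (Q α β)) * two_mul_half (R := R)

/-- Differentiating `P Q = 1` carries the compatibility of `Q` over to its inverse. -/
theorem upD_inverse_metric [DecidableEq n] {P Q : Matrix n n R} (hQ : Qᵀ = Q) (hQP : Q * P = 1)
    (μ : n) : upD d (chr d P Q) μ P = 0 := by
  have hPQ : P * Q = 1 := mul_eq_one_comm.1 hQP
  have h := lowD_metric (d := d) hQ hQP μ
  rw [lowD_eq] at h
  have h1 : P.map (d μ) * Q + P * Q.map (d μ) = 0 := by
    rw [← map_mul_derivation, hPQ, map_one_derivation]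
  rw [upD_eq]
  set C := conn (chr d P Q) μ
  have h2 : Q.map (d μ) = Cᵀ * Q + Q * C := by
    rw [← sub_eq_zero, ← h]; abel
  rw [h2] at h1
  have h3 := congrArg (· * P) h1
  simp only [Matrix.add_mul, Matrix.mul_add, Matrix.mul_assoc, hQP, Matrix.mul_one,
    Matrix.zero_mul] at h3
  rw [← Matrix.mul_assoc P Q, hPQ, Matrix.one_mul] at h3
  rw [← h3]
  abel

variable {Γ : n → n → n → R}

/-- The curvature as a matrix, `(F_{ρκ})^τ_ν = R_{ρκν}^τ`. -/
theorem riem_matrix (hΓ : ∀ α μ ν, Γ α μ ν = Γ α ν μ) (ρ κ : n) :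
    (Matrix.of fun τ ν => riem d Γ ρ κ ν τ) = (conn Γ ρ).map (d κ) - (conn Γ κ).map (d ρ)
      + (conn Γ κ * conn Γ ρ - conn Γ ρ * conn Γ κ) := by
  ext τ ν
  simp only [riem, conn, Matrix.of_apply, Matrix.add_apply, Matrix.sub_apply, Matrix.map_apply,
    Matrix.mul_apply, Finset.sum_sub_distrib]
  congr 2 <;> exact Finset.sum_congr rfl fun ι _ => by rw [hΓ τ ι, mul_comm]

/-- Commuting partial derivatives agree on `P`. Since `P` is parallel, each derivative is an action
of connection matrices, and their commutator is the curvature acting on `P`. -/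
theorem riem_antisymm (hd : ∀ μ ν f, d μ (d ν f) = d ν (d μ f))
    (hΓ : ∀ α μ ν, Γ α μ ν = Γ α ν μ) {P : Matrix n n R} (hP : ∀ μ, upD d Γ μ P = 0) (ρ κ : n) :
    (Matrix.of fun τ ν => riem d Γ ρ κ ν τ) * P
      + P * (Matrix.of fun τ ν => riem d Γ ρ κ ν τ)ᵀ = 0 := by
  have e : ∀ μ, P.map (d μ) = -(conn Γ μ * P) - P * (conn Γ μ)ᵀ := fun μ => by
    have := hP μ
    rw [upD_eq] at this
    rw [← sub_eq_zero, ← this]; abel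
  have e2 : (P.map (d κ)).map (d ρ) = (P.map (d ρ)).map (d κ) := by
    ext i j; simp [hd κ ρ]
  have hsub : ∀ (D : Derivation ℂ R R) (A B : Matrix n n R),
      (-A - B).map D = -A.map D - B.map D := fun D A B => by ext i j; simp
  have ht : ∀ (D : Derivation ℂ R R) (A : Matrix n n R), Aᵀ.map D = (A.map D)ᵀ := fun _ _ => rfl
  have e3 : ∀ ρ κ, (P.map (d κ)).map (d ρ)
      = -((conn Γ κ).map (d ρ) * P) + conn Γ κ * (conn Γ ρ * P) + conn Γ κ * (P * (conn Γ ρ)ᵀ)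
        + conn Γ ρ * (P * (conn Γ κ)ᵀ) + P * ((conn Γ ρ)ᵀ * (conn Γ κ)ᵀ)
        - P * ((conn Γ κ).map (d ρ))ᵀ := fun ρ κ => by
    rw [e κ, hsub, map_mul_derivation, map_mul_derivation, e ρ, ht]
    noncomm_ring
  rw [e3, e3] at e2
  rw [riem_matrix hΓ]
  simp only [Matrix.transpose_add, Matrix.transpose_sub, Matrix.transpose_mul]
  rw [← sub_eq_zero] at e2
  rw [← e2]
  noncomm_ring

/-- Antisymmetry in each index pair of the curvature moves this contraction onto the one that
defines Ricci. -/
theorem contract_riem [DecidableEq n] (hd : ∀ μ ν f, d μ (d ν f) = d ν (d μ f))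
    (hΓ : ∀ α μ ν, Γ α μ ν = Γ α ν μ) {P : Matrix n n R} (hPt : Pᵀ = P)
    (hP : ∀ μ, upD d Γ μ P = 0) (ρ κ : n) :
    ∑ μ, ∑ ν, P μ ν * riem d Γ μ ρ ν κ = (ric d Γ * P) ρ κ := by
  have hs : ∀ i j, P i j = P j i := fun i j => congrFun (congrFun hPt j) i
  have h1 : ∀ μ, ∑ ν, P μ ν * riem d Γ μ ρ ν κ = ∑ ν, riem d Γ ρ μ ν μ * P ν κ := fun μ => by
    have := congrFun (congrFun (riem_antisymm hd hΓ hP μ ρ) μ) κ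
    simp only [Matrix.add_apply, Matrix.mul_apply, Matrix.transpose_apply, Matrix.of_apply,
      Matrix.zero_apply] at this
    rw [eq_neg_of_add_eq_zero_right this, ← Finset.sum_neg_distrib]
    refine Finset.sum_congr rfl fun ν _ => ?_
    have : riem d Γ ρ μ ν μ = -riem d Γ μ ρ ν μ := by
      simp only [riem, Finset.sum_sub_distrib]; ring
    rw [this]; ring
  simp only [h1, Matrix.mul_apply, ric, Matrix.of_apply, Finset.sum_mul]
  exact Finset.sum_comm

/-- The Ricci identity for the covector `df`; absence of torsion removes the remaining connection
terms. -/
theorem lowD_hess_sub (hd : ∀ μ ν f, d μ (d ν f) = d ν (d μ f))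
    (hΓ : ∀ α μ ν, Γ α μ ν = Γ α ν μ) (f : R) (τ ρ μ : n) :
    lowD d Γ τ (hess d Γ f) ρ μ - lowD d Γ ρ (hess d Γ f) τ μ
      = ∑ κ, riem d Γ τ ρ μ κ * d κ f := by
  have e : ∀ τ ρ, ∑ κ, Γ κ τ μ * hess d Γ f ρ κ
      = ∑ κ, Γ κ τ μ * d ρ (d κ f) - ∑ κ, ∑ ι, Γ ι τ μ * Γ κ ι ρ * d κ f := fun τ ρ => by
    simp only [hess, cov, grad, Matrix.of_apply, mul_sub, Finset.sum_sub_distrib, Finset.mul_sum]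
    congr 1
    rw [Finset.sum_comm]
    refine Finset.sum_congr rfl fun κ _ => Finset.sum_congr rfl fun ι _ => ?_
    rw [hΓ κ ι ρ, mul_assoc]
  have e2 : ∀ τ ρ, d τ (hess d Γ f ρ μ) = d τ (d ρ (d μ f)) - ∑ κ, Γ κ ρ μ * d τ (d κ f)
      - ∑ κ, d τ (Γ κ ρ μ) * d κ f := fun τ ρ => by
    simp only [hess, cov, grad, Matrix.of_apply, map_sub, map_sum, Derivation.leibniz, smul_eq_mul,
      Finset.sum_add_distrib]
    simp only [mul_comm (d _ f)]
    ring
  simp only [lowD, Matrix.of_apply, e, e2, riem, add_mul, sub_mul, Finset.sum_mul,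
    Finset.sum_add_distrib, Finset.sum_sub_distrib]
  rw [hd τ ρ]
  simp only [hΓ _ τ ρ]
  ring

/-- The divergence of the Hessian: exchanging the outer derivative with a Hessian index costs a
curvature term, which contracts to Ricci, and leaves the derivative of the trace `□f`. -/
theorem contract_lowD_hess [DecidableEq n] (hd : ∀ μ ν f, d μ (d ν f) = d ν (d μ f))
    (hΓ : ∀ α μ ν, Γ α μ ν = Γ α ν μ) {P : Matrix n n R} (hPt : Pᵀ = P)
    (hP : ∀ μ, upD d Γ μ P = 0) (f : R) (w : n → R) :
    ∑ μ, (P *ᵥ (lowD d Γ μ (hess d Γ f) *ᵥ w)) μ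
      = grad d (lap d Γ P f) ⬝ᵥ w + w ⬝ᵥ (ric d Γ * P) *ᵥ grad d f := by
  have hK := hess_symm_apply (d := d) (Γ := Γ) hd hΓ f
  have hK2 : ∀ μ ν ρ, lowD d Γ μ (hess d Γ f) ν ρ = lowD d Γ μ (hess d Γ f) ρ ν :=
    fun μ ν ρ => by
    simp only [lowD, Matrix.of_apply]
    rw [hK ν ρ]
    simp only [hK _ ρ, hK ν]
    ring
  have hL : ∀ ρ, d ρ (lap d Γ P f) = ∑ μ, ∑ ν, P μ ν * lowD d Γ ρ (hess d Γ f) μ ν := fun ρ => by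
    rw [lap_eq_trace hd hΓ, trace_upD_mul d Γ, hP]
    rw [Matrix.zero_mul, Matrix.trace_zero, zero_add]
    simp only [Matrix.trace, Matrix.diag_apply, Matrix.mul_apply]
    exact Finset.sum_congr rfl fun μ _ => Finset.sum_congr rfl fun ν _ => by rw [hK2]
  have hR : ∀ μ ν ρ, lowD d Γ μ (hess d Γ f) ν ρ = lowD d Γ ρ (hess d Γ f) μ ν
      + ∑ κ, riem d Γ μ ρ ν κ * d κ f := fun μ ν ρ => by
    rw [hK2, ← lowD_hess_sub hd hΓ]
    ring
  have h1 : ∑ μ, (P *ᵥ (lowD d Γ μ (hess d Γ f) *ᵥ w)) μ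
      = ∑ ρ, (∑ μ, ∑ ν, P μ ν * lowD d Γ μ (hess d Γ f) ν ρ) * w ρ := by
    simp only [mulVec, dotProduct, Finset.mul_sum, Finset.sum_mul, ← mul_assoc]
    rw [sum_rotate]
  rw [h1]
  have h0 : ∀ ρ, ∑ μ, ∑ ν, P μ ν * lowD d Γ μ (hess d Γ f) ν ρ = d ρ (lap d Γ P f)
      + ∑ μ, ∑ ν, P μ ν * ∑ κ, riem d Γ μ ρ ν κ * d κ f := fun ρ => by
    rw [hL]
    simp only [← Finset.sum_add_distrib, ← mul_add]
    exact Finset.sum_congr rfl fun μ _ => Finset.sum_congr rfl fun ν _ => by rw [hR]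
  simp only [h0, add_mul, Finset.sum_add_distrib]
  congr 1
  rw [dotProduct]
  refine Finset.sum_congr rfl fun ρ _ => ?_
  rw [mul_comm]
  congr 1
  have h2 : ((ric d Γ * P) *ᵥ grad d f) ρ = ∑ κ, (ric d Γ * P) ρ κ * d κ f := rfl
  rw [h2]
  simp only [← contract_riem hd hΓ hPt hP ρ, Finset.mul_sum, Finset.sum_mul, ← mul_assoc]
  rw [sum_rotate]

/-- A Bochner type identity: the difference of the two quadratic invariants of the Hessian of `f`
is a divergence, up to curvature and to derivatives of `H`. -/
theorem hess_bochner [DecidableEq n] (hd : ∀ μ ν f, d μ (d ν f) = d ν (d μ f))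
    (hΓ : ∀ α μ ν, Γ α μ ν = Γ α ν μ) {P : Matrix n n R} (hPt : Pᵀ = P)
    (hP : ∀ μ, upD d Γ μ P = 0) (f : R) (H : Matrix n n R) :
    lap d Γ P f * (H * hess d Γ f).trace - (P * hess d Γ f * H * hess d Γ f).trace
      = divg d Γ (lap d Γ P f • (H *ᵥ grad d f)) - divg d Γ ((P * hess d Γ f * H) *ᵥ grad d f)
        + (H *ᵥ grad d f) ⬝ᵥ (ric d Γ * P) *ᵥ grad d f
        - lap d Γ P f * ∑ μ, (upD d Γ μ H *ᵥ grad d f) μ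
        + ∑ μ, (P *ᵥ (hess d Γ f *ᵥ (upD d Γ μ H *ᵥ grad d f))) μ := by
  have hK := hess_symm (d := d) (Γ := Γ) hd hΓ f
  have h1 : ∀ M : Matrix n n R, ∑ μ, (M *ᵥ cov d Γ (grad d f) μ) μ = (M * hess d Γ f).trace :=
    fun M => by
    refine Finset.sum_congr rfl fun μ _ => ?_
    rw [Matrix.diag_apply, Matrix.mul_apply]
    refine Finset.sum_congr rfl fun ν _ => ?_
    rw [hess_symm_apply hd hΓ, hess]
  -- Both divergences contain the third-order term `d(□f)` paired with `H df`. It cancels in their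
  -- difference and leaves Ricci.
  have h2 := contract_lowD_hess hd hΓ hPt hP f (H *ᵥ grad d f)
  have h3 : ∑ μ, (upD d Γ μ (P * hess d Γ f * H) *ᵥ grad d f) μ
      = ∑ μ, (P *ᵥ (lowD d Γ μ (hess d Γ f) *ᵥ (H *ᵥ grad d f))) μ
        + ∑ μ, (P *ᵥ (hess d Γ f *ᵥ (upD d Γ μ H *ᵥ grad d f))) μ := by
    rw [← Finset.sum_add_distrib]
    refine Finset.sum_congr rfl fun μ _ => ?_
    rw [upD_mul, hP]
    simp only [Matrix.zero_mul, zero_add, Matrix.add_mulVec, Matrix.mulVec_mulVec, Pi.add_apply,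
      Matrix.mul_assoc]
  rw [divg_smul, divg_mulVec, divg_mulVec, h1, h1, h3, h2]
  ring

end Curvature

/-! ### Sums over the embedding functions -/

section Embedding
variable {R : Type*} [CommRing R] [Algebra ℂ R] {n : Type*} [Fintype n] [DecidableEq n]
  {ι : Type*} [Fintype ι]

/-- `Γ` is a torsion free connection for which the inverse metric `P` is parallel. -/
structure MetricConnection (d : n → Derivation ℂ R R) (Γ : n → n → n → R) (P : Matrix n n R) :
    Prop where
  comm : ∀ μ ν f, d μ (d ν f) = d ν (d μ f)
  torsion : ∀ α μ ν, Γ α μ ν = Γ α ν μ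
  symm : Pᵀ = P
  parallel : ∀ μ, upD d Γ μ P = 0

/-- The metric `∑ c_a ∂_μ x^a ∂_ν x^a`. -/
def indMet (d : n → Derivation ℂ R R) (c : ι → ℂ) (X : ι → R) : Matrix n n R :=
  ∑ a, c a • vecMulVec (grad d (X a)) (grad d (X a))

theorem trace_mul_vecMulVec (M : Matrix n n R) (u w : n → R) :
    (M * vecMulVec u w).trace = w ⬝ᵥ M *ᵥ u := by
  rw [mul_vecMulVec, trace_vecMulVec, dotProduct_comm]

theorem indMet_transpose (d : n → Derivation ℂ R R) (c : ι → ℂ) (X : ι → R) :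
    (indMet d c X)ᵀ = indMet d c X := by
  simp [indMet, Matrix.transpose_sum, Matrix.transpose_smul, transpose_vecMulVec]

theorem sum_dotProduct_mulVec_grad (d : n → Derivation ℂ R R) (c : ι → ℂ) (X : ι → R)
    (M : Matrix n n R) :
    ∑ a, c a • (grad d (X a) ⬝ᵥ M *ᵥ grad d (X a)) = (M * indMet d c X).trace := by
  simp only [indMet, Matrix.mul_sum, Matrix.trace_sum, Matrix.mul_smul, Matrix.trace_smul,
    trace_mul_vecMulVec]

/-- The elimination rule for Latin indices: a repeated index on two gradients is replaced by the
induced metric. -/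
theorem sum_smul_grad (d : n → Derivation ℂ R R) (c : ι → ℂ) (X : ι → R) (u : n → R) :
    ∑ a, c a • ((u ⬝ᵥ grad d (X a)) • grad d (X a)) = indMet d c X *ᵥ u := by
  simp only [indMet, Matrix.sum_mulVec, Matrix.smul_mulVec, vecMulVec_mulVec]
  refine Finset.sum_congr rfl fun a _ => ?_
  rw [dotProduct_comm u, op_smul_eq_smul]

theorem mulVec_dotProduct (M : Matrix n n R) (u w : n → R) :
    (M *ᵥ u) ⬝ᵥ w = u ⬝ᵥ Mᵀ *ᵥ w := by
  rw [dotProduct_comm, dotProduct_mulVec, ← mulVec_transpose, dotProduct_comm]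

variable {d : n → Derivation ℂ R R} {Γ : n → n → n → R} {P : Matrix n n R}

theorem lowD_smul_const (μ : n) (c : ℂ) (T : Matrix n n R) :
    lowD d Γ μ (c • T) = c • lowD d Γ μ T := by
  ext α β
  simp [lowD, smul_sub, Finset.smul_sum]

theorem lowD_sum (μ : n) (T : ι → Matrix n n R) :
    lowD d Γ μ (∑ a, T a) = ∑ a, lowD d Γ μ (T a) := by
  have : (∑ a, T a).map (d μ) = ∑ a, (T a).map (d μ) := by
    ext i j; simp [Matrix.sum_apply]
  simp only [lowD_eq, this, Matrix.mul_sum, Matrix.sum_mul, Finset.sum_sub_distrib]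

theorem lowD_vecMulVec (μ : n) (u w : n → R) :
    lowD d Γ μ (vecMulVec u w) = vecMulVec (cov d Γ u μ) w + vecMulVec u (cov d Γ w μ) := by
  ext α β
  simp only [lowD, cov, vecMulVec_apply, Matrix.of_apply, Matrix.add_apply, Derivation.leibniz,
    smul_eq_mul, sub_mul, mul_sub, Finset.sum_mul, Finset.mul_sum, mul_assoc, mul_left_comm (u α)]
  ring

/-- The contribution of one coordinate to the derivative of the induced metric. -/
def symK (d : n → Derivation ℂ R R) (Γ : n → n → n → R) (f : R) (μ : n) : Matrix n n R :=
  vecMulVec (hess d Γ f μ) (grad d f) + vecMulVec (grad d f) (hess d Γ f μ)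

theorem lowD_indMet (c : ι → ℂ) (X : ι → R) (μ : n) :
    lowD d Γ μ (indMet d c X) = ∑ a, c a • symK d Γ (X a) μ := by
  simp only [indMet, lowD_sum, lowD_smul_const, lowD_vecMulVec, symK, hess]

theorem lowD_transpose (μ : n) (T : Matrix n n R) :
    (lowD d Γ μ T)ᵀ = lowD d Γ μ Tᵀ := by
  have : Tᵀ.map (d μ) = (T.map (d μ))ᵀ := rfl
  rw [lowD_eq, lowD_eq, this]
  simp only [Matrix.transpose_sub, Matrix.transpose_mul, Matrix.transpose_transpose]
  abel

theorem upD_sandwich (h : MetricConnection d Γ P) (μ : n) (T : Matrix n n R) :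
    upD d Γ μ (P * T * P) = P * lowD d Γ μ T * P := by
  rw [upD_mul, h.parallel]
  simp

theorem grad_inner (h : MetricConnection d Γ P) (f k : R) :
    grad d (grad d f ⬝ᵥ P *ᵥ grad d k)
      = hess d Γ f *ᵥ (P *ᵥ grad d k) + hess d Γ k *ᵥ (P *ᵥ grad d f) := by
  ext μ
  have h1 := derivation_mulVec_cov d Γ P (grad d k) μ
  rw [h.parallel, Matrix.zero_mulVec, zero_add] at h1
  have h2 : d μ ∘ grad d f = hess d Γ f μ + (conn Γ μ)ᵀ *ᵥ grad d f := by
    ext ν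
    simp [hess, cov, conn, mulVec, dotProduct, grad]
  change d μ _ = _
  rw [derivation_dotProduct, h2, eq_sub_of_add_eq h1, dotProduct_sub, add_dotProduct,
    mulVec_dotProduct, Matrix.transpose_transpose]
  simp only [Pi.add_apply]
  have h3 : grad d f ⬝ᵥ P *ᵥ hess d Γ k μ = (hess d Γ k *ᵥ (P *ᵥ grad d f)) μ := by
    rw [dotProduct_comm, mulVec_dotProduct, h.symm]
    rfl
  change _ + (grad d f ⬝ᵥ P *ᵥ hess d Γ k μ - _) = _
  rw [h3]
  change _ = hess d Γ f μ ⬝ᵥ (P *ᵥ grad d k) + _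
  ring

/-- `(GgGg)` as a double sum over the embedding functions. -/
theorem sum_inner_sq (h : MetricConnection d Γ P) (c : ι → ℂ) (X : ι → R) :
    ∑ a, ∑ b, (c a * c b) • ((grad d (X a) ⬝ᵥ P *ᵥ grad d (X b))
      * (grad d (X a) ⬝ᵥ P *ᵥ grad d (X b)))
      = (P * indMet d c X * P * indMet d c X).trace := by
  rw [← sum_dotProduct_mulVec_grad]
  refine Finset.sum_congr rfl fun a _ => ?_
  simp only [mul_smul, ← Finset.smul_sum]
  congr 1
  have h1 : ∀ b, (grad d (X a) ⬝ᵥ P *ᵥ grad d (X b)) * (grad d (X a) ⬝ᵥ P *ᵥ grad d (X b))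
      = (P *ᵥ grad d (X a)) ⬝ᵥ (((P *ᵥ grad d (X a)) ⬝ᵥ grad d (X b)) • grad d (X b)) :=
    fun b => by
    rw [dotProduct_smul, mulVec_dotProduct, h.symm, smul_eq_mul]
  have h2 : ∀ b, c b • ((P *ᵥ grad d (X a)) ⬝ᵥ (((P *ᵥ grad d (X a)) ⬝ᵥ grad d (X b))
      • grad d (X b))) = (P *ᵥ grad d (X a)) ⬝ᵥ (c b • (((P *ᵥ grad d (X a)) ⬝ᵥ grad d (X b))
      • grad d (X b))) := fun b => (dotProduct_smul (c b) _ _).symm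
  simp only [h1]
  simp only [h2]
  rw [← dotProduct_sum, sum_smul_grad, mulVec_dotProduct, h.symm]
  simp only [Matrix.mulVec_mulVec, Matrix.mul_assoc]

/-- `∑_a ∇_μ∂_α x^a ∂_β x_a ∇^μ∂^β x^b ∂^α x_b`. -/
def tau (d : n → Derivation ℂ R R) (Γ : n → n → n → R) (P : Matrix n n R) (c : ι → ℂ)
    (X : ι → R) : R :=
  ∑ a, ∑ b, (c a * c b) • ((hess d Γ (X a) *ᵥ (P *ᵥ grad d (X b)))
    ⬝ᵥ P *ᵥ (hess d Γ (X b) *ᵥ (P *ᵥ grad d (X a))))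

/-- Each `dG^{ab}` is `K_a` applied to the gradient of `x^b` plus the same with `a` and `b`
exchanged. The two squares give the trace sum, their product gives `tau`. -/
theorem sum_grad_inner_sq (h : MetricConnection d Γ P) (c : ι → ℂ) (X : ι → R) :
    ∑ a, ∑ b, (c a * c b) • (grad d (grad d (X a) ⬝ᵥ P *ᵥ grad d (X b))
      ⬝ᵥ P *ᵥ grad d (grad d (X a) ⬝ᵥ P *ᵥ grad d (X b)))
      = 2 * ∑ a, c a • (P * hess d Γ (X a) * (P * indMet d c X * P) * hess d Γ (X a)).trace
        + 2 * tau d Γ P c X := by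
  have hK := fun f => hess_symm (d := d) (Γ := Γ) h.comm h.torsion f
  set A : ι → ι → R := fun a b => (hess d Γ (X a) *ᵥ (P *ᵥ grad d (X b)))
    ⬝ᵥ P *ᵥ (hess d Γ (X a) *ᵥ (P *ᵥ grad d (X b))) with hA
  set B : ι → ι → R := fun a b => (hess d Γ (X a) *ᵥ (P *ᵥ grad d (X b)))
    ⬝ᵥ P *ᵥ (hess d Γ (X b) *ᵥ (P *ᵥ grad d (X a))) with hB
  have h1 : ∀ a b, grad d (grad d (X a) ⬝ᵥ P *ᵥ grad d (X b))
      ⬝ᵥ P *ᵥ grad d (grad d (X a) ⬝ᵥ P *ᵥ grad d (X b)) = A a b + A b a + 2 * B a b :=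
    fun a b => by
    rw [grad_inner h, Matrix.mulVec_add, add_dotProduct, dotProduct_add, dotProduct_add]
    have : (hess d Γ (X b) *ᵥ (P *ᵥ grad d (X a)))
        ⬝ᵥ P *ᵥ (hess d Γ (X a) *ᵥ (P *ᵥ grad d (X b))) = B a b := by
      rw [dotProduct_comm, mulVec_dotProduct, h.symm]
    rw [this]
    simp only [hA, hB]
    ring
  have h2 : ∑ a, ∑ b, (c a * c b) • A a b
      = ∑ a, c a • (P * hess d Γ (X a) * (P * indMet d c X * P) * hess d Γ (X a)).trace := by
    refine Finset.sum_congr rfl fun a _ => ?_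
    simp only [mul_smul, ← Finset.smul_sum]
    congr 1
    have : ∀ b, A a b = grad d (X b) ⬝ᵥ (P * hess d Γ (X a) * P * hess d Γ (X a) * P)
        *ᵥ grad d (X b) := fun b => by
      simp only [hA]
      rw [mulVec_dotProduct, mulVec_dotProduct, h.symm, hK]
      simp only [Matrix.mulVec_mulVec, Matrix.mul_assoc]
    simp only [this, sum_dotProduct_mulVec_grad]
    have e1 := Matrix.trace_mul_comm (P * hess d Γ (X a)) (P * indMet d c X * P * hess d Γ (X a))
    have e2 := Matrix.trace_mul_comm (P * hess d Γ (X a) * P * hess d Γ (X a)) (P * indMet d c X)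
    simp only [Matrix.mul_assoc] at e1 e2 ⊢
    rw [e1, e2]
  have h3 : ∑ a, ∑ b, (c a * c b) • A b a = ∑ a, ∑ b, (c a * c b) • A a b := by
    rw [Finset.sum_comm]
    simp only [mul_comm]
  simp only [h1, smul_add, Finset.sum_add_distrib, h3, h2, tau, ← mul_smul_comm, ← Finset.mul_sum]
  simp only [hB]
  ring

theorem lap_smul_sum {κ : Type*} [Fintype κ] (h : MetricConnection d Γ P) (c : κ → ℂ)
    (f : κ → R) : lap d Γ P (∑ a, c a • f a) = ∑ a, c a • lap d Γ P (f a) := by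
  have : ∀ a, lap d Γ P (f a) = divg d Γ (P *ᵥ grad d (f a)) := fun a =>
    lap_eq_divg h.parallel _
  rw [lap_eq_divg h.parallel]
  simp only [this]
  rw [← divg_sum]
  congr 1
  have : grad d (∑ a, c a • f a) = ∑ a, c a • grad d (f a) := by
    ext μ; simp [grad]
  rw [this, Matrix.mulVec_sum]
  simp only [Matrix.mulVec_smul]

/-- The product rule gives `2 G□G = □(G²) - 2|dG|²`, and `∑ G² = S`. The terms with derivatives of
`E` assemble into derivatives of `S` in the same way. -/
theorem sum_inner_mul_lap (h : MetricConnection d Γ P) (c : ι → ℂ) (X : ι → R) (E : R) :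
    2 * ∑ a, ∑ b, (c a * c b) • ((grad d (X a) ⬝ᵥ P *ᵥ grad d (X b))
        * lap d Γ P (E * (grad d (X a) ⬝ᵥ P *ᵥ grad d (X b))))
      = 2 * ((P * indMet d c X * P * indMet d c X).trace * lap d Γ P E)
        + 2 * (grad d E ⬝ᵥ P *ᵥ grad d (P * indMet d c X * P * indMet d c X).trace)
        + E * (lap d Γ P (P * indMet d c X * P * indMet d c X).trace
          - 4 * ∑ a, c a • (P * hess d Γ (X a) * (P * indMet d c X * P) * hess d Γ (X a)).trace
          - 4 * tau d Γ P c X) := by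
  have hs := sum_inner_sq h c X
  have hg := sum_grad_inner_sq h c X
  set G : ι → ι → R := fun a b => grad d (X a) ⬝ᵥ P *ᵥ grad d (X b)
  set S := (P * indMet d c X * P * indMet d c X).trace
  change ∑ a, ∑ b, (c a * c b) • (G a b * G a b) = S at hs
  change ∑ a, ∑ b, (c a * c b) • (grad d (G a b) ⬝ᵥ P *ᵥ grad d (G a b)) = _ at hg
  change 2 * ∑ a, ∑ b, (c a * c b) • (G a b * lap d Γ P (E * G a b)) = _
  have hs' : ∑ p : ι × ι, (c p.1 * c p.2) • (G p.1 p.2 * G p.1 p.2) = S := by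
    rw [Fintype.sum_prod_type]; exact hs
  have hg' := hg
  rw [← Fintype.sum_prod_type' (f := fun a b => (c a * c b) • (grad d (G a b)
    ⬝ᵥ P *ᵥ grad d (G a b)))] at hg'
  rw [← Fintype.sum_prod_type' (f := fun a b => (c a * c b) • (G a b * lap d Γ P (E * G a b)))]
  have e1 : grad d S = ∑ p : ι × ι, (c p.1 * c p.2) • ((2 * G p.1 p.2) • grad d (G p.1 p.2)) := by
    rw [← hs']
    ext μ
    simp only [grad, map_sum, Finset.sum_apply, Pi.smul_apply, Derivation.map_smul,
      Derivation.leibniz, smul_eq_mul]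
    exact Finset.sum_congr rfl fun p _ => by ring_nf
  have e2 : lap d Γ P S = ∑ p : ι × ι, (c p.1 * c p.2) • (2 * (G p.1 p.2 * lap d Γ P (G p.1 p.2))
      + 2 * (grad d (G p.1 p.2) ⬝ᵥ P *ᵥ grad d (G p.1 p.2))) := by
    rw [← hs', lap_smul_sum h]
    refine Finset.sum_congr rfl fun p _ => ?_
    rw [lap_mul h.symm h.parallel]
    ring_nf
  have e3 : ∀ a b, G a b * lap d Γ P (E * G a b) = G a b * G a b * lap d Γ P E
      + grad d E ⬝ᵥ P *ᵥ ((2 * G a b) • grad d (G a b)) + E * (G a b * lap d Γ P (G a b)) :=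
    fun a b => by
    rw [lap_mul h.symm h.parallel, Matrix.mulVec_smul, dotProduct_smul, smul_eq_mul]
    ring
  simp only [e3, smul_add, Finset.sum_add_distrib]
  have e4 : ∑ p : ι × ι, (c p.1 * c p.2) • (G p.1 p.2 * G p.1 p.2 * lap d Γ P E)
      = S * lap d Γ P E := by
    rw [← hs', Finset.sum_mul]
    simp only [smul_mul_assoc]
  have e5 : ∑ p : ι × ι, (c p.1 * c p.2) • (grad d E ⬝ᵥ P *ᵥ ((2 * G p.1 p.2)
      • grad d (G p.1 p.2))) = grad d E ⬝ᵥ P *ᵥ grad d S := by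
    rw [e1, Matrix.mulVec_sum, dotProduct_sum]
    simp only [Matrix.mulVec_smul, dotProduct_smul]
  have e6 : ∑ p : ι × ι, (c p.1 * c p.2) • (E * (G p.1 p.2 * lap d Γ P (G p.1 p.2)))
      = E * ∑ p : ι × ι, (c p.1 * c p.2) • (G p.1 p.2 * lap d Γ P (G p.1 p.2)) := by
    simp only [← mul_smul_comm, ← Finset.mul_sum]
  simp only [smul_add, Finset.sum_add_distrib, ← mul_smul_comm, ← Finset.mul_sum] at e2
  rw [e4, e5, e6]
  simp only [mul_smul_comm] at e2
  linear_combination E * (-e2) - 2 * E * hg'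

end Embedding

theorem sum_sum_comm {α β M : Type*} [Fintype α] [Fintype β] [AddCommMonoid M]
    (f : α → α → β → β → M) :
    ∑ i, ∑ j, ∑ k, ∑ l, f i j k l = ∑ k, ∑ l, ∑ i, ∑ j, f i j k l := by
  rw [sum_rotate]
  exact Finset.sum_congr rfl fun k _ => sum_rotate _

/-! ### Summed Bochner identity and quadratic invariants of the derivative of the metric -/

section Embedding
variable {R : Type*} [CommRing R] [Algebra ℂ R] {n : Type*} [Fintype n] [DecidableEq n]
  {ι : Type*} [Fintype ι]
variable {d : n → Derivation ℂ R R} {Γ : n → n → n → R} {P : Matrix n n R}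

/-- `∇_ν g_{μβ} ∇^ν g^{μβ}`, all indices moved with `P`. -/
def normSq (d : n → Derivation ℂ R R) (Γ : n → n → n → R) (P g : Matrix n n R) : R :=
  ∑ μ, ∑ ν, P μ ν * (P * lowD d Γ μ g * P * lowD d Γ ν g).trace

/-- `∇_α g_{μν} ∇^ν g^{μα}`, all indices moved with `P`. -/
def twistSq (d : n → Derivation ℂ R R) (Γ : n → n → n → R) (P g : Matrix n n R) : R :=
  ∑ α, ∑ ρ, (P * lowD d Γ ρ g * P * lowD d Γ α g * P) α ρ

/-- The vector field `∑_a □x_a dx^a`. -/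
def lapGrad (d : n → Derivation ℂ R R) (Γ : n → n → n → R) (P : Matrix n n R) (c : ι → ℂ)
    (X : ι → R) : n → R := ∑ a, c a • (lap d Γ P (X a) • grad d (X a))

theorem dotProduct_mulVec_symm {M : Matrix n n R} (hM : Mᵀ = M) (u w : n → R) :
    u ⬝ᵥ M *ᵥ w = w ⬝ᵥ M *ᵥ u := by
  rw [dotProduct_comm, mulVec_dotProduct, hM]

theorem trace_mul_symK (M : Matrix n n R) (hM : Mᵀ = M) (f : R) (μ : n) :
    (M * symK d Γ f μ).trace = 2 * (hess d Γ f *ᵥ (M *ᵥ grad d f)) μ := by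
  rw [symK, Matrix.mul_add, Matrix.trace_add, trace_mul_vecMulVec, trace_mul_vecMulVec,
    dotProduct_mulVec_symm hM]
  change _ = 2 * (hess d Γ f μ ⬝ᵥ M *ᵥ grad d f)
  ring

theorem trace_mul_lowD_indMet (M : Matrix n n R) (hM : Mᵀ = M) (c : ι → ℂ) (X : ι → R) (μ : n) :
    (M * lowD d Γ μ (indMet d c X)).trace
      = 2 * ∑ a, c a • (hess d Γ (X a) *ᵥ (M *ᵥ grad d (X a))) μ := by
  rw [lowD_indMet]
  simp only [Matrix.trace_sum, Matrix.trace_smul, trace_mul_symK M hM, Finset.mul_sum, mul_smul_comm]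

theorem sandwich_transpose (h : MetricConnection d Γ P) {T : Matrix n n R} (hT : Tᵀ = T) :
    (P * T * P)ᵀ = P * T * P := by
  rw [Matrix.transpose_mul, Matrix.transpose_mul, h.symm, hT, Matrix.mul_assoc]

theorem trace_sq_derivation (h : MetricConnection d Γ P) (g : Matrix n n R) (μ : n) :
    d μ (P * g * P * g).trace = 2 * (P * g * P * lowD d Γ μ g).trace := by
  rw [trace_upD_mul d Γ, upD_sandwich h]
  have := Matrix.trace_mul_comm (P * lowD d Γ μ g) (P * g)
  simp only [Matrix.mul_assoc] at this ⊢
  rw [this]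
  ring

/-- Identifies the second divergence in the summed Bochner identity as a multiple of `□S`. -/
theorem four_smul_sum_hess (h : MetricConnection d Γ P) (c : ι → ℂ) (X : ι → R) :
    (4 : ℂ) • ∑ a, c a • ((P * hess d Γ (X a) * (P * indMet d c X * P)) *ᵥ grad d (X a))
      = P *ᵥ grad d (P * indMet d c X * P * indMet d c X).trace := by
  have h1 : grad d (P * indMet d c X * P * indMet d c X).trace
      = (4 : ℂ) • ∑ a, c a • (hess d Γ (X a) *ᵥ ((P * indMet d c X * P) *ᵥ grad d (X a))) := by
    ext μ
    rw [grad, trace_sq_derivation h, trace_mul_lowD_indMet _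
      (sandwich_transpose h (indMet_transpose d c X))]
    simp only [Pi.smul_apply, Finset.sum_apply]
    rw [Algebra.smul_def, map_ofNat]
    ring
  rw [h1, Matrix.mulVec_smul, Matrix.mulVec_sum]
  simp only [Matrix.mulVec_smul, Matrix.mulVec_mulVec, Matrix.mul_assoc]

theorem normSq_eq (h : MetricConnection d Γ P) (c : ι → ℂ) (X : ι → R) :
    normSq d Γ P (indMet d c X) = 2 * ∑ a, c a • ∑ μ, (P *ᵥ (hess d Γ (X a) *ᵥ
      ((P * lowD d Γ μ (indMet d c X) * P) *ᵥ grad d (X a)))) μ := by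
  have hN : ∀ μ, (lowD d Γ μ (indMet d c X))ᵀ = lowD d Γ μ (indMet d c X) := fun μ => by
    rw [lowD_transpose, indMet_transpose]
  simp only [normSq, trace_mul_lowD_indMet _ (sandwich_transpose h (hN _))]
  simp only [Finset.mul_sum, mul_smul_comm, Finset.smul_sum]
  rw [sum_rotate]
  refine Finset.sum_congr rfl fun a _ => Finset.sum_congr rfl fun μ _ => ?_
  simp only [mul_left_comm _ (2 : R), ← Finset.mul_sum, ← Finset.smul_sum]
  rfl

/-- `hess_bochner` with `H = PgP`, summed over the coordinates. The term `□S` is the one in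
`sum_inner_mul_lap` and drops out of the final combination; the corrections from `∇H` involve only
`∇g` and `V`. -/
theorem sum_hess_bochner (h : MetricConnection d Γ P) (c : ι → ℂ) (X : ι → R) :
    4 * (∑ a, c a • (lap d Γ P (X a) * (P * indMet d c X * P * hess d Γ (X a)).trace)
      - ∑ a, c a • (P * hess d Γ (X a) * (P * indMet d c X * P) * hess d Γ (X a)).trace)
      = 4 * divg d Γ ((P * indMet d c X * P) *ᵥ lapGrad d Γ P c X)
        - lap d Γ P (P * indMet d c X * P * indMet d c X).trace
        + 4 * (ric d Γ * (P * indMet d c X * P * indMet d c X * P)).trace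
        - 4 * ∑ μ, ((P * lowD d Γ μ (indMet d c X) * P) *ᵥ lapGrad d Γ P c X) μ
        + 2 * normSq d Γ P (indMet d c X) := by
  have hg := indMet_transpose d c X
  set g := indMet d c X with hgdef
  have hH := sandwich_transpose h hg
  have e1 : ∀ a, lap d Γ P (X a) * (P * g * P * hess d Γ (X a)).trace
      - (P * hess d Γ (X a) * (P * g * P) * hess d Γ (X a)).trace = _ := fun a =>
    hess_bochner h.comm h.torsion h.symm h.parallel (X a) (P * g * P)
  simp only [← Finset.sum_sub_distrib, ← smul_sub, e1, upD_sandwich h]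
  simp only [smul_add, smul_sub, Finset.sum_add_distrib, Finset.sum_sub_distrib]
  have e2 : ∑ a, c a • divg d Γ (lap d Γ P (X a) • ((P * g * P) *ᵥ grad d (X a)))
      = divg d Γ ((P * g * P) *ᵥ lapGrad d Γ P c X) := by
    rw [← divg_sum, lapGrad, Matrix.mulVec_sum]
    simp only [Matrix.mulVec_smul]
  have e3 : 4 * ∑ a, c a • divg d Γ ((P * hess d Γ (X a) * (P * g * P)) *ᵥ grad d (X a))
      = lap d Γ P (P * g * P * g).trace := by
    rw [← divg_sum, lap_eq_divg h.parallel, ← four_smul_sum_hess h c X]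
    have := divg_sum d Γ (univ : Finset Unit) (fun _ => (4 : ℂ))
      (fun _ => ∑ a, c a • ((P * hess d Γ (X a) * (P * g * P)) *ᵥ grad d (X a)))
    simp only [Finset.univ_unique, Finset.sum_singleton] at this
    rw [this, Algebra.smul_def, map_ofNat]
  have e4 : ∑ a, c a • (((P * g * P) *ᵥ grad d (X a)) ⬝ᵥ (ric d Γ * P) *ᵥ grad d (X a))
      = (ric d Γ * (P * g * P * g * P)).trace := by
    simp only [mulVec_dotProduct, hH, Matrix.mulVec_mulVec]
    rw [sum_dotProduct_mulVec_grad, ← hgdef]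
    have := Matrix.trace_mul_comm (P * g * P) (ric d Γ * P * g)
    simp only [Matrix.mul_assoc] at this ⊢
    exact this
  have e5 : ∑ a, c a • (lap d Γ P (X a) * ∑ μ, ((P * lowD d Γ μ g * P) *ᵥ grad d (X a)) μ)
      = ∑ μ, ((P * lowD d Γ μ g * P) *ᵥ lapGrad d Γ P c X) μ := by
    simp only [lapGrad, Matrix.mulVec_sum, Matrix.mulVec_smul, Finset.sum_apply, Pi.smul_apply,
      Finset.mul_sum, Finset.smul_sum, smul_eq_mul]
    rw [Finset.sum_comm]
  have e6 := normSq_eq h c X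
  rw [← hgdef] at e6
  rw [e2, e4, e5, e6]
  linear_combination -e3

theorem symK_transpose (f : R) (μ : n) : (symK d Γ f μ)ᵀ = symK d Γ f μ := by
  rw [symK, Matrix.transpose_add, transpose_vecMulVec, transpose_vecMulVec, add_comm]

theorem sum_trace_symK (h : MetricConnection d Γ P) (f k : R) :
    ∑ μ, ∑ ν, P μ ν * (P * symK d Γ f μ * P * symK d Γ k ν).trace
      = 2 * ((grad d f ⬝ᵥ P *ᵥ grad d k) * (P * hess d Γ f * (P * hess d Γ k)).trace)
        + 2 * ((hess d Γ f *ᵥ (P *ᵥ grad d k)) ⬝ᵥ P *ᵥ (hess d Γ k *ᵥ (P *ᵥ grad d f))) := by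
  have hK := fun f => hess_symm (d := d) (Γ := Γ) h.comm h.torsion f
  have e2 : ∀ μ, (P * symK d Γ f μ * P) *ᵥ grad d k
      = (grad d f ⬝ᵥ P *ᵥ grad d k) • (P *ᵥ hess d Γ f μ)
        + (hess d Γ f *ᵥ (P *ᵥ grad d k)) μ • (P *ᵥ grad d f) := fun μ => by
    rw [symK, Matrix.mul_assoc, ← Matrix.mulVec_mulVec, ← Matrix.mulVec_mulVec,
      Matrix.add_mulVec, vecMulVec_mulVec, vecMulVec_mulVec, op_smul_eq_smul, op_smul_eq_smul,
      Matrix.mulVec_add, Matrix.mulVec_smul, Matrix.mulVec_smul]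
    rfl
  simp only [trace_mul_symK _ (sandwich_transpose h (symK_transpose f _)), e2, Matrix.mulVec_add,
    Matrix.mulVec_smul, Pi.add_apply, Pi.smul_apply, smul_eq_mul, mul_add, Finset.sum_add_distrib]
  congr 1
  · have : ∀ μ ν, (hess d Γ k *ᵥ (P *ᵥ hess d Γ f μ)) ν = (hess d Γ k * (P * hess d Γ f)) ν μ :=
      fun μ ν => by
      rw [Matrix.mulVec_mulVec, ← Matrix.mul_assoc, Matrix.mul_apply]
      conv_rhs => rw [← hK f]
      rfl
    rw [Matrix.trace_mul_comm, Matrix.mul_assoc, Matrix.trace, Finset.mul_sum, Finset.mul_sum]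
    refine Finset.sum_congr rfl fun μ _ => ?_
    rw [Matrix.diag_apply, Matrix.mul_apply, Finset.mul_sum, Finset.mul_sum]
    refine Finset.sum_congr rfl fun ν _ => ?_
    rw [this]
    ring
  · simp only [dotProduct, mulVec, Finset.mul_sum]
    refine Finset.sum_congr rfl fun μ _ => Finset.sum_congr rfl fun ν _ => ?_
    simp only [← Finset.mul_sum]
    ring

theorem sum_apply_symK (h : MetricConnection d Γ P) (f k : R) :
    ∑ α, ∑ ρ, (P * symK d Γ f ρ * P * symK d Γ k α * P) α ρ
      = (grad d f ⬝ᵥ P *ᵥ grad d k) * (P * hess d Γ f * (P * hess d Γ k)).trace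
        + 3 * ((hess d Γ f *ᵥ (P *ᵥ grad d k)) ⬝ᵥ P *ᵥ (hess d Γ k *ᵥ (P *ᵥ grad d f))) := by
  have hK := fun f => hess_symm (d := d) (Γ := Γ) h.comm h.torsion f
  have hPK : ∀ f ρ α, (P *ᵥ hess d Γ f ρ) α = (P * hess d Γ f) α ρ := fun f ρ α => by
    rw [Matrix.mul_apply]
    conv_rhs => rw [← hK f]
    rfl
  have e1 : ∀ (x y z w : n → R) (α ρ : n), (P * vecMulVec x y * P * vecMulVec z w * P) α ρ
      = (y ⬝ᵥ P *ᵥ z) * (P *ᵥ x) α * (P *ᵥ w) ρ := fun x y z w α ρ => by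
    have : P * vecMulVec x y * P * vecMulVec z w * P
        = (y ⬝ᵥ P *ᵥ z) • vecMulVec (P *ᵥ x) (P *ᵥ w) := by
      rw [mul_vecMulVec, vecMulVec_mul, ← Matrix.mulVec_mulVec, ← Matrix.mulVec_mulVec,
        vecMulVec_mulVec, op_smul_eq_smul, Matrix.mulVec_smul, smul_vecMulVec, ← mulVec_transpose,
        h.symm]
    rw [this, Matrix.smul_apply, vecMulVec_apply, smul_eq_mul, mul_assoc]
  set b := hess d Γ f *ᵥ (P *ᵥ grad d k) with hb
  set a := hess d Γ k *ᵥ (P *ᵥ grad d f) with ha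
  have hab : b ⬝ᵥ P *ᵥ a = a ⬝ᵥ P *ᵥ b := dotProduct_mulVec_symm h.symm _ _
  have hba : ∀ ρ, hess d Γ f ρ ⬝ᵥ P *ᵥ grad d k = b ρ := fun ρ => rfl
  have haa : ∀ α, grad d f ⬝ᵥ P *ᵥ hess d Γ k α = a α := fun α =>
    dotProduct_mulVec_symm h.symm _ _
  have hKK : ∀ ρ α, hess d Γ f ρ ⬝ᵥ P *ᵥ hess d Γ k α = (hess d Γ f * (P * hess d Γ k)) ρ α :=
    fun ρ α => by
    rw [Matrix.mul_apply, dotProduct]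
    simp only [hPK]
  simp only [symK, Matrix.mul_add, Matrix.add_mul, Matrix.add_apply, e1, Finset.sum_add_distrib,
    hba, haa, hKK]
  have t1 : ∑ α, ∑ ρ, a α * (P *ᵥ hess d Γ f ρ) α * (P *ᵥ grad d k) ρ = b ⬝ᵥ P *ᵥ a := by
    rw [hab, hb, Matrix.mulVec_mulVec]
    simp only [hPK]
    simp only [mul_assoc, ← Finset.mul_sum]
    rfl
  have t2 : ∑ α, ∑ ρ, (grad d f ⬝ᵥ P *ᵥ grad d k) * (P *ᵥ hess d Γ f ρ) α
      * (P *ᵥ hess d Γ k α) ρ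
      = (grad d f ⬝ᵥ P *ᵥ grad d k) * (P * hess d Γ f * (P * hess d Γ k)).trace := by
    simp only [hPK, mul_assoc (grad d f ⬝ᵥ P *ᵥ grad d k), ← Finset.mul_sum]
    rfl
  have t3 : ∑ α, ∑ ρ, (hess d Γ f * (P * hess d Γ k)) ρ α * (P *ᵥ grad d f) α
      * (P *ᵥ grad d k) ρ = b ⬝ᵥ P *ᵥ a := by
    rw [hb, mulVec_dotProduct, hK, ha, Matrix.mulVec_mulVec, Matrix.mulVec_mulVec, Finset.sum_comm,
      Matrix.mul_assoc, dotProduct]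
    refine Finset.sum_congr rfl fun ρ _ => ?_
    rw [← Finset.sum_mul, mul_comm]
    rfl
  have t4 : ∑ α, ∑ ρ, b ρ * (P *ᵥ grad d f) α * (P *ᵥ hess d Γ k α) ρ = b ⬝ᵥ P *ᵥ a := by
    rw [ha, Matrix.mulVec_mulVec, Finset.sum_comm]
    simp only [hPK]
    simp only [mul_comm (_ * _) ((P * hess d Γ k) _ _), mul_left_comm _ (b _), ← Finset.mul_sum]
    rfl
  rw [t1, t2, t3, t4]
  ring

/-- The difference of the two quadratic invariants of `∇g` in terms of the embedding. -/
theorem two_mul_twistSq (h : MetricConnection d Γ P) (c : ι → ℂ) (X : ι → R) :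
    2 * twistSq d Γ P (indMet d c X) = normSq d Γ P (indMet d c X) + 4 * tau d Γ P c X := by
  have h1 : normSq d Γ P (indMet d c X) = ∑ a, ∑ b, (c a * c b) •
      ∑ μ, ∑ ν, P μ ν * (P * symK d Γ (X a) μ * P * symK d Γ (X b) ν).trace := by
    have e : ∀ μ ν, P μ ν * (P * lowD d Γ μ (indMet d c X) * P
        * lowD d Γ ν (indMet d c X)).trace = ∑ a, ∑ b, (c a * c b) •
          (P μ ν * (P * symK d Γ (X a) μ * P * symK d Γ (X b) ν).trace) := fun μ ν => by
      simp only [lowD_indMet, Finset.sum_mul, Matrix.smul_mul, Matrix.trace_sum,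
        Matrix.trace_smul, Finset.mul_sum, mul_smul_comm, Finset.smul_sum, smul_smul]
      rw [Finset.sum_comm]
      simp only [mul_comm (c _) (c _)]
    simp only [normSq, e, Finset.smul_sum]
    exact sum_sum_comm _
  have h2 : twistSq d Γ P (indMet d c X) = ∑ a, ∑ b, (c a * c b) •
      ∑ α, ∑ ρ, (P * symK d Γ (X a) ρ * P * symK d Γ (X b) α * P) α ρ := by
    have e : ∀ α ρ, (P * lowD d Γ ρ (indMet d c X) * P * lowD d Γ α (indMet d c X) * P) α ρ
        = ∑ a, ∑ b, (c a * c b) •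
          (P * symK d Γ (X a) ρ * P * symK d Γ (X b) α * P) α ρ := fun α ρ => by
      simp only [lowD_indMet, Finset.sum_mul, Matrix.smul_mul, Matrix.sum_apply,
        Matrix.smul_apply, Finset.mul_sum, mul_smul_comm, Finset.smul_sum, smul_smul]
      rw [Finset.sum_comm]
      simp only [mul_comm (c _) (c _)]
    simp only [twistSq, e, Finset.smul_sum]
    exact sum_sum_comm _
  rw [h1, h2]
  -- For each pair of coordinates the two invariants are `2T + 2τ` and `T + 3τ`, where `T` is
  -- `G^{ab}` times the trace of the two Hessians. Twice the second minus the first is `4τ`, without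
  -- `T`.
  simp only [sum_trace_symK h, sum_apply_symK h, tau, Finset.mul_sum,
    ← Finset.sum_add_distrib]
  refine Finset.sum_congr rfl fun a _ => Finset.sum_congr rfl fun b _ => ?_
  simp only [mul_smul_comm, ← smul_add]
  congr 1
  ring

end Embedding

/-! ### Poisson brackets and the effective metric -/

section Poisson
variable {R : Type*} [CommRing R] [Algebra ℂ R] {n : Type*} [Fintype n] [DecidableEq n]
  {ι : Type*} [Fintype ι]

/-- The Poisson bracket of the bivector `θ`. -/
def pbr (d : n → Derivation ℂ R R) (θ : Matrix n n R) (f k : R) : R :=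
  ∑ μ, ∑ ν, θ μ ν * d μ f * d ν k

theorem pbr_eq (d : n → Derivation ℂ R R) (θ : Matrix n n R) (f k : R) :
    pbr d θ f k = grad d f ⬝ᵥ θ *ᵥ grad d k := by
  simp only [pbr, dotProduct, mulVec, Finset.mul_sum, grad]
  exact Finset.sum_congr rfl fun _ _ => Finset.sum_congr rfl fun _ _ => by ring

/-- A metric `g` and a non-degenerate Poisson structure `θ` with inverse `Ω`, together with the
effective metric `Q`, its inverse `P = E⁻¹ θ g θᵀ`, and the dilaton `E`. -/
structure Background (d : n → Derivation ℂ R R) (P Q θ Ω g : Matrix n n R) (E Ei : R) : Prop where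
  comm : ∀ μ ν f, d μ (d ν f) = d ν (d μ f)
  antisymm : θᵀ = -θ
  inv : Ω * θ = 1
  jacobi : ∀ μ ν ρ, ∑ κ, (θ μ κ * d κ (θ ν ρ) + θ ν κ * d κ (θ ρ μ) + θ ρ κ * d κ (θ μ ν)) = 0
  mul_inv : E * Ei = 1
  symm : gᵀ = g
  eff : P = -(Ei • (θ * g * θ))
  eff_inv : Q * P = 1
  scale : Ei ^ 2 * Q.det = Ω.det

variable {d : n → Derivation ℂ R R} {P Q θ Ω g : Matrix n n R} {E Ei : R}

theorem sum_antisymm_mul_symm {A S : Matrix n n R} (hA : Aᵀ = -A) (hS : Sᵀ = S) :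
    ∑ i, ∑ j, A i j * S i j = 0 := by
  have h1 : ∑ i, ∑ j, A i j * S i j = -∑ i, ∑ j, A i j * S i j := by
    conv_lhs => rw [Finset.sum_comm]
    rw [← Finset.sum_neg_distrib]
    refine Finset.sum_congr rfl fun i _ => ?_
    rw [← Finset.sum_neg_distrib]
    refine Finset.sum_congr rfl fun j _ => ?_
    have e1 := congrFun (congrFun hA i) j
    have e2 := congrFun (congrFun hS i) j
    simp only [Matrix.transpose_apply, Matrix.neg_apply] at e1 e2
    rw [e1, e2]
    ring
  apply (isUnit_two (R := R)).mul_left_cancel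
  linear_combination h1

namespace Background

theorem inv' (h : Background d P Q θ Ω g E Ei) : θ * Ω = 1 := mul_eq_one_comm.1 h.inv

theorem inv_antisymm (h : Background d P Q θ Ω g E Ei) : Ωᵀ = -Ω := by
  have h1 : θᵀ * Ωᵀ = 1 := by rw [← Matrix.transpose_mul, h.inv, Matrix.transpose_one]
  rw [h.antisymm] at h1
  calc Ωᵀ = (Ω * θ) * Ωᵀ := by rw [h.inv, Matrix.one_mul]
    _ = -Ω * (-θ * Ωᵀ) := by noncomm_ring
    _ = -Ω := by rw [h1, Matrix.mul_one]

theorem eff_symm (h : Background d P Q θ Ω g E Ei) : Pᵀ = P := by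
  rw [h.eff]
  simp [Matrix.transpose_mul, h.antisymm, h.symm, Matrix.mul_assoc]

theorem eff_inv_symm (h : Background d P Q θ Ω g E Ei) : Qᵀ = Q := by
  have h1 : P * Qᵀ = 1 := by
    rw [← h.eff_symm, ← Matrix.transpose_mul, h.eff_inv, Matrix.transpose_one]
  calc Qᵀ = (Q * P) * Qᵀ := by rw [h.eff_inv, Matrix.one_mul]
    _ = Q := by rw [Matrix.mul_assoc, h1, Matrix.mul_one]

theorem metricConnection (h : Background d P Q θ Ω g E Ei) :
    MetricConnection d (chr d P Q) P where
  comm := h.comm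
  torsion := chr_symm h.eff_inv_symm
  symm := h.eff_symm
  parallel := upD_inverse_metric h.eff_inv_symm h.eff_inv

/-- The right side is `∂_β log det Q`, written without a logarithm. The other two derivative terms
of the Christoffel symbol cancel by symmetry of `P`. -/
theorem sum_chr (h : Background d P Q θ Ω g E Ei) (β : n) :
    2 * ∑ μ, chr d P Q μ μ β = (P * Q.map (d β)).trace := by
  have hs : ∀ i j, P i j = P j i := fun i j => congrFun (congrFun h.eff_symm j) i
  have hq : ∀ i j, Q i j = Q j i := fun i j => congrFun (congrFun h.eff_inv_symm j) i
  have e : ∑ μ, ∑ κ, P μ κ * d μ (Q κ β) = ∑ μ, ∑ κ, P μ κ * d κ (Q μ β) := by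
    rw [Finset.sum_comm]
    simp only [hs]
  simp only [chr, ← Finset.mul_sum, mul_add, mul_sub, Finset.sum_add_distrib,
    Finset.sum_sub_distrib, e]
  have e2 : (P * Q.map (d β)).trace = ∑ μ, ∑ κ, P μ κ * d β (Q κ μ) := by
    simp [Matrix.trace, Matrix.mul_apply]
  rw [e2]
  linear_combination (∑ μ, ∑ κ, P μ κ * d β (Q κ μ)) * two_mul_half (R := R)

/-- The logarithmic derivative of `scale`, through Jacobi's formula. It says that `e^{-σ}√det G` and
the Liouville density `√det Ω` vary alike. -/
theorem trace_scale (h : Background d P Q θ Ω g E Ei) (β : n) :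
    2 * E * d β Ei + (P * Q.map (d β)).trace = (θ * Ω.map (d β)).trace := by
  have aQ : Q.adjugate = Q.det • P := by
    have := Matrix.mul_adjugate Q
    calc Q.adjugate = (P * Q) * Q.adjugate := by
          rw [mul_eq_one_comm.1 h.eff_inv, Matrix.one_mul]
      _ = Q.det • P := by rw [Matrix.mul_assoc, this, Matrix.mul_smul, Matrix.mul_one]
  have aΩ : Ω.adjugate = Ω.det • θ := by
    have := Matrix.mul_adjugate Ω
    calc Ω.adjugate = (θ * Ω) * Ω.adjugate := by rw [h.inv', Matrix.one_mul]
      _ = Ω.det • θ := by rw [Matrix.mul_assoc, this, Matrix.mul_smul, Matrix.mul_one]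
  have h1 := congrArg (d β) h.scale
  rw [Derivation.leibniz, derivation_det, derivation_det, aQ, aΩ, pow_two, Derivation.leibniz,
    Matrix.smul_mul, Matrix.smul_mul, Matrix.trace_smul, Matrix.trace_smul] at h1
  simp only [smul_eq_mul] at h1
  have hu : IsUnit Ω.det := by
    have : Ω.det * θ.det = 1 := by rw [← Matrix.det_mul, h.inv, Matrix.det_one]
    exact IsUnit.of_mul_eq_one _ this
  apply hu.mul_left_cancel
  rw [← h1, ← h.scale]
  linear_combination (2 * Ei * Q.det * d β Ei) * h.mul_inv

/-- Contracting the Jacobi identity with `Ω` turns two of its terms into the divergence of `θ` and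
the third into a derivative of `log det Ω`. -/
theorem jacobi_trace (h : Background d P Q θ Ω g E Ei) (μ : n) :
    2 * ∑ ρ, d ρ (θ ρ μ) = ∑ κ, θ μ κ * (θ * Ω.map (d κ)).trace := by
  have hΩ : ∀ i j, Ω i j = -Ω j i := fun i j => by
    have := congrFun (congrFun h.inv_antisymm j) i
    simpa using this
  have hθ : ∀ i j, θ i j = -θ j i := fun i j => by
    have := congrFun (congrFun h.antisymm j) i
    simpa using this
  have c1 : ∀ (x : n → R) ρ, ∑ ν, Ω ρ ν * ∑ κ, θ ν κ * x κ = x ρ := fun x ρ => by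
    have : Ω *ᵥ (θ *ᵥ x) = x := by rw [Matrix.mulVec_mulVec, h.inv, Matrix.one_mulVec]
    exact congrFun this ρ
  have e0 : ∀ κ, (θ * Ω.map (d κ)).trace = -∑ ρ, ∑ ν, Ω ρ ν * d κ (θ ν ρ) := fun κ => by
    have := map_mul_derivation (d κ) θ Ω
    rw [h.inv', map_one_derivation] at this
    have h2 := congrArg Matrix.trace this
    rw [Matrix.trace_add, Matrix.trace_zero, Matrix.trace_mul_comm _ Ω] at h2
    rw [eq_neg_iff_add_eq_zero, add_comm, h2]
    simp [Matrix.trace, Matrix.mul_apply]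
  have hJ : ∑ ρ, ∑ ν, Ω ρ ν * (∑ κ, (θ μ κ * d κ (θ ν ρ) + θ ν κ * d κ (θ ρ μ)
      + θ ρ κ * d κ (θ μ ν))) = 0 := by simp [h.jacobi]
  simp only [Finset.sum_add_distrib, mul_add] at hJ
  have t2 : ∑ ρ, ∑ ν, Ω ρ ν * ∑ κ, θ ν κ * d κ (θ ρ μ) = ∑ ρ, d ρ (θ ρ μ) :=
    Finset.sum_congr rfl fun ρ _ => c1 (fun κ => d κ (θ ρ μ)) ρ
  have t3 : ∑ ρ, ∑ ν, Ω ρ ν * ∑ κ, θ ρ κ * d κ (θ μ ν) = ∑ ρ, d ρ (θ ρ μ) := by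
    rw [Finset.sum_comm]
    refine Finset.sum_congr rfl fun ν _ => ?_
    rw [hθ ν μ, map_neg, ← c1 (fun κ => d κ (θ μ ν)) ν, ← Finset.sum_neg_distrib]
    exact Finset.sum_congr rfl fun ρ _ => by rw [hΩ ρ ν]; ring
  have t1 : ∑ ρ, ∑ ν, Ω ρ ν * ∑ κ, θ μ κ * d κ (θ ν ρ)
      = -∑ κ, θ μ κ * (θ * Ω.map (d κ)).trace := by
    simp only [e0, Finset.mul_sum, mul_neg, Finset.sum_neg_distrib, neg_neg]
    rw [sum_rotate]
    exact Finset.sum_congr rfl fun _ _ => Finset.sum_congr rfl fun _ _ =>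
      Finset.sum_congr rfl fun _ _ => by ring
  rw [t1, t2, t3] at hJ
  linear_combination hJ

/-- `∇_μ (e^{-σ} θ^{μν}) = 0`. -/
theorem sum_upD_poisson (h : Background d P Q θ Ω g E Ei) (ν : n) :
    ∑ μ, upD d (chr d P Q) μ (Ei • θ) μ ν = 0 := by
  have hθ : ∀ i j, θ i j = -θ j i := fun i j => by
    have := congrFun (congrFun h.antisymm j) i
    simpa using this
  simp only [upD, Matrix.of_apply, Matrix.smul_apply, smul_eq_mul, Finset.sum_add_distrib]
  have e1 : ∑ μ, ∑ κ, chr d P Q ν μ κ * (Ei * θ μ κ) = 0 := by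
    have := sum_antisymm_mul_symm (A := θ) (S := Matrix.of fun μ κ => Ei * chr d P Q ν μ κ)
      h.antisymm (by ext i j; simp [chr_symm h.eff_inv_symm ν i j])
    rw [← this]
    exact Finset.sum_congr rfl fun _ _ => Finset.sum_congr rfl fun _ _ => by
      rw [Matrix.of_apply]; ring
  have e2 : ∑ μ, ∑ κ, chr d P Q μ μ κ * (Ei * θ κ ν)
      = Ei * ∑ κ, (∑ μ, chr d P Q μ μ κ) * θ κ ν := by
    rw [Finset.sum_comm, Finset.mul_sum]
    refine Finset.sum_congr rfl fun κ _ => ?_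
    rw [← Finset.sum_mul]
    ring
  have e3 : ∑ μ, d μ (Ei * θ μ ν) = Ei * ∑ μ, d μ (θ μ ν) + ∑ μ, d μ Ei * θ μ ν := by
    simp only [Derivation.leibniz, smul_eq_mul, Finset.sum_add_distrib, Finset.mul_sum,
      mul_comm (θ _ _)]
  rw [e1, e2, e3]
  apply (isUnit_two (R := R)).mul_left_cancel
  -- The ordinary divergence of `θ` is controlled by `det Ω`. The scale relation converts this into
  -- `σ` and `Γ^μ_{μκ}`, which are the remaining terms of the covariant divergence.
  have e4 := h.jacobi_trace ν
  have e5 : ∑ κ, θ ν κ * (θ * Ω.map (d κ)).trace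
      = -(2 * E * ∑ κ, d κ Ei * θ κ ν) - 2 * ∑ κ, (∑ μ, chr d P Q μ μ κ) * θ κ ν := by
    simp only [← h.trace_scale, ← h.sum_chr, Finset.mul_sum, ← Finset.sum_neg_distrib,
      ← Finset.sum_sub_distrib]
    refine Finset.sum_congr rfl fun κ _ => ?_
    rw [hθ ν κ, ← Finset.mul_sum]
    ring
  rw [e5] at e4
  linear_combination Ei * e4 - 2 * (∑ κ, d κ Ei * θ κ ν) * h.mul_inv

/-- The field `e^{-σ}θ df` is divergence free: `θ` is antisymmetric against the Hessian, and
`e^{-σ}θ` is itself divergence free. A derivative along it is therefore a total divergence. -/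
theorem pbr_eq_divg (h : Background d P Q θ Ω g E Ei) (f ψ : R) :
    pbr d θ f ψ = -(E * divg d (chr d P Q) (ψ • ((Ei • θ) *ᵥ grad d f))) := by
  have hc := h.metricConnection
  have h1 : divg d (chr d P Q) ((Ei • θ) *ᵥ grad d f) = 0 := by
    rw [divg_mulVec]
    have e1 : ∑ μ, ((Ei • θ) *ᵥ cov d (chr d P Q) (grad d f) μ) μ = 0 :=
      sum_antisymm_mul_symm (by rw [Matrix.transpose_smul, h.antisymm, smul_neg])
        (hess_symm hc.comm hc.torsion f)
    have e2 : ∑ μ, (upD d (chr d P Q) μ (Ei • θ) *ᵥ grad d f) μ = 0 := by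
      simp only [mulVec, dotProduct]
      rw [Finset.sum_comm]
      simp only [← Finset.sum_mul, h.sum_upD_poisson, zero_mul, Finset.sum_const_zero]
    rw [e1, e2, add_zero]
  rw [divg_smul, h1, pbr_eq, Matrix.smul_mulVec, dotProduct_smul, smul_eq_mul]
  have h2 : grad d ψ ⬝ᵥ θ *ᵥ grad d f = -(grad d f ⬝ᵥ θ *ᵥ grad d ψ) := by
    rw [dotProduct_comm, mulVec_dotProduct, h.antisymm, Matrix.neg_mulVec, dotProduct_neg]
  rw [h2]
  linear_combination (-(grad d f ⬝ᵥ θ *ᵥ grad d ψ)) * h.mul_inv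

/-- The matrix Laplacian: `{x^a, {x_a, f}} = e^σ □_G f`. -/
theorem sum_pbr_pbr {c : ι → ℂ} {X : ι → R} (h : Background d P Q θ Ω (indMet d c X) E Ei)
    (f : R) : ∑ a, c a • pbr d θ (X a) (pbr d θ (X a) f) = E * lap d (chr d P Q) P f := by
  have h1 : ∀ a, pbr d θ (X a) (pbr d θ (X a) f) = -(E * divg d (chr d P Q)
      (pbr d θ (X a) f • ((Ei • θ) *ᵥ grad d (X a)))) := fun a => h.pbr_eq_divg _ _
  rw [lap_eq_divg h.metricConnection.parallel]
  -- The effective metric is `-e^{-σ}θgθ`; inserting `g = ∑ c_a dx^a dx^a` makes the gradient of `f`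
  -- a sum of Hamiltonian fields weighted by brackets.
  have h2 : P *ᵥ grad d f = ∑ a, (-c a) • (pbr d θ (X a) f • ((Ei • θ) *ᵥ grad d (X a))) := by
    have := sum_smul_grad d c X (θ *ᵥ grad d f)
    simp only [neg_smul, Finset.sum_neg_distrib, ← Matrix.mulVec_smul, ← Matrix.mulVec_sum]
    conv_lhs => rw [h.eff, Matrix.mul_assoc, ← Matrix.smul_mul, Matrix.neg_mulVec,
      ← Matrix.mulVec_mulVec, ← Matrix.mulVec_mulVec, ← this]
    simp only [dotProduct_comm _ (grad d (X _)), ← pbr_eq]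
  rw [h2, divg_sum, Finset.mul_sum]
  refine Finset.sum_congr rfl fun a _ => ?_
  rw [h1, neg_smul, smul_neg, mul_neg, mul_smul_comm]

/-- The inverse of a Poisson tensor is a closed two-form. -/
theorem closed (h : Background d P Q θ Ω g E Ei) (β ν μ : n) :
    d β (Ω ν μ) + d ν (Ω μ β) + d μ (Ω β ν) = 0 := by
  have hΩ : ∀ i j, Ω i j = -Ω j i := fun i j => by
    have := congrFun (congrFun h.inv_antisymm j) i
    simpa using this
  have c1 : ∀ (x : n → R) ρ, ∑ p, Ω ρ p * ∑ κ, θ p κ * x κ = x ρ := fun x ρ => by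
    have : Ω *ᵥ (θ *ᵥ x) = x := by rw [Matrix.mulVec_mulVec, h.inv, Matrix.one_mulVec]
    exact congrFun this ρ
  have c2 : ∀ κ i j, ∑ q, ∑ r, Ω i q * Ω j r * d κ (θ q r) = d κ (Ω i j) := fun κ i j => by
    have e := map_mul_derivation (d κ) Ω θ
    rw [h.inv, map_one_derivation] at e
    have e2 := congrArg (· * Ω) e
    simp only [Matrix.add_mul, Matrix.mul_assoc, h.inv', Matrix.mul_one, Matrix.zero_mul] at e2
    have e3 := congrFun (congrFun e2 i) j
    simp only [Matrix.add_apply, Matrix.map_apply, Matrix.mul_apply, Matrix.zero_apply,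
      Finset.mul_sum] at e3
    have e4 : ∑ q, ∑ r, Ω i q * Ω j r * d κ (θ q r)
        = -∑ q, ∑ r, Ω i q * (d κ (θ q r) * Ω r j) := by
      simp only [← Finset.sum_neg_distrib]
      exact Finset.sum_congr rfl fun q _ => Finset.sum_congr rfl fun r _ => by
        rw [hΩ j r]; ring
    rw [e4]
    linear_combination e3
  -- The Jacobi identity with all three indices lowered by `Ω`: in each term one `Ω` cancels the
  -- undifferentiated `θ`, and the other two turn `∂θ` into `∂Ω`.
  have hJ : ∑ p, ∑ q, ∑ r, Ω β p * Ω ν q * Ω μ r * (∑ κ, (θ p κ * d κ (θ q r)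
      + θ q κ * d κ (θ r p) + θ r κ * d κ (θ p q))) = 0 := by simp [h.jacobi]
  simp only [Finset.sum_add_distrib, mul_add] at hJ
  have t1 : ∑ p, ∑ q, ∑ r, Ω β p * Ω ν q * Ω μ r * ∑ κ, θ p κ * d κ (θ q r) = d β (Ω ν μ) := by
    rw [← c2 β ν μ, ← sum_rotate (fun q r p => Ω β p * Ω ν q * Ω μ r * ∑ κ, θ p κ * d κ (θ q r))]
    refine Finset.sum_congr rfl fun q _ => Finset.sum_congr rfl fun r _ => ?_
    rw [← c1 (fun κ => d κ (θ q r)) β, Finset.mul_sum]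
    exact Finset.sum_congr rfl fun p _ => by ring
  have t2 : ∑ p, ∑ q, ∑ r, Ω β p * Ω ν q * Ω μ r * ∑ κ, θ q κ * d κ (θ r p) = d ν (Ω μ β) := by
    rw [← c2 ν μ β, sum_rotate]
    refine Finset.sum_congr rfl fun r _ => Finset.sum_congr rfl fun p _ => ?_
    rw [← c1 (fun κ => d κ (θ r p)) ν, Finset.mul_sum]
    exact Finset.sum_congr rfl fun q _ => by ring
  have t3 : ∑ p, ∑ q, ∑ r, Ω β p * Ω ν q * Ω μ r * ∑ κ, θ r κ * d κ (θ p q) = d μ (Ω β ν) := by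
    rw [← c2 μ β ν]
    refine Finset.sum_congr rfl fun p _ => Finset.sum_congr rfl fun q _ => ?_
    rw [← c1 (fun κ => d κ (θ p q)) μ, Finset.mul_sum]
    exact Finset.sum_congr rfl fun r _ => by ring
  rw [t1, t2, t3] at hJ
  exact hJ

theorem inv_mul_eff (h : Background d P Q θ Ω g E Ei) : Ω * P = -(Ei • (g * θ)) := by
  rw [h.eff, Matrix.mul_neg, Matrix.mul_smul, Matrix.mul_assoc, ← Matrix.mul_assoc Ω, h.inv,
    Matrix.one_mul]

theorem metric_mul_poisson (h : Background d P Q θ Ω g E Ei) : g * θ = -(E • (Ω * P)) := by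
  rw [h.inv_mul_eff, smul_neg, smul_smul, h.mul_inv, one_smul, neg_neg]

theorem inv_eff_inv (h : Background d P Q θ Ω g E Ei) : Ω * P * Ω = -(Ei • g) := by
  rw [h.inv_mul_eff, Matrix.neg_mul, Matrix.smul_mul, Matrix.mul_assoc, h.inv', Matrix.mul_one]

/-- The contraction of the exterior derivative of `i_Y Ω` with `P Ω P`. -/
theorem sum_derivation_inv (h : Background d P Q θ Ω g E Ei) (Y : n → R) :
    4 * ∑ ν, ∑ β, (P * Ω * P) ν β * d β ((Ω *ᵥ Y) ν)
      = grad d (Ei * (P * g).trace) ⬝ᵥ Y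
        + 4 * Ei * ∑ β, ((P * g) *ᵥ (d β ∘ Y + conn (chr d P Q) β *ᵥ Y)) β := by
  have hc := h.metricConnection
  set B := P * Ω * P with hB
  have hBt : Bᵀ = -B := by
    simp [hB, Matrix.transpose_mul, h.eff_symm, h.inv_antisymm, Matrix.mul_assoc]
  have hB' : ∀ i j, B i j = -B j i := fun i j => by
    have := congrFun (congrFun hBt j) i
    simpa using this
  have hΩ : ∀ i j, Ω i j = -Ω j i := fun i j => by
    have := congrFun (congrFun h.inv_antisymm j) i
    simpa using this
  -- split the derivative of the product
  have e1 : ∑ ν, ∑ β, B ν β * d β ((Ω *ᵥ Y) ν)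
      = ∑ μ, (∑ ν, ∑ β, B ν β * d β (Ω ν μ)) * Y μ
        + ∑ ν, ∑ β, ∑ μ, B ν β * Ω ν μ * d β (Y μ) := by
    have e : ∀ ν β, B ν β * d β ((Ω *ᵥ Y) ν) = ∑ μ, B ν β * d β (Ω ν μ) * Y μ
        + ∑ μ, B ν β * Ω ν μ * d β (Y μ) := fun ν β => by
      simp only [mulVec, dotProduct, map_sum, Derivation.leibniz, smul_eq_mul,
        ← Finset.sum_add_distrib, Finset.mul_sum]
      exact Finset.sum_congr rfl fun μ _ => by ring
    simp only [e, Finset.sum_add_distrib]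
    congr 1
    rw [sum_rotate]
    simp only [Finset.sum_mul]
  -- Closedness of `Ω`, contracted with the antisymmetric `B`, trades derivatives along contracted
  -- indices for the free derivative `∂_μ`.
  have e2 : ∀ μ, 2 * ∑ ν, ∑ β, B ν β * d β (Ω ν μ) = -(B * Ω.map (d μ)).trace := fun μ => by
    have f1 : ∑ ν, ∑ β, B ν β * d β (Ω ν μ) = ∑ ν, ∑ β, B ν β * d ν (Ω μ β) := by
      rw [Finset.sum_comm]
      refine Finset.sum_congr rfl fun β _ => Finset.sum_congr rfl fun ν _ => ?_
      rw [hB' ν β, hΩ ν μ, map_neg]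
      ring
    have f2 : (B * Ω.map (d μ)).trace = ∑ ν, ∑ β, B ν β * d μ (Ω β ν) := by
      simp [Matrix.trace, Matrix.mul_apply]
    have f3 : ∑ ν, ∑ β, B ν β * (d β (Ω ν μ) + d ν (Ω μ β) + d μ (Ω β ν)) = 0 := by
      simp [h.closed]
    simp only [mul_add, Finset.sum_add_distrib] at f3
    rw [f2]
    linear_combination f1 + f3
  -- Since `ΩPΩ = -e^{-σ}g`, the trace of `PΩPΩ` is `-e^{-σ}t`. Its derivative hits the two `Ω`
  -- equally, and the derivatives of `P` are connection terms.
  have e3 : ∀ μ, -2 * (B * Ω.map (d μ)).trace = d μ (Ei * (P * g).trace)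
      + 4 * Ei * (conn (chr d P Q) μ * P * g).trace := fun μ => by
    have f1 : d μ (P * (Ω * P * Ω)).trace = 2 * (B * Ω.map (d μ)).trace
        + 2 * (P.map (d μ) * (Ω * P * Ω)).trace := by
      rw [map_trace_derivation, map_mul_derivation, map_mul_derivation, map_mul_derivation]
      simp only [Matrix.mul_add, Matrix.add_mul, Matrix.trace_add, hB]
      have g1 := Matrix.trace_mul_comm (P * Ω.map (d μ)) (P * Ω)
      have g2 := Matrix.trace_mul_comm (P * Ω) (P.map (d μ) * Ω)
      simp only [Matrix.mul_assoc] at g1 g2 ⊢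
      rw [g1, g2]
      ring
    have f2 : P.map (d μ) = -(conn (chr d P Q) μ * P) - P * (conn (chr d P Q) μ)ᵀ := by
      have := hc.parallel μ
      rw [upD_eq] at this
      rw [← sub_eq_zero, ← this]
      abel
    have f3 : (P * (conn (chr d P Q) μ)ᵀ * g).trace = (conn (chr d P Q) μ * P * g).trace := by
      rw [← Matrix.trace_transpose, Matrix.transpose_mul, Matrix.transpose_mul,
        Matrix.transpose_transpose, h.symm, h.eff_symm, Matrix.trace_mul_comm]
    rw [h.inv_eff_inv, f2] at f1
    simp only [Matrix.mul_neg, Matrix.mul_smul, Matrix.trace_neg, Matrix.trace_smul,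
      Matrix.sub_mul, Matrix.neg_mul, Matrix.trace_sub, f3, map_neg, smul_eq_mul] at f1
    linear_combination f1
  have e4 : ∑ ν, ∑ β, ∑ μ, B ν β * Ω ν μ * d β (Y μ)
      = Ei * ∑ β, ((P * g) *ᵥ (d β ∘ Y)) β := by
    have f1 : Bᵀ * Ω = Ei • (P * g) := by
      rw [hBt, hB, Matrix.neg_mul, Matrix.mul_assoc, Matrix.mul_assoc, ← Matrix.mul_assoc Ω,
        h.inv_eff_inv, Matrix.mul_neg, neg_neg, Matrix.mul_smul]
    have f2 : Ei * ∑ β, ((P * g) *ᵥ (d β ∘ Y)) β = ∑ β, ((Bᵀ * Ω) *ᵥ (d β ∘ Y)) β := by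
      rw [f1, Finset.mul_sum]
      simp only [Matrix.smul_mulVec, Pi.smul_apply, smul_eq_mul]
    rw [f2, Finset.sum_comm]
    refine Finset.sum_congr rfl fun β _ => ?_
    simp only [mulVec, dotProduct, Matrix.mul_apply, Finset.sum_mul, Matrix.transpose_apply,
      Function.comp_apply]
    rw [Finset.sum_comm]
  have e5 : ∑ μ, (conn (chr d P Q) μ * P * g).trace * Y μ
      = ∑ β, ((P * g) *ᵥ (conn (chr d P Q) β *ᵥ Y)) β := by
    have f1 : ∀ μ, (conn (chr d P Q) μ * P * g).trace
        = ∑ β, ∑ α, (P * g) β α * chr d P Q α β μ := fun μ => by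
      rw [Matrix.mul_assoc, Matrix.trace_mul_comm]
      refine Finset.sum_congr rfl fun β _ => ?_
      rw [Matrix.diag_apply, Matrix.mul_apply]
      refine Finset.sum_congr rfl fun α _ => ?_
      rw [chr_symm h.eff_inv_symm]
      rfl
    simp only [f1]
    simp only [Finset.sum_mul, mulVec, dotProduct, Finset.mul_sum, conn, Matrix.of_apply]
    rw [← sum_rotate (fun β α μ => (P * g) β α * chr d P Q α β μ * Y μ)]
    simp only [mul_assoc]
  simp only [Matrix.mulVec_add, Pi.add_apply, Finset.sum_add_distrib]
  have e8 : grad d (Ei * (P * g).trace) ⬝ᵥ Y = ∑ μ, d μ (Ei * (P * g).trace) * Y μ := rfl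
  rw [e1, e4, ← e5, e8, mul_add (4 * Ei)]
  have e6 : ∀ μ, 4 * ((∑ ν, ∑ β, B ν β * d β (Ω ν μ)) * Y μ) = d μ (Ei * (P * g).trace) * Y μ
      + 4 * Ei * ((conn (chr d P Q) μ * P * g).trace * Y μ) := fun μ => by
    linear_combination (2 * e2 μ + e3 μ) * Y μ
  have e7 : 4 * ∑ μ, (∑ ν, ∑ β, B ν β * d β (Ω ν μ)) * Y μ
      = ∑ μ, d μ (Ei * (P * g).trace) * Y μ
        + 4 * Ei * ∑ μ, (conn (chr d P Q) μ * P * g).trace * Y μ := by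
    rw [Finset.mul_sum]
    simp only [e6, Finset.sum_add_distrib, ← Finset.mul_sum]
  linear_combination e7

/-- The contraction of `G^{ab}` with the second Poisson bracket `{x_a, {x_b, f}}`. -/
theorem sum_inner_mul_pbr_pbr {c : ι → ℂ} {X : ι → R}
    (h : Background d P Q θ Ω (indMet d c X) E Ei) (f : R) :
    4 * ∑ a, ∑ b, (c a * c b) • ((grad d (X a) ⬝ᵥ P *ᵥ grad d (X b))
        * pbr d θ (X a) (pbr d θ (X b) f))
      = 4 * E * (P * indMet d c X * P * hess d (chr d P Q) f).trace
        + 4 * (grad d E ⬝ᵥ (P * indMet d c X * P) *ᵥ grad d f)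
        + E * (grad d (P * indMet d c X).trace ⬝ᵥ P *ᵥ grad d f)
        - (P * indMet d c X).trace * (grad d E ⬝ᵥ P *ᵥ grad d f) := by
  have hc := h.metricConnection
  set g := indMet d c X with hg
  set A := P * g * θ with hA
  -- The relation `gθ = -E ΩP` exhibits `A` as antisymmetric, which the form `PgθP`-free product `P
  -- g θ` hides.
  have hA2 : A = -(E • (P * Ω * P)) := by
    rw [hA, Matrix.mul_assoc, h.metric_mul_poisson, Matrix.mul_neg, Matrix.mul_smul,
      Matrix.mul_assoc]
  have hAt : Aᵀ = -A := by
    rw [hA2]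
    simp [Matrix.transpose_mul, h.eff_symm, h.inv_antisymm, Matrix.mul_assoc]
  -- sum over the first index
  have e1 : ∑ a, ∑ b, (c a * c b) • ((grad d (X a) ⬝ᵥ P *ᵥ grad d (X b))
      * pbr d θ (X a) (pbr d θ (X b) f))
      = ∑ b, c b • (grad d (X b) ⬝ᵥ A *ᵥ grad d (pbr d θ (X b) f)) := by
    rw [Finset.sum_comm]
    refine Finset.sum_congr rfl fun b _ => ?_
    have := sum_smul_grad d c X (P *ᵥ grad d (X b))
    rw [← hg] at this
    have e : grad d (X b) ⬝ᵥ A *ᵥ grad d (pbr d θ (X b) f)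
        = (g *ᵥ (P *ᵥ grad d (X b))) ⬝ᵥ θ *ᵥ grad d (pbr d θ (X b) f) := by
      rw [mulVec_dotProduct, mulVec_dotProduct, h.symm, h.eff_symm, hA, Matrix.mulVec_mulVec,
        Matrix.mulVec_mulVec, Matrix.mul_assoc]
    rw [e, ← this, sum_dotProduct, Finset.smul_sum]
    refine Finset.sum_congr rfl fun a _ => ?_
    rw [smul_dotProduct, smul_dotProduct, pbr_eq d θ (X a), smul_smul, mul_comm (c b),
      dotProduct_comm (P *ᵥ grad d (X b)), smul_eq_mul]
  -- sum over the second index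
  have e2 : ∑ b, c b • (grad d (X b) ⬝ᵥ A *ᵥ grad d (pbr d θ (X b) f))
      = ∑ ν, ∑ β, A ν β * d β ((g *ᵥ (θ *ᵥ grad d f)) ν) := by
    have f0 := sum_smul_grad d c X (θ *ᵥ grad d f)
    rw [← hg] at f0
    have f1 : ∀ ν β, d β ((g *ᵥ (θ *ᵥ grad d f)) ν)
        = ∑ b, c b • (d ν (X b) * d β (pbr d θ (X b) f))
          + ∑ b, c b • (pbr d θ (X b) f * d β (d ν (X b))) := fun ν β => by
      rw [← f0]
      simp only [Finset.sum_apply, Pi.smul_apply, map_sum, Derivation.map_smul, smul_eq_mul,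
        Derivation.leibniz, dotProduct_comm _ (grad d (X _)), ← pbr_eq, smul_add,
        Finset.sum_add_distrib]
      rw [add_comm]
      rfl
    -- The second derivatives of `x^b` are symmetric and `A` is not, so the derivative may be pulled
    -- out of the sum over `b`.
    have f2 : ∑ ν, ∑ β, A ν β * ∑ b, c b • (pbr d θ (X b) f * d β (d ν (X b))) = 0 := by
      have := sum_antisymm_mul_symm (A := A)
        (S := Matrix.of fun ν β => ∑ b, c b • (pbr d θ (X b) f * d β (d ν (X b)))) hAt
        (by ext i j; simp [h.comm i j])
      exact this
    simp only [f1, mul_add, Finset.sum_add_distrib, f2, add_zero]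
    simp only [dotProduct, mulVec, Finset.mul_sum, Finset.smul_sum, mul_smul_comm]
    rw [← sum_rotate]
    exact Finset.sum_congr rfl fun ν _ => Finset.sum_congr rfl fun β _ =>
      Finset.sum_congr rfl fun b _ => by rw [grad, grad, mul_left_comm]
  -- With this `Y` the covector `gθ df` is `-ΩY`, the shape that `sum_derivation_inv` handles.
  set Y : n → R := (E • P) *ᵥ grad d f with hY
  have e3 : g *ᵥ (θ *ᵥ grad d f) = -(Ω *ᵥ Y) := by
    rw [Matrix.mulVec_mulVec, h.metric_mul_poisson, hY, Matrix.mulVec_mulVec, Matrix.mul_smul,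
      Matrix.neg_mulVec]
  have e4 : ∑ ν, ∑ β, A ν β * d β ((g *ᵥ (θ *ᵥ grad d f)) ν)
      = E * ∑ ν, ∑ β, (P * Ω * P) ν β * d β ((Ω *ᵥ Y) ν) := by
    rw [e3, hA2]
    simp only [Finset.mul_sum, Pi.neg_apply, map_neg, Matrix.neg_apply, Matrix.smul_apply,
      smul_eq_mul]
    exact Finset.sum_congr rfl fun ν _ => Finset.sum_congr rfl fun β _ => by ring
  have e5 := h.sum_derivation_inv Y
  have e6 : ∑ β, ((P * g) *ᵥ (d β ∘ Y + conn (chr d P Q) β *ᵥ Y)) β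
      = grad d E ⬝ᵥ (P * g * P) *ᵥ grad d f + E * (P * g * P * hess d (chr d P Q) f).trace := by
    have f1 : ∀ β, d β ∘ Y + conn (chr d P Q) β *ᵥ Y
        = d β E • (P *ᵥ grad d f) + E • (P *ᵥ hess d (chr d P Q) f β) := fun β => by
      rw [hY, derivation_mulVec_cov, upD_smul, hc.parallel, smul_zero, add_zero,
        Matrix.smul_mulVec, Matrix.smul_mulVec, hess]
    have f2 : (P * g * P * hess d (chr d P Q) f).trace
        = ∑ β, ((P * g * P) *ᵥ hess d (chr d P Q) f β) β := by
      conv_lhs => rw [← hess_symm hc.comm hc.torsion f]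
      rfl
    simp only [f1, Matrix.mulVec_add, Matrix.mulVec_smul, Matrix.mulVec_mulVec, Pi.add_apply,
      Pi.smul_apply, smul_eq_mul, Finset.sum_add_distrib, ← Finset.mul_sum, f2]
    rfl
  have e7 : grad d (Ei * (P * g).trace) ⬝ᵥ Y
      = grad d (P * g).trace ⬝ᵥ P *ᵥ grad d f
        - Ei * (P * g).trace * (grad d E ⬝ᵥ P *ᵥ grad d f) := by
    have f1 : E • grad d Ei = -(Ei • grad d E) := by
      ext μ
      have := congrArg (d μ) h.mul_inv
      rw [Derivation.leibniz, Derivation.map_one_eq_zero] at this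
      exact eq_neg_of_add_eq_zero_left this
    rw [hY, grad_mul, Matrix.smul_mulVec, dotProduct_smul, ← smul_dotProduct, smul_add, smul_smul,
      smul_smul, mul_comm E (P * g).trace, ← smul_smul (P * g).trace, f1, h.mul_inv, one_smul,
      add_dotProduct, smul_neg, neg_dotProduct, smul_smul, smul_dotProduct, smul_eq_mul]
    ring
  rw [e6, e7] at e5
  rw [e1, e2, e4]
  linear_combination E * e5 + (4 * (grad d E ⬝ᵥ (P * g * P) *ᵥ grad d f)
    + 4 * E * (P * g * P * hess d (chr d P Q) f).trace
    - (P * g).trace * (grad d E ⬝ᵥ P *ᵥ grad d f)) * h.mul_inv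

end Background
end Poisson

/-! ### Reduction of the intrinsic scalar -/

section Intrinsic
variable {R : Type*} [CommRing R] [Algebra ℂ R] {n : Type*} [Fintype n] [DecidableEq n]
  {ι : Type*} [Fintype ι]

/-- The vector field `∇_α g^{αβ}`. -/
def divInv (d : n → Derivation ℂ R R) (Γ : n → n → n → R) (gi : Matrix n n R) (β : n) : R :=
  ∑ α, upD d Γ α gi α β

/-- The intrinsic scalar in an algebra with derivations, as a function of the metrics and of
`E = e^σ`; the differential of `σ` is `E⁻¹ dE`. -/
noncomputable def intr (d : n → Derivation ℂ R R) (P Q g gi : Matrix n n R) (E Ei : R) : R :=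
  (P * g * P * g).trace * Ei * lap d (chr d P Q) P E
    + 8 * (Ei * Ei) * ((∑ μ, ∑ ν, P μ ν * d μ (half R * half R * E * ∑ μ, ∑ ν, P μ ν * g μ ν)
          * d ν (half R * half R * E * ∑ μ, ∑ ν, P μ ν * g μ ν))
        - (half R * half R * E * ∑ μ, ∑ ν, P μ ν * g μ ν) ^ 2
          * ∑ μ, ∑ ν, P μ ν * (Ei * d μ E) * (Ei * d ν E))
    - 3 * half R * ∑ ν, ∑ κ, ∑ μ, ∑ β, P ν κ * upD d (chr d P Q) ν gi μ β
        * lowD d (chr d P Q) κ g μ β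
    + 2 * ∑ μ, ∑ κ, ∑ β, P μ κ * lowD d (chr d P Q) κ g μ β * divInv d (chr d P Q) gi β
    + (∑ μ, ∑ ν, P μ ν * g μ ν) * ∑ μ, ∑ ν, ric d (chr d P Q) μ ν * (P * g * P) μ ν
    - 2 * ∑ ρ, ∑ ν, P ρ ν * ric d (chr d P Q) ρ ν
    - 2 * divg d (chr d P Q) (fun ν => ∑ μ, ∑ β, P μ ν * g μ β * divInv d (chr d P Q) gi β)
    - ∑ μ, ∑ β, ∑ α, ∑ ρ, Q μ β * upD d (chr d P Q) α gi μ ρ * upD d (chr d P Q) ρ gi α β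
    + 2 * Ei * ∑ α, divInv d (chr d P Q) gi α
        * d α (half R * half R * E * ∑ μ, ∑ ν, P μ ν * g μ ν)
    - 4 * Ei * (half R * half R * E * ∑ μ, ∑ ν, P μ ν * g μ ν)
        * ∑ α, divInv d (chr d P Q) gi α * (Ei * d α E)
    + 2 * ∑ μ, ∑ ν, ∑ α, gi μ ν * Q μ α * divInv d (chr d P Q) gi α * (Ei * d ν E)

variable {d : n → Derivation ℂ R R} {Γ : n → n → n → R} {P : Matrix n n R}

theorem grad_trace (h : MetricConnection d Γ P) (c : ι → ℂ) (X : ι → R) :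
    grad d (P * indMet d c X).trace
      = (2 : R) • ∑ a, c a • (hess d Γ (X a) *ᵥ (P *ᵥ grad d (X a))) := by
  ext μ
  rw [grad, trace_upD_mul d Γ, h.parallel, Matrix.zero_mul, Matrix.trace_zero, zero_add,
    trace_mul_lowD_indMet P h.symm]
  simp [Finset.sum_apply]

/-- The derivative hits either the gradient carrying the contracted index, which gives `□x_a dx^a`,
or the other one, which gives half of `dt` by `grad_trace`. Thus `V` is determined by the two
metrics. -/
theorem sum_lowD_indMet (h : MetricConnection d Γ P) (c : ι → ℂ) (X : ι → R) (β : n) :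
    ∑ μ, (P * lowD d Γ μ (indMet d c X) * P) μ β
      = (P *ᵥ lapGrad d Γ P c X) β + half R * (P *ᵥ grad d (P * indMet d c X).trace) β := by
  have hK := fun f => hess_symm (d := d) (Γ := Γ) h.comm h.torsion f
  have e1 : ∀ f μ, (P * symK d Γ f μ * P) μ β = (P * hess d Γ f) μ μ * (P *ᵥ grad d f) β
      + (P *ᵥ grad d f) μ * (hess d Γ f * P) μ β := fun f μ => by
    rw [symK, Matrix.mul_add, Matrix.add_mul, mul_vecMulVec, mul_vecMulVec, vecMulVec_mul,
      vecMulVec_mul, ← mulVec_transpose, h.symm, Matrix.add_apply, vecMulVec_apply,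
      vecMulVec_apply]
    congr 2
    conv_rhs => rw [← hK f]
    rfl
  have e2 : ∀ f, ∑ μ, (P * symK d Γ f μ * P) μ β
      = lap d Γ P f * (P *ᵥ grad d f) β + (P *ᵥ (hess d Γ f *ᵥ (P *ᵥ grad d f))) β := fun f => by
    simp only [e1, Finset.sum_add_distrib, ← Finset.sum_mul]
    rw [lap_eq_trace h.comm h.torsion]
    congr 1
    have : ((P *ᵥ grad d f) ᵥ* (hess d Γ f * P)) β = (P *ᵥ (hess d Γ f *ᵥ (P *ᵥ grad d f))) β := by
      rw [← mulVec_transpose, Matrix.transpose_mul, h.symm, hK, ← Matrix.mulVec_mulVec]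
    exact this
  have e3 : ∑ μ, (P * lowD d Γ μ (indMet d c X) * P) μ β
      = ∑ a, c a • ∑ μ, (P * symK d Γ (X a) μ * P) μ β := by
    simp only [lowD_indMet, Finset.sum_mul, Finset.mul_sum, Matrix.smul_mul, mul_smul_comm,
      Matrix.sum_apply, Matrix.smul_apply, Finset.smul_sum]
    rw [Finset.sum_comm]
  rw [e3, grad_trace h, lapGrad]
  simp only [e2, Matrix.mulVec_smul, Matrix.mulVec_sum, Pi.smul_apply, Finset.sum_apply, smul_add,
    Finset.sum_add_distrib, smul_eq_mul]
  linear_combination (-∑ a, c a • (P *ᵥ (hess d Γ (X a) *ᵥ (P *ᵥ grad d (X a)))) β)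
    * two_mul_half (R := R)

variable {Q θ Ω gi : Matrix n n R} {E Ei : R} {c : ι → ℂ} {X : ι → R}

theorem sum_sum_mul_eq_dotProduct (M : Matrix n n R) (u w : n → R) :
    ∑ μ, ∑ ν, M μ ν * u μ * w ν = u ⬝ᵥ M *ᵥ w := by
  simp only [dotProduct, mulVec, Finset.mul_sum]
  exact Finset.sum_congr rfl fun _ _ => Finset.sum_congr rfl fun _ _ => by ring

theorem sum_sum_mul_eq_trace (M N : Matrix n n R) (hN : Nᵀ = N) :
    ∑ μ, ∑ ν, M μ ν * N μ ν = (M * N).trace := by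
  conv_rhs => rw [← hN]
  simp [Matrix.trace, Matrix.mul_apply]

theorem upD_gi (h : MetricConnection d Γ P) {g : Matrix n n R}
    (hgi : gi = (half R * (P * g).trace) • P - P * g * P) (μ : n) :
    upD d Γ μ gi = (half R * d μ (P * g).trace) • P - P * lowD d Γ μ g * P := by
  rw [hgi, upD_sub, upD_smul, upD_sandwich h, h.parallel, smul_zero, add_zero,
    Derivation.leibniz, derivation_half, smul_zero, add_zero, smul_eq_mul]

/-- The formula for `g⁻¹` removes all derivatives of the inverse metric. The terms in `|dt|²` and in
`|dE|²` cancel, and by `hsq` the two curvature terms `(Gg) Ric·GgG - 2R` merge into `2 Ric·GgGgG`.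
-/
theorem four_mul_intr (h : MetricConnection d (chr d P Q) P) (hEi : E * Ei = 1) (hQP : Q * P = 1)
    (hgi : gi = (half R * (P * indMet d c X).trace) • P - P * indMet d c X * P)
    (hsq : P * indMet d c X * P * indMet d c X * P
      = (half R * (P * indMet d c X).trace) • (P * indMet d c X * P) - P) :
    4 * E * intr d P Q (indMet d c X) gi E Ei
      = 4 * ((P * indMet d c X * P * indMet d c X).trace * lap d (chr d P Q) P E)
        + 4 * ((P * indMet d c X).trace
          * (grad d (P * indMet d c X).trace ⬝ᵥ P *ᵥ grad d E))
        + 6 * E * normSq d (chr d P Q) P (indMet d c X)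
        - 8 * E * ∑ μ, ((P * lowD d (chr d P Q) μ (indMet d c X) * P)
            *ᵥ lapGrad d (chr d P Q) P c X) μ
        + 8 * E * (ric d (chr d P Q) * (P * indMet d c X * P * indMet d c X * P)).trace
        + 8 * E * divg d (chr d P Q) ((P * indMet d c X * P) *ᵥ lapGrad d (chr d P Q) P c X)
        - 4 * E * twistSq d (chr d P Q) P (indMet d c X)
        + 2 * E * (grad d (P * indMet d c X).trace ⬝ᵥ P *ᵥ lapGrad d (chr d P Q) P c X)
        - 2 * (P * indMet d c X).trace * (grad d E ⬝ᵥ P *ᵥ lapGrad d (chr d P Q) P c X)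
        + 8 * (grad d E ⬝ᵥ (P * indMet d c X * P) *ᵥ lapGrad d (chr d P Q) P c X) := by
  have hg := indMet_transpose d c X
  have hm := sum_lowD_indMet h c X
  set g := indMet d c X with hgdef
  set Γ := chr d P Q
  set V := lapGrad d Γ P c X
  set t := (P * g).trace with ht
  have hN : ∀ μ, (lowD d Γ μ g)ᵀ = lowD d Γ μ g := fun μ => by rw [lowD_transpose, hg]
  have hu := upD_gi h hgi
  simp only [← ht] at hu
  have hPs : ∀ i j, P i j = P j i := fun i j => congrFun (congrFun h.symm j) i
  have ht' : ∀ κ, (P * lowD d Γ κ g).trace = d κ t := fun κ => by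
    rw [ht, trace_upD_mul d Γ, h.parallel, Matrix.zero_mul, Matrix.trace_zero, zero_add]
  have ett : ∑ μ, ∑ ν, P μ ν * g μ ν = t := sum_sum_mul_eq_trace P g hg
  -- The `½dt` from differentiating `½tP` cancels the one in `sum_lowD_indMet`.
  have edv : divInv d Γ gi = -(P *ᵥ V) := by
    ext β
    have : ∑ α, half R * d α t * P α β = half R * (P *ᵥ grad d t) β := by
      simp only [mulVec, dotProduct, Finset.mul_sum, grad]
      exact Finset.sum_congr rfl fun α _ => by rw [hPs α β]; ring
    simp only [divInv, hu, Matrix.sub_apply, Matrix.smul_apply, smul_eq_mul,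
      Finset.sum_sub_distrib, hm, this, Pi.neg_apply]
    ring
  -- the individual terms
  have e3 : ∑ ν, ∑ κ, ∑ μ, ∑ β, P ν κ * upD d Γ ν gi μ β * lowD d Γ κ g μ β
      = half R * (grad d t ⬝ᵥ P *ᵥ grad d t) - normSq d Γ P g := by
    have f1 : ∀ ν κ, ∑ μ, ∑ β, P ν κ * upD d Γ ν gi μ β * lowD d Γ κ g μ β
        = half R * (P ν κ * d ν t * d κ t)
          - P ν κ * (P * lowD d Γ ν g * P * lowD d Γ κ g).trace := fun ν κ => by
      simp only [mul_assoc (P ν κ), ← Finset.mul_sum]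
      rw [sum_sum_mul_eq_trace _ _ (hN κ), hu, Matrix.sub_mul, Matrix.trace_sub, Matrix.smul_mul,
        Matrix.trace_smul, ht', smul_eq_mul]
      ring
    simp only [f1, Finset.sum_sub_distrib, ← Finset.mul_sum, normSq]
    rw [← sum_sum_mul_eq_dotProduct]
    rfl
  have e4 : ∑ μ, ∑ κ, ∑ β, P μ κ * lowD d Γ κ g μ β * divInv d Γ gi β
      = -∑ μ, ((P * lowD d Γ μ g * P) *ᵥ V) μ := by
    rw [Finset.sum_comm, ← Finset.sum_neg_distrib]
    refine Finset.sum_congr rfl fun κ _ => ?_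
    rw [← Matrix.mulVec_mulVec, ← Pi.neg_apply, ← Matrix.mulVec_neg, ← edv, Finset.sum_comm]
    simp only [mulVec, dotProduct, Matrix.mul_apply, Finset.sum_mul, hPs κ]
  have e5 : ∑ μ, ∑ ν, ric d Γ μ ν * (P * g * P) μ ν = (ric d Γ * (P * g * P)).trace :=
    sum_sum_mul_eq_trace _ _ (sandwich_transpose h hg)
  have e6 : ∑ ρ, ∑ ν, P ρ ν * ric d Γ ρ ν = (ric d Γ * P).trace := by
    rw [← sum_sum_mul_eq_trace _ _ h.symm]
    simp only [mul_comm]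
  have e56 : (ric d Γ * (P * g * P * g * P)).trace
      = half R * t * (ric d Γ * (P * g * P)).trace - (ric d Γ * P).trace := by
    rw [hsq, Matrix.mul_sub, Matrix.trace_sub, Matrix.mul_smul, Matrix.trace_smul, smul_eq_mul]
  have e7 : divg d Γ (fun ν => ∑ μ, ∑ β, P μ ν * g μ β * divInv d Γ gi β)
      = -divg d Γ ((P * g * P) *ᵥ V) := by
    have f1 : (fun ν => ∑ μ, ∑ β, P μ ν * g μ β * divInv d Γ gi β) = -((P * g * P) *ᵥ V) := by
      ext ν
      rw [← Matrix.mulVec_mulVec, ← Matrix.mulVec_neg, ← edv, Finset.sum_comm]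
      simp only [mulVec, dotProduct, Matrix.mul_apply, Finset.sum_mul, hPs ν]
    rw [f1, divg, divg, ← Finset.sum_neg_distrib]
    refine Finset.sum_congr rfl fun μ _ => ?_
    simp only [Pi.neg_apply, map_neg, mul_neg, Finset.sum_neg_distrib]
    ring
  have e8 : ∑ μ, ∑ β, ∑ α, ∑ ρ, Q μ β * upD d Γ α gi μ ρ * upD d Γ ρ gi α β
      = -(half R * half R * (grad d t ⬝ᵥ P *ᵥ grad d t)) - 2 * half R * (grad d t ⬝ᵥ P *ᵥ V)
        + twistSq d Γ P g := by
    have f1 : ∀ α ρ, ∑ μ, ∑ β, Q μ β * upD d Γ α gi μ ρ * upD d Γ ρ gi α β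
        = half R * half R * (P α ρ * d α t * d ρ t)
          - half R * (d ρ t * (P * lowD d Γ α g * P) α ρ)
          - half R * (d α t * (P * lowD d Γ ρ g * P) ρ α)
          + (P * lowD d Γ ρ g * P * lowD d Γ α g * P) α ρ := fun α ρ => by
      have g1 : ∑ μ, ∑ β, Q μ β * upD d Γ α gi μ ρ * upD d Γ ρ gi α β
          = (upD d Γ ρ gi * Qᵀ * upD d Γ α gi) α ρ := by
        simp only [Matrix.mul_apply, Finset.sum_mul, Matrix.transpose_apply]
        exact Finset.sum_congr rfl fun _ _ => Finset.sum_congr rfl fun _ _ => by ring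
      have hPQ : P * Qᵀ = 1 := by
        rw [← h.symm, ← Matrix.transpose_mul, hQP, Matrix.transpose_one]
      have g2 : upD d Γ ρ gi * Qᵀ * upD d Γ α gi
          = (half R * half R * d ρ t * d α t) • P - (half R * d ρ t) • (P * lowD d Γ α g * P)
            - (half R * d α t) • (P * lowD d Γ ρ g * P)
            + P * lowD d Γ ρ g * P * lowD d Γ α g * P := by
        rw [hu, hu]
        have hPQM : ∀ M N : Matrix n n R, M * P * Qᵀ * N = M * N := fun M N => by
          rw [Matrix.mul_assoc M, hPQ, Matrix.mul_one]
        simp only [Matrix.sub_mul, Matrix.mul_sub, Matrix.smul_mul, Matrix.mul_smul, hPQ,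
          Matrix.one_mul, smul_sub, smul_smul, ← Matrix.mul_assoc, hPQM]
        rw [show half R * d α t * (half R * d ρ t) = half R * half R * d ρ t * d α t by ring]
        abel
      have g3 : (P * lowD d Γ ρ g * P) ρ α = (P * lowD d Γ ρ g * P) α ρ :=
        congrFun (congrFun (sandwich_transpose h (hN ρ)) α) ρ
      rw [g1, g2, g3]
      simp only [Matrix.add_apply, Matrix.sub_apply, Matrix.smul_apply, smul_eq_mul]
      ring
    have f2 : ∑ α, ∑ ρ, d ρ t * (P * lowD d Γ α g * P) α ρ
        = grad d t ⬝ᵥ P *ᵥ V + half R * (grad d t ⬝ᵥ P *ᵥ grad d t) := by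
      rw [Finset.sum_comm]
      simp only [← Finset.mul_sum, hm, mul_add, Finset.sum_add_distrib, mul_left_comm _ (half R)]
      rfl
    have f3 : ∑ α, ∑ ρ, d α t * (P * lowD d Γ ρ g * P) ρ α
        = grad d t ⬝ᵥ P *ᵥ V + half R * (grad d t ⬝ᵥ P *ᵥ grad d t) := by
      rw [← f2, Finset.sum_comm]
    have f4 := sum_sum_mul_eq_dotProduct P (grad d t) (grad d t)
    rw [sum_sum_comm, ← f4, twistSq]
    simp only [f1, Finset.sum_add_distrib, Finset.sum_sub_distrib]
    have f5 : ∀ (x : R) (F : n → n → R), ∑ α, ∑ ρ, x * F α ρ = x * ∑ α, ∑ ρ, F α ρ :=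
      fun x F => by simp only [Finset.mul_sum]
    rw [f5, f5, f5, f2, f3, ← f4]
    simp only [grad]
    ring
  have eη : grad d (half R * half R * E * t)
      = (half R * half R) • (E • grad d t + t • grad d E) := by
    ext μ
    simp only [grad, Derivation.leibniz, derivation_half, smul_eq_mul, Pi.smul_apply, Pi.add_apply]
    ring
  have e2 : ∑ μ, ∑ ν, P μ ν * d μ (half R * half R * E * t) * d ν (half R * half R * E * t)
      = (half R * half R) * (half R * half R) * (E * E * (grad d t ⬝ᵥ P *ᵥ grad d t)
        + 2 * E * t * (grad d t ⬝ᵥ P *ᵥ grad d E) + t * t * (grad d E ⬝ᵥ P *ᵥ grad d E)) := by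
    have f1 := sum_sum_mul_eq_dotProduct P (grad d (half R * half R * E * t))
      (grad d (half R * half R * E * t))
    rw [eη] at f1
    simp only [Matrix.mulVec_smul, Matrix.mulVec_add, smul_dotProduct, dotProduct_smul,
      add_dotProduct, dotProduct_add, smul_eq_mul] at f1
    rw [dotProduct_mulVec_symm h.symm (grad d E) (grad d t), ← eη] at f1
    refine f1.trans ?_
    ring
  have e2' : ∑ μ, ∑ ν, P μ ν * (Ei * d μ E) * (Ei * d ν E)
      = Ei * Ei * (grad d E ⬝ᵥ P *ᵥ grad d E) := by
    rw [← sum_sum_mul_eq_dotProduct]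
    simp only [Finset.mul_sum, grad]
    exact Finset.sum_congr rfl fun _ _ => Finset.sum_congr rfl fun _ _ => by ring
  have e9 : ∑ α, divInv d Γ gi α * d α (half R * half R * E * t)
      = -(half R * half R * (E * (grad d t ⬝ᵥ P *ᵥ V) + t * (grad d E ⬝ᵥ P *ᵥ V))) := by
    change divInv d Γ gi ⬝ᵥ grad d (half R * half R * E * t) = _
    rw [eη, edv, neg_dotProduct, dotProduct_comm, smul_dotProduct, add_dotProduct,
      smul_dotProduct, smul_dotProduct]
    rfl
  have e10 : ∑ α, divInv d Γ gi α * (Ei * d α E) = -(Ei * (grad d E ⬝ᵥ P *ᵥ V)) := by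
    change divInv d Γ gi ⬝ᵥ (Ei • grad d E) = _
    rw [edv, neg_dotProduct, dotProduct_comm, smul_dotProduct, smul_eq_mul]
  have e11 : ∑ μ, ∑ ν, ∑ α, gi μ ν * Q μ α * divInv d Γ gi α * (Ei * d ν E)
      = -(Ei * (half R * t * (grad d E ⬝ᵥ P *ᵥ V) - grad d E ⬝ᵥ (P * g * P) *ᵥ V)) := by
    have f1 : ∑ μ, ∑ ν, ∑ α, gi μ ν * Q μ α * divInv d Γ gi α * (Ei * d ν E)
        = (Q *ᵥ divInv d Γ gi) ⬝ᵥ gi *ᵥ (Ei • grad d E) := by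
      simp only [dotProduct, mulVec, Finset.mul_sum, Finset.sum_mul, Pi.smul_apply, smul_eq_mul,
        grad]
      exact Finset.sum_congr rfl fun _ _ => Finset.sum_congr rfl fun _ _ =>
        Finset.sum_congr rfl fun _ _ => by ring
    rw [f1, edv, Matrix.mulVec_neg, Matrix.mulVec_mulVec, hQP, Matrix.one_mulVec,
      Matrix.mulVec_smul, dotProduct_smul, neg_dotProduct, hgi, Matrix.sub_mulVec,
      Matrix.smul_mulVec, dotProduct_sub, dotProduct_smul, dotProduct_mulVec_symm h.symm V,
      dotProduct_mulVec_symm (sandwich_transpose h hg) V]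
    simp only [smul_eq_mul, mul_neg]
  rw [intr, ett, e2, e2', e3, e4, e5, e6, e7, e8, e9, e10, e11, e56]
  generalize (P * g * P * g).trace = S, ric d Γ * (P * g * P) = rH, ric d Γ * P = rP,
    ∑ μ, ((P * lowD d Γ μ g * P) *ᵥ V) μ = m, divg d Γ ((P * g * P) *ᵥ V) = w,
    grad d t ⬝ᵥ P *ᵥ grad d t = tt, grad d t ⬝ᵥ P *ᵥ grad d E = te,
    grad d E ⬝ᵥ P *ᵥ grad d E = ee, grad d t ⬝ᵥ P *ᵥ V = tV, grad d E ⬝ᵥ P *ᵥ V = eV,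
    grad d E ⬝ᵥ (P * g * P) *ᵥ V = eHV, lap d Γ P E = L, normSq d Γ P g = nn,
    twistSq d Γ P g = qq
  -- The relations `2·½ = 1`, `4·¼ = 1` and `16·(¼)² = 1`, together with `E Ei = 1`, clear all
  -- denominators.
  have k1 := two_mul_half (R := R)
  have k2 : half R * half R * 4 = 1 := by linear_combination (2 * half R + 1) * k1
  have k4 : half R * half R * (half R * half R) * 16 = 1 := by
    linear_combination (half R * half R * 4 + 1) * k2
  linear_combination (4 * S * L + 2 * (E * Ei + 1) * (E * tt + 2 * t * te)
      - 2 * t * t * ee * E * Ei * Ei * (E * Ei + 1) - 2 * (E * tV + t * eV)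
      + 4 * t * eV * (E * Ei + 1) - 4 * t * eV + 8 * eHV) * hEi
    + 2 * (E * E * E * Ei * Ei * tt + 2 * E * E * Ei * Ei * t * te + t * t * ee * (E * Ei * Ei)
      - t * t * ee * (E * E * E * Ei * Ei * Ei * Ei)) * k4
    + (-2 * E * tt - 2 * E * Ei * (E * tV + t * eV) + 4 * E * E * Ei * Ei * t * eV) * k2
    + (6 * E * nn - 4 * E * t * rH.trace + 4 * E * tV - 4 * E * Ei * t * eV) * k1

end Intrinsic

/-! ### Dimension four and the algebraic form of the theorem -/

section FourDimensional
variable {R : Type*} [CommRing R] [Algebra ℂ R] {d : Fin 4 → Derivation ℂ R R}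
  {P Q θ Ω g gi : Matrix (Fin 4) (Fin 4) R} {E Ei : R}

/-- Compare two values of `det P`: the definition gives `E⁻⁴ (det θ)² det g`, the scale relation
`E⁻² det θ`. -/
theorem Background.sq_eq_det (h : Background d P Q θ Ω g E Ei) : E ^ 2 = θ.det * g.det := by
  have h1 : P.det = Ei ^ 4 * (θ.det * g.det * θ.det) := by
    rw [h.eff, ← neg_smul, Matrix.det_smul, Matrix.det_mul, Matrix.det_mul, Fintype.card_fin]
    ring
  have h2 : Q.det * P.det = 1 := by rw [← Matrix.det_mul, h.eff_inv, Matrix.det_one]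
  have h3 : Ω.det * θ.det = 1 := by rw [← Matrix.det_mul, h.inv, Matrix.det_one]
  have h4 : Ei ^ 2 * θ.det = P.det := by
    linear_combination (-Ei ^ 2 * θ.det) * h2 + P.det * θ.det * h.scale + P.det * h3
  have h5 : E ^ 2 * Ei ^ 2 = 1 := by rw [← mul_pow, h.mul_inv, one_pow]
  have h6 : E ^ 4 * Ei ^ 4 = 1 := by rw [← mul_pow, h.mul_inv, one_pow]
  rw [h1] at h4
  linear_combination (-E ^ 2) * h3 + E ^ 4 * Ω.det * h4 - E ^ 2 * Ω.det * θ.det * h5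
    + Ω.det * θ.det * g.det * θ.det * h6 + θ.det * g.det * h3

/-- In four dimensions the effective metric satisfies a quadratic Cayley–Hamilton identity. -/
theorem Background.two_smul_sq (h : Background d P Q θ Ω g E Ei) (hgi : g * gi = 1) :
    (2 : R) • (g * P * (g * P)) + (2 : R) • 1 = (P * g).trace • (g * P) := by
  have hg : IsUnit g.det := (Matrix.isUnit_iff_isUnit_det g).1 (IsUnit.of_mul_eq_one _ hgi)
  have hθ : IsUnit θ.det :=
    (Matrix.isUnit_iff_isUnit_det θ).1 (IsUnit.of_mul_eq_one _ (mul_eq_one_comm.1 h.inv))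
  -- Thus `gP` is a multiple of `(gθ)²`, and `E² = det θ det g` normalises the constant term of its
  -- quadratic equation.
  have h1 : g * θ * g * θ = -(E • (g * P)) := by
    rw [h.eff, mul_neg, Matrix.mul_smul, smul_neg, smul_smul, h.mul_inv, one_smul, neg_neg]
    simp only [Matrix.mul_assoc]
  have key := sq_asym_mul_symm isUnit_two h.antisymm h.symm hθ hg
  rw [h1, mul_assoc 2, ← h.sq_eq_det, Matrix.trace_neg, Matrix.trace_smul, Matrix.trace_mul_comm]
    at key
  simp only [Matrix.smul_mul, Matrix.mul_smul, smul_smul, smul_neg, neg_mul,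
    Matrix.mul_neg, neg_smul, neg_neg, smul_eq_mul] at key
  have hE : Ei * Ei * (E * E) = 1 := by linear_combination (E * Ei + 1) * h.mul_inv
  have := congrArg (fun M => (Ei * Ei) • M) key
  simp only [smul_add, smul_smul] at this
  rw [show Ei * Ei * (2 * (E * E)) = 2 by linear_combination 2 * hE,
    show Ei * Ei * (2 * E ^ 2) = 2 by linear_combination 2 * hE,
    show Ei * Ei * (E * (P * g).trace * E) = (P * g).trace by
      linear_combination (P * g).trace * hE] at this
  exact this

theorem eq_half_smul {M N : Matrix (Fin 4) (Fin 4) R} (h : (2 : R) • M = N) : M = half R • N := by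
  rw [← h, smul_smul, mul_comm, two_mul_half, one_smul]

theorem Background.inverse_metric (h : Background d P Q θ Ω g E Ei) (hgi : g * gi = 1) :
    gi = (half R * (P * g).trace) • P - P * g * P := by
  have hgi' : gi * g = 1 := mul_eq_one_comm.1 hgi
  have key := congrArg (fun M => gi * M) (h.two_smul_sq hgi)
  simp only [Matrix.mul_add, Matrix.mul_smul, ← Matrix.mul_assoc, hgi', Matrix.one_mul,
    Matrix.mul_one] at key
  rw [← eq_sub_iff_add_eq'] at key
  rw [eq_half_smul key, smul_sub, smul_smul, smul_smul, mul_comm (half R) 2, two_mul_half, one_smul]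

theorem Background.cube (h : Background d P Q θ Ω g E Ei) (hgi : g * gi = 1) :
    P * g * P * g * P = (half R * (P * g).trace) • (P * g * P) - P := by
  have key := congrArg (fun M => P * M) (h.two_smul_sq hgi)
  simp only [Matrix.mul_add, Matrix.mul_smul, ← Matrix.mul_assoc, Matrix.mul_one] at key
  rw [← eq_sub_iff_add_eq] at key
  rw [eq_half_smul key, smul_sub, smul_smul, smul_smul, mul_comm (half R) 2, two_mul_half, one_smul]

/-- Tracing the quadratic identity gives `2S + 8 = t²`, where 8 is twice the dimension. -/
theorem Background.grad_trace_sq (h : Background d P Q θ Ω g E Ei) (hgi : g * gi = 1) :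
    grad d (P * g * P * g).trace = (P * g).trace • grad d (P * g).trace := by
  have h1 := congrArg Matrix.trace (h.two_smul_sq hgi)
  rw [Matrix.trace_add, Matrix.trace_smul, Matrix.trace_smul, Matrix.trace_smul,
    Matrix.trace_one, Fintype.card_fin, ← Matrix.mul_assoc, Matrix.trace_mul_comm (g * P * g),
    ← Matrix.mul_assoc, ← Matrix.mul_assoc, Matrix.trace_mul_comm g P] at h1
  simp only [smul_eq_mul] at h1
  set t := (P * g).trace
  have h2 : (P * g * P * g).trace = half R * (t * t - 8) := by
    push_cast at h1
    linear_combination half R * h1 - (P * g * P * g).trace * two_mul_half (R := R)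
  ext μ
  have h8 : d μ (8 : R) = 0 := by simpa using (d μ).map_natCast 8
  rw [h2]
  simp only [grad, Derivation.leibniz, map_sub, derivation_half, smul_eq_mul, Pi.smul_apply, h8]
  linear_combination (t * d μ t) * two_mul_half (R := R)

variable {D : ℕ}

theorem Background.matCombination_eq {ε : Fin D → ℝ} {X : Fin D → R}
    (h : Background d P Q θ Ω (indMet d (fun a => (ε a : ℂ)) X) E Ei)
    (hgi : indMet d (fun a => (ε a : ℂ)) X * gi = 1) :
    matCombination (fun f k => Complex.I • pbr d θ f k) ε X
      = -(E ^ 3 * intr d P Q (indMet d (fun a => (ε a : ℂ)) X) gi E Ei) := by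
  have hc := h.metricConnection
  set c : Fin D → ℂ := fun a => (ε a : ℂ) with hcdef
  have hI : ∀ f k : R, Complex.I • f * Complex.I • k = -(f * k) := fun f k => by
    rw [smul_mul_smul_comm, Complex.I_mul_I, neg_one_smul]
  have hpbr : ∀ f k, pbr d θ f (Complex.I • k) = Complex.I • pbr d θ f k := fun f k => by
    simp only [pbr, (d _).map_smul, mul_smul_comm, Finset.smul_sum]
  have hII : ∀ f : R, Complex.I • Complex.I • f = -f := fun f => by
    rw [smul_smul, Complex.I_mul_I, neg_one_smul]
  -- the building blocks
  have eH : ∀ a b, matH (fun f k => Complex.I • pbr d θ f k) ε X a b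
      = -(E * (grad d (X a) ⬝ᵥ P *ᵥ grad d (X b))) := fun a b => by
    have e1 : ∀ e : Fin D, Complex.I • pbr d θ (X a) (X e) * Complex.I • pbr d θ (X b) (X e)
        + Complex.I • pbr d θ (X b) (X e) * Complex.I • pbr d θ (X a) (X e)
        = (-2 : ℂ) • (pbr d θ (X a) (X e) * pbr d θ (X b) (X e)) := fun e => by
      rw [hI, hI, neg_smul, two_smul]
      ring
    simp only [matH, e1, smul_comm _ (-2 : ℂ), ← Finset.smul_sum]
    rw [smul_smul]
    have e2 : ∑ e, (ε e : ℂ) • (pbr d θ (X a) (X e) * pbr d θ (X b) (X e))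
        = E * (grad d (X a) ⬝ᵥ P *ᵥ grad d (X b)) := by
      have f1 := sum_smul_grad d c X (θ *ᵥ grad d (X b))
      have f2 := congrArg (fun w => grad d (X a) ⬝ᵥ θ *ᵥ w) f1
      simp only [Matrix.mulVec_sum, Matrix.mulVec_smul, dotProduct_sum, dotProduct_smul] at f2
      rw [h.eff, Matrix.neg_mulVec, dotProduct_neg, Matrix.smul_mulVec, dotProduct_smul,
        ← Matrix.mulVec_mulVec, ← Matrix.mulVec_mulVec, ← f2, smul_eq_mul, mul_neg, ← mul_assoc,
        h.mul_inv, one_mul, ← Finset.sum_neg_distrib]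
      refine Finset.sum_congr rfl fun e _ => ?_
      rw [mulVec_dotProduct, h.antisymm, Matrix.neg_mulVec, dotProduct_neg, ← pbr_eq, ← pbr_eq,
        ← smul_neg, smul_eq_mul]
      congr 1
      ring
    rw [e2, show (-2 : ℂ) * (1 / 2) = -1 by norm_num, neg_one_smul]
  have eB : ∀ Φ, matBox (fun f k => Complex.I • pbr d θ f k) ε X Φ
      = -(E * lap d (chr d P Q) P Φ) := fun Φ => by
    rw [← h.sum_pbr_pbr, ← Finset.sum_neg_distrib]
    refine Finset.sum_congr rfl fun a _ => ?_
    change (ε a : ℂ) • Complex.I • pbr d θ (X a) (Complex.I • pbr d θ (X a) Φ) = _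
    rw [hpbr, hII, smul_neg]
  have lap_neg : ∀ f, lap d (chr d P Q) P (-f) = -lap d (chr d P Q) P f := fun f => by
    simp only [lap, map_neg, mul_neg, ← Finset.sum_neg_distrib]
    exact Finset.sum_congr rfl fun _ _ => Finset.sum_congr rfl fun _ _ => by
      rw [Finset.sum_neg_distrib]; ring
  have e1 : ∑ a, ∑ b, ((ε a : ℂ) * (ε b : ℂ)) • (matH (fun f k => Complex.I • pbr d θ f k) ε X a b
      * matBox (fun f k => Complex.I • pbr d θ f k) ε X
        (matH (fun f k => Complex.I • pbr d θ f k) ε X a b))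
      = -(E ^ 2 * ∑ a, ∑ b, (c a * c b) • ((grad d (X a) ⬝ᵥ P *ᵥ grad d (X b))
        * lap d (chr d P Q) P (E * (grad d (X a) ⬝ᵥ P *ᵥ grad d (X b))))) := by
    simp only [Finset.mul_sum, ← Finset.sum_neg_distrib, eH, eB, lap_neg, mul_smul_comm, ← smul_neg]
    exact Finset.sum_congr rfl fun _ _ => Finset.sum_congr rfl fun _ _ => by
      congr 1
      ring
  have e2 : ∑ a, ∑ b, ∑ e, ((ε a : ℂ) * (ε b : ℂ) * (ε e : ℂ)) •
      (matBox (fun f k => Complex.I • pbr d θ f k) ε X (X e)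
        * matH (fun f k => Complex.I • pbr d θ f k) ε X a b
        * Complex.I • pbr d θ (X a) (Complex.I • pbr d θ (X b) (X e)))
      = -(E ^ 2 * ∑ e, c e • (lap d (chr d P Q) P (X e) * ∑ a, ∑ b, (c a * c b) •
        ((grad d (X a) ⬝ᵥ P *ᵥ grad d (X b)) * pbr d θ (X a) (pbr d θ (X b) (X e))))) := by
    rw [sum_rotate]
    simp only [Finset.mul_sum, ← Finset.sum_neg_distrib, eH, eB, hpbr, hII, mul_smul_comm,
      ← smul_neg, Finset.smul_sum, smul_smul]
    exact Finset.sum_congr rfl fun _ _ => Finset.sum_congr rfl fun _ _ =>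
      Finset.sum_congr rfl fun _ _ => by
        congr 1 <;> ring
  have k1 := sum_inner_mul_lap hc c X E
  rw [h.grad_trace_sq hgi, Matrix.mulVec_smul, dotProduct_smul, smul_eq_mul,
    dotProduct_mulVec_symm hc.symm (grad d E)] at k1
  have k2 := sum_hess_bochner hc c X
  have k3 := two_mul_twistSq hc c X
  have k4 := four_mul_intr hc h.mul_inv h.eff_inv (h.inverse_metric hgi) (h.cube hgi)
  have k5 : 4 * ∑ e, c e • (lap d (chr d P Q) P (X e) * ∑ a, ∑ b, (c a * c b) •
        ((grad d (X a) ⬝ᵥ P *ᵥ grad d (X b)) * pbr d θ (X a) (pbr d θ (X b) (X e))))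
      = 4 * E * ∑ a, c a • (lap d (chr d P Q) P (X a)
          * (P * indMet d c X * P * hess d (chr d P Q) (X a)).trace)
        + 4 * (grad d E ⬝ᵥ (P * indMet d c X * P) *ᵥ lapGrad d (chr d P Q) P c X)
        + E * (grad d (P * indMet d c X).trace ⬝ᵥ P *ᵥ lapGrad d (chr d P Q) P c X)
        - (P * indMet d c X).trace * (grad d E ⬝ᵥ P *ᵥ lapGrad d (chr d P Q) P c X) := by
    simp only [lapGrad, Matrix.mulVec_sum, Matrix.mulVec_smul, dotProduct_sum, dotProduct_smul,
      Finset.mul_sum (s := univ) (a := (4 : R)), Finset.mul_sum (a := 4 * E),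
      Finset.mul_sum (a := E), Finset.mul_sum (a := (P * indMet d c X).trace),
      ← Finset.sum_add_distrib, ← Finset.sum_sub_distrib]
    refine Finset.sum_congr rfl fun e _ => ?_
    have := h.sum_inner_mul_pbr_pbr (X e)
    simp only [mul_smul_comm, ← smul_add, ← smul_sub]
    congr 1
    simp only [smul_eq_mul]
    linear_combination lap d (chr d P Q) P (X e) * this
  rw [matCombination, e1, e2, two_smul]
  have h4 : IsUnit (4 : R) := by
    rw [show (4 : R) = 2 * 2 by norm_num]
    exact isUnit_two.mul isUnit_two
  refine h4.mul_left_cancel ?_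
  -- `k1` and `k5` expand the left-hand side, `k2` removes `□S` and both Hessian sums, `k3` removes
  -- `tau`, and `k4` recognises the remainder.
  linear_combination (-2 * E ^ 2) * k1 - 2 * E ^ 2 * k5 - 2 * E ^ 3 * k2 - 2 * E ^ 3 * k3
    + E ^ 2 * k4

end FourDimensional

/-! ### Smooth functions on `U` as an algebra with derivations -/

section SmoothFunctions
variable (U : Set Coord)

/-- The algebra of smooth functions on `U`. -/
def smoothFun : Subalgebra ℂ (U → ℂ) where
  carrier := {r | ∃ F : Coord → ℂ, ContDiffOn ℝ ∞ F U ∧ ∀ y : U, F y = r y}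
  mul_mem' := by
    rintro r s ⟨F, hF, hr⟩ ⟨K, hK, hs⟩
    exact ⟨fun y => F y * K y, hF.mul hK, fun y => by simp [hr, hs]⟩
  add_mem' := by
    rintro r s ⟨F, hF, hr⟩ ⟨K, hK, hs⟩
    exact ⟨fun y => F y + K y, hF.add hK, fun y => by simp [hr, hs]⟩
  algebraMap_mem' c := ⟨fun _ => c, contDiffOn_const, fun _ => rfl⟩

variable {U}

/-- Evaluation at a point. -/
def ev (y : U) : smoothFun U →ₐ[ℂ] ℂ := (Pi.evalAlgHom ℂ (fun _ : U => ℂ) y).comp (smoothFun U).val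

theorem ev_ext {r s : smoothFun U} (h : ∀ y, ev y r = ev y s) : r = s :=
  Subtype.ext (funext h)

/-- The function `F` restricts to `r` on `U`. -/
def Rep (F : Coord → ℂ) (r : smoothFun U) : Prop := ∀ y : U, F y = ev y r

/-- The matrix valued function `T` restricts to `M` on `U`. -/
def RepM (T : TensorField) (M : Matrix (Fin 4) (Fin 4) (smoothFun U)) : Prop :=
  ∀ y : U, T y = (ev y).mapMatrix M

theorem RepM.apply {T : TensorField} {M : Matrix (Fin 4) (Fin 4) (smoothFun U)} (h : RepM T M)
    (i j : Fin 4) : Rep (fun y => T y i j) (M i j) := fun y => by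
  change T y i j = _
  rw [h y]
  rfl

theorem exists_rep {F : Coord → ℂ} (hF : ContDiffOn ℝ ∞ F U) : ∃ r : smoothFun U, Rep F r :=
  ⟨⟨fun y => F y, F, hF, fun _ => rfl⟩, fun _ => rfl⟩

theorem exists_repM {T : TensorField} (hT : ∀ i j, ContDiffOn ℝ ∞ (fun y => T y i j) U) :
    ∃ M : Matrix (Fin 4) (Fin 4) (smoothFun U), RepM T M := by
  choose M hM using fun i j => exists_rep (hT i j)
  exact ⟨Matrix.of M, fun y => by ext i j; exact hM i j y⟩

theorem isUnit_of_ev_ne_zero {r : smoothFun U} (h : ∀ y, ev y r ≠ 0) : IsUnit r := by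
  obtain ⟨r, F, hF, hr⟩ := r
  refine IsUnit.of_mul_eq_one
    ⟨fun y => (F y)⁻¹, fun y => (F y)⁻¹, hF.inv fun y hy => ?_, fun _ => rfl⟩ (ev_ext fun y => ?_)
  · rw [hr ⟨y, hy⟩]
    exact h ⟨y, hy⟩
  · rw [map_one]
    change r y * (F y)⁻¹ = 1
    rw [hr]
    exact mul_inv_cancel₀ (h y)

theorem RepM.isUnit_det {T : TensorField} {M : Matrix (Fin 4) (Fin 4) (smoothFun U)}
    (h : RepM T M) (hT : ∀ y ∈ U, (T y).det ≠ 0) : IsUnit M.det :=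
  isUnit_of_ev_ne_zero fun y => by
    rw [AlgHom.map_det, ← h y]
    exact hT y y.2

theorem RepM.inv {T : TensorField} {M : Matrix (Fin 4) (Fin 4) (smoothFun U)} (h : RepM T M)
    (hM : IsUnit M.det) : RepM (fun y => (T y)⁻¹) M⁻¹ := fun y => by
  change (T y)⁻¹ = _
  refine Matrix.inv_eq_left_inv ?_
  rw [h y, ← map_mul, Matrix.nonsing_inv_mul _ hM, map_one]

/-- Extension by zero. -/
noncomputable def extend (r : smoothFun U) (y : Coord) : ℂ := by
  classical exact if h : y ∈ U then ev ⟨y, h⟩ r else 0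

theorem rep_extend (r : smoothFun U) : Rep (extend r) r := fun y => by
  rw [extend, dif_pos y.2]

theorem Rep.contDiffOn {F : Coord → ℂ} {r : smoothFun U} (h : Rep F r) : ContDiffOn ℝ ∞ F U := by
  obtain ⟨K, hK, hr⟩ := r.2
  exact hK.congr fun y hy => (h ⟨y, hy⟩).trans (hr ⟨y, hy⟩).symm

theorem contDiffOn_pd (hU : IsOpen U) (μ : Fin 4) {F : Coord → ℂ} (hF : ContDiffOn ℝ ∞ F U) :
    ContDiffOn ℝ ∞ (pd μ F) U :=
  (hF.fderiv_of_isOpen hU (by simp)).clm_apply contDiffOn_const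

/-- Since `U` is open, derivatives on `U` do not depend on the chosen extension; this makes the
extension by zero harmless. -/
theorem pd_congr (hU : IsOpen U) (μ : Fin 4) {F K : Coord → ℂ} (h : ∀ y ∈ U, F y = K y) {y : Coord}
    (hy : y ∈ U) : pd μ F y = pd μ K y := by
  rw [pd, pd, Filter.EventuallyEq.fderiv_eq (Filter.mem_of_superset (hU.mem_nhds hy) h)]

theorem pd_comm (hU : IsOpen U) (μ ν : Fin 4) {F : Coord → ℂ} (hF : ContDiffOn ℝ ∞ F U)
    {y : Coord} (hy : y ∈ U) : pd μ (pd ν F) y = pd ν (pd μ F) y := by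
  have hc := hF.contDiffAt (hU.mem_nhds hy)
  have hs : IsSymmSndFDerivAt ℝ F y := hc.isSymmSndFDerivAt (by
    rw [minSmoothness_of_isRCLikeNormedField]; exact WithTop.coe_le_coe.2 (le_top : (2 : ℕ∞) ≤ ⊤))
  have hd : DifferentiableAt ℝ (fderiv ℝ F) y :=
    (hc.fderiv_right (m := 1) (by norm_cast)).differentiableAt (by simp)
  have e : ∀ μ ν, pd μ (pd ν F) y
      = fderiv ℝ (fderiv ℝ F) y (Pi.single μ 1) (Pi.single ν 1) := fun μ ν => by
    change fderiv ℝ (fun z => fderiv ℝ F z (Pi.single ν 1)) y _ = _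
    rw [fderiv_clm_apply hd (differentiableAt_const _)]
    simp
  rw [e, e]
  exact hs.eq _ _

/-- The partial derivative of a smooth function on `U`. -/
noncomputable def partialFun (hU : IsOpen U) (μ : Fin 4) (r : smoothFun U) : smoothFun U :=
  ⟨fun y => pd μ (extend r) y, pd μ (extend r), contDiffOn_pd hU μ (rep_extend r).contDiffOn,
    fun _ => rfl⟩

theorem Rep.partialFun (hU : IsOpen U) {F : Coord → ℂ} {r : smoothFun U} (h : Rep F r) (μ : Fin 4) :
    Rep (pd μ F) (partialFun hU μ r) := fun y =>
  pd_congr hU μ (fun z hz => (h ⟨z, hz⟩).trans (rep_extend r ⟨z, hz⟩).symm) y.2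

theorem Rep.differentiableAt (hU : IsOpen U) {F : Coord → ℂ} {r : smoothFun U} (h : Rep F r)
    (y : U) : DifferentiableAt ℝ F y :=
  (h.contDiffOn.contDiffAt (hU.mem_nhds y.2)).differentiableAt (by simp)

theorem Rep.add {F K : Coord → ℂ} {r s : smoothFun U} (hF : Rep F r) (hK : Rep K s) :
    Rep (F + K) (r + s) := fun y => by rw [map_add, ← hF y, ← hK y]; rfl

theorem Rep.mul {F K : Coord → ℂ} {r s : smoothFun U} (hF : Rep F r) (hK : Rep K s) :
    Rep (F * K) (r * s) := fun y => by rw [map_mul, ← hF y, ← hK y]; rfl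

theorem Rep.smul (c : ℂ) {F : Coord → ℂ} {r : smoothFun U} (hF : Rep F r) :
    Rep (c • F) (c • r) := fun y => by rw [map_smul, ← hF y]; rfl

theorem partialFun_add (hU : IsOpen U) (μ : Fin 4) (r s : smoothFun U) :
    partialFun hU μ (r + s) = partialFun hU μ r + partialFun hU μ s := ev_ext fun y => by
  have hr := rep_extend r
  have hs := rep_extend s
  rw [map_add, ← (hr.add hs).partialFun hU μ y, ← hr.partialFun hU μ y, ← hs.partialFun hU μ y, pd,
    fderiv_add (hr.differentiableAt hU y) (hs.differentiableAt hU y)]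
  rfl

theorem partialFun_smul (hU : IsOpen U) (μ : Fin 4) (c : ℂ) (r : smoothFun U) :
    partialFun hU μ (c • r) = c • partialFun hU μ r := ev_ext fun y => by
  have hr := rep_extend r
  rw [map_smul, ← (hr.smul c).partialFun hU μ y, ← hr.partialFun hU μ y, pd,
    fderiv_const_smul (hr.differentiableAt hU y)]
  rfl

theorem partialFun_mul (hU : IsOpen U) (μ : Fin 4) (r s : smoothFun U) :
    partialFun hU μ (r * s) = r • partialFun hU μ s + s • partialFun hU μ r := ev_ext fun y => by
  have hr := rep_extend r
  have hs := rep_extend s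
  rw [map_add, smul_eq_mul, smul_eq_mul, map_mul, map_mul, ← (hr.mul hs).partialFun hU μ y,
    ← hr.partialFun hU μ y, ← hs.partialFun hU μ y, pd,
    fderiv_mul (hr.differentiableAt hU y) (hs.differentiableAt hU y), ← hr y, ← hs y]
  rfl

/-- The partial derivative as a derivation of the algebra of smooth functions. -/
noncomputable def partialDer (hU : IsOpen U) (μ : Fin 4) :
    Derivation ℂ (smoothFun U) (smoothFun U) :=
  Derivation.mk' ⟨⟨partialFun hU μ, partialFun_add hU μ⟩, partialFun_smul hU μ⟩
    (partialFun_mul hU μ)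

theorem Rep.pd (hU : IsOpen U) {F : Coord → ℂ} {r : smoothFun U} (h : Rep F r) (μ : Fin 4) :
    Rep (pd μ F) (partialDer hU μ r) := h.partialFun hU μ

theorem partialDer_comm (hU : IsOpen U) (μ ν : Fin 4) (r : smoothFun U) :
    partialDer hU μ (partialDer hU ν r) = partialDer hU ν (partialDer hU μ r) :=
  ev_ext fun y => by
    rw [← ((rep_extend r).pd hU ν).pd hU μ y, ← ((rep_extend r).pd hU μ).pd hU ν y]
    exact pd_comm hU μ ν (rep_extend r).contDiffOn y.2

theorem ev_half (y : U) : ev y (half (smoothFun U)) = 1 / 2 := (ev y).commutes _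

end SmoothFunctions

/-! ### Transfer of pointwise geometry to the algebra -/

section Geometry
variable {U : Set Coord} (hU : IsOpen U) {P g : TensorField} {σ : Coord → ℂ}
  {P' Q' g' gi' : Matrix (Fin 4) (Fin 4) (smoothFun U)} {E Ei : smoothFun U}

theorem rep_poissonBracket {θ : TensorField} {θ' : Matrix (Fin 4) (Fin 4) (smoothFun U)}
    (hθ : RepM θ θ') {f h : Coord → ℂ} {f' h' : smoothFun U} (hf : Rep f f') (hh : Rep h h') :
    Rep (poissonBracket θ f h) (pbr (partialDer hU) θ' f' h') := fun y => by
  simp only [poissonBracket, pbr, map_sum, map_mul, hθ.apply _ _ y, hf.pd hU _ y, hh.pd hU _ y]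

theorem rep_christoffel (hP : RepM P P') (hQ : RepM (fun y => (P y)⁻¹) Q') (α μ ν : Fin 4) :
    Rep (christoffel P α μ ν) (chr (partialDer hU) P' Q' α μ ν) := fun y => by
  have h := fun i j κ => (hQ.apply i j).pd hU κ y
  simp only [christoffel, chr, map_mul, map_sum, map_add, map_sub, ev_half, hP.apply _ _ y, h]

variable {Γ : Fin 4 → Fin 4 → Fin 4 → smoothFun U}

theorem rep_covDerivLower (hΓ : ∀ α μ ν, Rep (christoffel P α μ ν) (Γ α μ ν))
    (hT : RepM g g') (μ α β : Fin 4) :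
    Rep (covDerivLower P g μ α β) (lowD (partialDer hU) Γ μ g' α β) := fun y => by
  simp only [covDerivLower, lowD, Matrix.of_apply, map_mul, map_sum, map_sub, hT.apply _ _ y,
    (hT.apply α β).pd hU μ y, hΓ _ _ _ y]

theorem rep_covDerivUpper (hΓ : ∀ α μ ν, Rep (christoffel P α μ ν) (Γ α μ ν))
    (hT : RepM g g') (μ α β : Fin 4) :
    Rep (covDerivUpper P g μ α β) (upD (partialDer hU) Γ μ g' α β) := fun y => by
  simp only [covDerivUpper, upD, Matrix.of_apply, map_mul, map_sum, map_add, hT.apply _ _ y,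
    (hT.apply α β).pd hU μ y, hΓ _ _ _ y]

theorem rep_divergence (hΓ : ∀ α μ ν, Rep (christoffel P α μ ν) (Γ α μ ν))
    {V : Fin 4 → Coord → ℂ} {V' : Fin 4 → smoothFun U}
    (hV : ∀ μ, Rep (V μ) (V' μ)) :
    Rep (divergence P V) (divg (partialDer hU) Γ V') := fun y => by
  simp only [divergence, divg, map_mul, map_sum, map_add, hV _ y, (hV _).pd hU _ y, hΓ _ _ _ y]

theorem rep_laplacian (hΓ : ∀ α μ ν, Rep (christoffel P α μ ν) (Γ α μ ν))
    (hP : RepM P P') {f : Coord → ℂ} {f' : smoothFun U} (hf : Rep f f') :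
    Rep (laplacian P f) (lap (partialDer hU) Γ P' f') := fun y => by
  simp only [laplacian, lap, map_mul, map_sum, map_sub, hP.apply _ _ y, hf.pd hU _ y,
    (hf.pd hU _).pd hU _ y, hΓ _ _ _ y]

theorem rep_ricci (hΓ : ∀ α μ ν, Rep (christoffel P α μ ν) (Γ α μ ν))
    (ρ ν : Fin 4) :
    Rep (ricci P ρ ν) (ric (partialDer hU) Γ ρ ν) := fun y => by
  simp only [ricci, riemann, ric, riem, Matrix.of_apply, map_mul, map_sum, map_sub, map_add,
    (hΓ _ _ _).pd hU _ y, hΓ _ _ _ y]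

theorem rep_divInvMetric (hΓ : ∀ α μ ν, Rep (christoffel P α μ ν) (Γ α μ ν))
    (hgi : RepM (invMetric g) gi') (β : Fin 4) :
    Rep (divInvMetric P g β) (divInv (partialDer hU) Γ gi' β) := fun y => by
  simp only [divInvMetric, divInv, map_sum, rep_covDerivUpper hU hΓ hgi _ _ _ y]

theorem rep_traceGg (hP : RepM P P') (hg : RepM g g') :
    Rep (traceGg P g) (∑ μ, ∑ ν, P' μ ν * g' μ ν) := fun y => by
  simp only [traceGg, map_sum, map_mul, hP.apply _ _ y, hg.apply _ _ y]

theorem rep_etaScalar (hP : RepM P P') (hg : RepM g g')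
    (hE : Rep (fun y => Complex.exp (σ y)) E) :
    Rep (etaScalar P g σ) (half (smoothFun U) * half (smoothFun U) * E
      * ∑ μ, ∑ ν, P' μ ν * g' μ ν) := fun y => by
  have := hE y
  simp only at this
  simp only [etaScalar, rep_traceGg hP hg y, map_mul, this, ev_half]
  norm_num

end Geometry

section Transfer
variable {U : Set Coord} (hU : IsOpen U) {P g : TensorField} {σ : Coord → ℂ}
  {P' Q' g' gi' : Matrix (Fin 4) (Fin 4) (smoothFun U)} {E Ei : smoothFun U}

theorem rep_intrinsicScalar (hP : RepM P P') (hQ : RepM (fun y => (P y)⁻¹) Q') (hg : RepM g g')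
    (hgi : RepM (invMetric g) gi') (hE : Rep (fun y => Complex.exp (σ y)) E)
    (hEi : Rep (fun y => Complex.exp (-σ y)) Ei)
    (hdσ : ∀ μ, Rep (pd μ σ) (Ei * partialDer hU μ E)) :
    Rep (intrinsicScalar P g σ) (intr (partialDer hU) P' Q' g' gi' E Ei) := fun y => by
  have hΓ := rep_christoffel hU hP hQ
  have hη := rep_etaScalar hP hg hE
  have hW := rep_divInvMetric hU hΓ hgi
  have e1 : (P y * g y * P y * g y).trace = ev y (P' * g' * P' * g').trace := by
    rw [AddMonoidHom.map_trace (ev y), hP y, hg y, ← map_mul, ← map_mul, ← map_mul]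
    rfl
  have e2 : Complex.exp (-σ y) = ev y Ei := hEi y
  have e3 : Complex.exp (-2 * σ y) = ev y (Ei * Ei) := by
    rw [map_mul, ← e2, ← Complex.exp_add]
    ring_nf
  have e4 : ∀ μ ν, (P y * g y * P y) μ ν = ev y ((P' * g' * P') μ ν) := fun μ ν => by
    rw [hP y, hg y, ← map_mul, ← map_mul]
    rfl
  have e5 := rep_divergence hU hΓ (V := fun ν z => ∑ μ, ∑ β, P z μ ν * g z μ β * divInvMetric P g β z)
    (V' := fun ν => ∑ μ, ∑ β, P' μ ν * g' μ β * divInv (partialDer hU) (chr (partialDer hU) P' Q') gi' β)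
    (fun ν z => by simp only [map_sum, map_mul, hP.apply _ _ z, hg.apply _ _ z, hW _ z])
  have e6 : ∀ i j, (P y)⁻¹ i j = ev y (Q' i j) := fun i j => hQ.apply i j y
  have e7 : ∀ i j, invMetric g y i j = ev y (gi' i j) := fun i j => hgi.apply i j y
  have e8 := rep_laplacian hU hΓ hP hE
  have e9 : ∀ μ, pd μ (etaScalar P g σ) y = _ := fun μ => hη.pd hU μ y
  have e10 : ∀ μ, pd μ σ y = _ := fun μ => hdσ μ y
  have hh := ev_half y
  simp only [intrinsicScalar, intr, scalarCurv, gradDot, e1, e2, e3, e4, e5 y, e6, e7, e8 y, hη y,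
    e9, e10, hP.apply _ _ y, rep_traceGg hP hg y, hW _ y, rep_ricci hU hΓ _ _ y,
    rep_covDerivLower hU hΓ hg _ _ _ y, rep_covDerivUpper hU hΓ hgi _ _ _ y, map_sum, map_mul,
    map_add, map_sub, map_pow, map_ofNat, hh]
  ring

end Transfer

/-! ### Compatibility of the matrix expression with graded relations -/

section Expressions
variable {B C : Type*} [Ring B] [Algebra ℂ B] [Ring C] [Algebra ℂ C] {D : ℕ}

/-- The matrix combination is compatible with every relation between two algebras with brackets
that respects sums, products and brackets and is graded by the number of brackets. -/
theorem matCombination_rel (rel : ℕ → B → C → Prop) {br : B → B → B} {br' : C → C → C}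
    (h0 : ∀ k, rel k 0 0)
    (hadd : ∀ {k a b r s}, rel k a r → rel k b s → rel k (a + b) (r + s))
    (hsmul : ∀ {k a r} (z : ℂ), rel k a r → rel k (z • a) (z • r))
    (hmul : ∀ {k l a b r s}, rel k a r → rel l b s → rel (k + l) (a * b) (r * s))
    (hbr : ∀ {k l a b r s}, rel k a r → rel l b s → rel (k + l + 1) (br a b) (br' r s))
    (ε : Fin D → ℝ) {X : Fin D → B} {Y : Fin D → C} (hX : ∀ a, rel 0 (X a) (Y a)) :
    rel 6 (matCombination br ε X) (matCombination br' ε Y) := by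
  have hsum : ∀ {k} {a : Fin D → B} {r : Fin D → C}, (∀ i, rel k (a i) (r i)) →
      rel k (∑ i, a i) (∑ i, r i) := fun {k a r} h => by
    induction (univ : Finset (Fin D)) using Finset.induction_on with
    | empty => simpa using h0 k
    | insert i s hi ih =>
      rw [Finset.sum_insert hi, Finset.sum_insert hi]
      exact hadd (h i) ih
  have hH : ∀ a b, rel 2 (matH br ε X a b) (matH br' ε Y a b) := fun a b =>
    hsmul _ (hsum fun c => hsmul _ (hadd (hmul (hbr (hX a) (hX c)) (hbr (hX b) (hX c)))
      (hmul (hbr (hX b) (hX c)) (hbr (hX a) (hX c)))))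
  have hB : ∀ {k Φ Ψ}, rel k Φ Ψ → rel (k + 2) (matBox br ε X Φ) (matBox br' ε Y Ψ) :=
    fun {k Φ Ψ} h => hsum fun a => hsmul _ (by
      have := hbr (hX a) (hbr (hX a) h)
      rwa [zero_add, zero_add] at this)
  -- Counting brackets: 2 + 4 in `H □H`, and 2 + 2 + 2 in the second term.
  exact hadd (hsum fun a => hsum fun b => hsmul _ (hmul (hH a b) (hB (hH a b))))
    (hsmul _ (hsum fun a => hsum fun b => hsum fun c => hsmul _
      (hmul (hmul (hB (hX c)) (hH a b)) (hbr (hX a) (hbr (hX b) (hX c))))))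

end Expressions

theorem isUnit_det_neg_smul_sandwich {R : Type*} [CommRing R] {A g : Matrix (Fin 4) (Fin 4) R}
    {e : R} (he : IsUnit e) (hA : IsUnit A.det) (hg : IsUnit g.det) :
    IsUnit (-(e • (A * g * A))).det := by
  rw [← neg_smul, Matrix.det_smul, Matrix.det_mul, Matrix.det_mul]
  exact (he.neg.pow _).mul ((hA.mul hg).mul hA)

/-! ### Branes as algebraic backgrounds -/

section Brane
variable {U : Set Coord} {D : ℕ} {ε : Fin D → ℝ} {x : Fin D → Coord → ℝ} {θ : TensorField}
  {σ : Coord → ℂ}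

/-- The data of a brane as elements of the algebra of smooth functions on `U`. -/
structure BraneRep (hU : IsOpen U) (ε : Fin D → ℝ) (x : Fin D → Coord → ℝ) (θ : TensorField)
    (σ : Coord → ℂ) (P Q θ' Ω gi : Matrix (Fin 4) (Fin 4) (smoothFun U)) (E Ei : smoothFun U)
    (X : Fin D → smoothFun U) : Prop where
  coord : ∀ a, Rep (embFun x a) (X a)
  poisson : RepM θ θ'
  metric : RepM (inducedMetric ε x) (indMet (partialDer hU) (fun a => (ε a : ℂ)) X)
  metric_inv : RepM (invMetric (inducedMetric ε x)) gi
  eff : RepM (effectiveMetricInv θ (inducedMetric ε x) σ) P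
  eff_inv : RepM (fun y => (effectiveMetricInv θ (inducedMetric ε x) σ y)⁻¹) Q
  exp : Rep (fun y => Complex.exp (σ y)) E
  exp_neg : Rep (fun y => Complex.exp (-σ y)) Ei
  background : Background (partialDer hU) P Q θ' Ω
    (indMet (partialDer hU) (fun a => (ε a : ℂ)) X) E Ei
  mul_metric_inv : indMet (partialDer hU) (fun a => (ε a : ℂ)) X * gi = 1

theorem rep_inducedMetric (hU : IsOpen U) {X : Fin D → smoothFun U}
    (hX : ∀ a, Rep (embFun x a) (X a)) :
    RepM (inducedMetric ε x) (indMet (partialDer hU) (fun a => (ε a : ℂ)) X) := fun y => by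
  ext μ ν
  simp only [inducedMetric, Matrix.of_apply, indMet, AlgHom.mapMatrix_apply, Matrix.map_apply,
    Matrix.sum_apply, Matrix.smul_apply, vecMulVec_apply, map_sum, map_smul, map_mul, grad,
    (hX _).pd hU _ y, smul_eq_mul, mul_assoc]

/-- Here `dσ = e^{-σ} d(e^σ)`, so the scalar can be expressed through `e^σ` alone and no branch of
the logarithm is chosen. -/
theorem rep_pd_log (hU : IsOpen U) (hσ : ContDiffOn ℝ ∞ σ U) {E Ei : smoothFun U}
    (hE : Rep (fun y => Complex.exp (σ y)) E) (hEi : Rep (fun y => Complex.exp (-σ y)) Ei)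
    (μ : Fin 4) : Rep (pd μ σ) (Ei * partialDer hU μ E) := fun y => by
  have hd : DifferentiableAt ℝ σ y :=
    (hσ.contDiffAt (hU.mem_nhds y.2)).differentiableAt (by simp)
  have h1 : pd μ (fun y => Complex.exp (σ y)) y = Complex.exp (σ y) * pd μ σ y := by
    rw [pd, hd.hasFDerivAt.cexp.fderiv]
    rfl
  have h2 : Complex.exp (-σ y) = ev y Ei := hEi y
  rw [map_mul, ← hE.pd hU μ y, h1, ← h2, ← mul_assoc, ← Complex.exp_add]
  simp

theorem rep_effectiveMetricInv {g : TensorField} {θ' g' : Matrix (Fin 4) (Fin 4) (smoothFun U)}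
    {Ei : smoothFun U} (hθ : RepM θ θ') (hg : RepM g g') (hθt : θ'ᵀ = -θ')
    (hEi : Rep (fun y => Complex.exp (-σ y)) Ei) :
    RepM (effectiveMetricInv θ g σ) (-(Ei • (θ' * g' * θ'))) := fun y => by
  have h : -(Ei • (θ' * g' * θ')) = Ei • (θ' * g' * θ'ᵀ) := by rw [hθt, Matrix.mul_neg, smul_neg]
  have h2 : Complex.exp (-σ y) = ev y Ei := hEi y
  rw [h]
  ext μ ν
  simp only [effectiveMetricInv, Matrix.of_apply, AlgHom.mapMatrix_apply, Matrix.map_apply,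
    Matrix.smul_apply, smul_eq_mul, Matrix.mul_apply, Matrix.transpose_apply, map_mul, map_sum, h2,
    hθ.apply _ _ y, hg.apply _ _ y, Finset.sum_mul]
  rw [Finset.sum_comm]
  exact congrArg _ (Finset.sum_congr rfl fun _ _ => Finset.sum_congr rfl fun _ _ => by ring)

/-- Nowhere vanishing determinants become units, so pointwise inverse matrices are inverses over the
algebra. The remaining axioms are checked at each point. -/
theorem IsBrane.exists_braneRep (hM : IsBrane U ε x θ σ) :
    ∃ P Q θ' Ω gi E Ei X, BraneRep hM.isOpen ε x θ σ P Q θ' Ω gi E Ei X := by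
  have hU := hM.isOpen
  have hx : ∀ a, ContDiffOn ℝ ∞ (embFun x a) U := fun a =>
    Complex.ofRealCLM.contDiff.comp_contDiffOn (hM.smooth_x a)
  choose X hX using fun a => exists_rep (hx a)
  obtain ⟨θ', hθ⟩ := exists_repM hM.smooth_θ
  obtain ⟨E, hE⟩ := exists_rep hM.smooth_σ.cexp
  obtain ⟨Ei, hEi⟩ := exists_rep hM.smooth_σ.neg.cexp
  have hg := rep_inducedMetric (ε := ε) hU hX
  have hgt := indMet_transpose (partialDer hU) (fun a => (ε a : ℂ)) X
  have hgd := hg.isUnit_det hM.metric_nondeg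
  have hθd := hθ.isUnit_det hM.nondeg
  have hθt : θ'ᵀ = -θ' := by
    ext1 i j
    refine ev_ext fun y => ?_
    rw [Matrix.transpose_apply, Matrix.neg_apply, map_neg, ← hθ.apply i j y, ← hθ.apply j i y]
    exact hM.antisymm y y.2 j i
  have hEE : E * Ei = 1 := ev_ext fun y => by
    rw [map_mul, map_one, ← hE y, ← hEi y, ← Complex.exp_add, add_neg_cancel, Complex.exp_zero]
  set g := indMet (partialDer hU) (fun a => (ε a : ℂ)) X
  have hP := rep_effectiveMetricInv hθ hg hθt hEi
  have hPd : IsUnit (-(Ei • (θ' * g * θ'))).det := isUnit_det_neg_smul_sandwich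
    (IsUnit.of_mul_eq_one E (by rw [mul_comm, hEE])) hθd hgd
  refine ⟨_, _, θ', θ'⁻¹, g⁻¹, E, Ei, X, hX, hθ, hg, hg.inv hgd, hP, hP.inv hPd, hE, hEi, ?_,
    Matrix.mul_nonsing_inv _ hgd⟩
  refine ⟨fun μ ν f => partialDer_comm hU μ ν f, hθt, Matrix.nonsing_inv_mul _ hθd, ?_, hEE, hgt,
    rfl, Matrix.nonsing_inv_mul _ hPd, ?_⟩
  · intro μ ν ρ
    refine ev_ext fun y => ?_
    have := hM.jacobi y y.2 μ ν ρ
    simp only [(hθ.apply _ _).pd hU _ y, hθ.apply _ _ y] at this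
    simpa only [map_sum, map_add, map_mul, map_zero] using this
  · refine ev_ext fun y => ?_
    rw [map_mul, map_pow, AlgHom.map_det, AlgHom.map_det, ← hP.inv hPd y, ← hθ.inv hθd y, ← hEi y]
    exact hM.scale y y.2

variable {P Q θ' Ω gi : Matrix (Fin 4) (Fin 4) (smoothFun U)} {E Ei : smoothFun U}
  {X : Fin D → smoothFun U}

theorem rep_classicalBracket (hU : IsOpen U) (hθ : RepM θ θ') {f h : Coord → ℂ}
    {f' h' : smoothFun U} (hf : Rep f f') (hh : Rep h h') :
    Rep (classicalBracket θ f h) (Complex.I • pbr (partialDer hU) θ' f' h') :=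
  (rep_poissonBracket hU hθ hf hh).smul Complex.I

theorem Rep.zero : Rep (0 : Coord → ℂ) (0 : smoothFun U) := fun y => (map_zero (ev y)).symm

theorem BraneRep.rep_limit {hU : IsOpen U} (h : BraneRep hU ε x θ σ P Q θ' Ω gi E Ei X)
    (hσ : ContDiffOn ℝ ∞ σ U) :
    Rep (fun y => -Complex.exp (3 * σ y) * intrinsicScalar
        (effectiveMetricInv θ (inducedMetric ε x) σ) (inducedMetric ε x) σ y)
      (matCombination (fun f k => Complex.I • pbr (partialDer hU) θ' f k) ε X) := fun y => by
  have h1 : Complex.exp (σ y) = ev y E := h.exp y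
  rw [h.background.matCombination_eq h.mul_metric_inv, map_neg, map_mul, map_pow, ← h1,
    ← rep_intrinsicScalar hU h.eff h.eff_inv h.metric h.metric_inv h.exp h.exp_neg
      (rep_pd_log hU hσ h.exp h.exp_neg) y, ← Complex.exp_nat_mul]
  exact neg_mul _ _

theorem BraneRep.rep_classicalCombination {hU : IsOpen U}
    (h : BraneRep hU ε x θ σ P Q θ' Ω gi E Ei X) :
    Rep (classicalCombination ε x θ)
      (matCombination (fun f k => Complex.I • pbr (partialDer hU) θ' f k) ε X) :=
  matCombination_rel (fun _ => Rep) (fun _ => Rep.zero) Rep.add (fun z h => h.smul z) Rep.mul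
    (rep_classicalBracket hU h.poisson) ε h.coord

theorem IsBrane.classicalCombination_eq (hM : IsBrane U ε x θ σ) {y : Coord} (hy : y ∈ U) :
    classicalCombination ε x θ y = -Complex.exp (3 * σ y) * intrinsicScalar
      (effectiveMetricInv θ (inducedMetric ε x) σ) (inducedMetric ε x) σ y := by
  obtain ⟨P, Q, θ', Ω, gi, E, Ei, X, h⟩ := hM.exists_braneRep
  exact (h.rep_classicalCombination ⟨y, hy⟩).trans (h.rep_limit hM.smooth_σ ⟨y, hy⟩).symm

/-- The intrinsic scalar depends on the metrics and on `e^σ` only. -/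
theorem IsBrane.intrinsicScalar_congr (hM : IsBrane U ε x θ σ) {P g : TensorField} {σ' : Coord → ℂ}
    (hσ' : ContDiffOn ℝ ∞ σ' U) (hg : ∀ y ∈ U, g y = inducedMetric ε x y)
    (hP : ∀ y ∈ U, P y = effectiveMetricInv θ (inducedMetric ε x) σ y)
    (hE : ∀ y ∈ U, Complex.exp (σ' y) = Complex.exp (σ y)) {y : Coord} (hy : y ∈ U) :
    intrinsicScalar P g σ' y = intrinsicScalar
      (effectiveMetricInv θ (inducedMetric ε x) σ) (inducedMetric ε x) σ y := by
  obtain ⟨P', Q, θ', Ω, gi, E, Ei, X, h⟩ := hM.exists_braneRep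
  have hU := hM.isOpen
  -- The same algebra elements represent both sets of data, so both scalars are values of one
  -- element.
  have h1 : Rep (fun y => Complex.exp (σ' y)) E := fun z => (hE z z.2).trans (h.exp z)
  have h2 : Rep (fun y => Complex.exp (-σ' y)) Ei := fun z => by
    have e : Complex.exp (-σ' z) = Complex.exp (-σ z) := by
      rw [Complex.exp_neg, hE z z.2, Complex.exp_neg]
    exact e.trans (h.exp_neg z)
  have e1 := rep_intrinsicScalar hU (P := P) (g := g) (fun z => (hP z z.2).trans (h.eff z))
    (fun z => (congrArg _ (hP z z.2)).trans (h.eff_inv z)) (fun z => (hg z z.2).trans (h.metric z))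
    (fun z => (congrArg _ (hg z z.2)).trans (h.metric_inv z)) h1 h2 (rep_pd_log hU hσ' h1 h2) ⟨y, hy⟩
  have e2 := rep_intrinsicScalar hU h.eff h.eff_inv h.metric h.metric_inv h.exp h.exp_neg
    (rep_pd_log hU hM.smooth_σ h.exp h.exp_neg) ⟨y, hy⟩
  exact e1.trans e2.symm

end Brane

/-! ### Semi-classical limits in a quantization -/

section Quantize
variable {U : Set Coord} {θ : TensorField} {A : Type*} [Ring A] [Algebra ℂ A]
  (Q : Quantization U θ A)

/-- The element `a` has the semi-classical limit `r` at order `k`. -/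
def Quantization.Lim (k : ℕ) (a : A) (r : smoothFun U) : Prop :=
  ∃ b, a = Q.hbar ^ k * b ∧ Rep (Q.symbol b) r

namespace Quantization
variable {Q} {k l : ℕ} {a b : A} {r s : smoothFun U}

theorem Lim.zero (k : ℕ) : Q.Lim k 0 0 :=
  ⟨0, (mul_zero _).symm, fun y => by simpa using Q.symbol_smul 0 0 y y.2⟩

theorem Lim.add : Q.Lim k a r → Q.Lim k b s → Q.Lim k (a + b) (r + s) := by
  rintro ⟨a', rfl, ha⟩ ⟨b', rfl, hb⟩
  exact ⟨a' + b', (mul_add _ _ _).symm, fun y => by rw [Q.symbol_add _ _ y y.2, map_add, ha y, hb y]⟩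

theorem Lim.smul (z : ℂ) : Q.Lim k a r → Q.Lim k (z • a) (z • r) := by
  rintro ⟨a', rfl, ha⟩
  exact ⟨z • a', (mul_smul_comm _ _ _).symm, fun y => by
    rw [Q.symbol_smul _ _ y y.2, map_smul, ha y, smul_eq_mul]⟩

theorem hbar_pow_commute (k : ℕ) (a : A) : Commute (Q.hbar ^ k) a :=
  (show Commute Q.hbar a from Q.hbar_central a).pow_left k

theorem hbar_pow_mul_mul (k l : ℕ) (a b : A) :
    Q.hbar ^ k * a * (Q.hbar ^ l * b) = Q.hbar ^ (k + l) * (a * b) := by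
  rw [pow_add, mul_assoc, ← mul_assoc a, ← (hbar_pow_commute l a).eq]
  simp only [mul_assoc]

theorem Lim.mul : Q.Lim k a r → Q.Lim l b s → Q.Lim (k + l) (a * b) (r * s) := by
  rintro ⟨a', rfl, ha⟩ ⟨b', rfl, hb⟩
  exact ⟨a' * b', hbar_pow_mul_mul _ _ _ _, fun y => by
    rw [Q.symbol_mul _ _ y y.2, map_mul, ha y, hb y]⟩

/-- Powers of the central `ħ` come out of the commutator, and the commutator of the remaining
factors supplies one more. -/
theorem Lim.bracket (hU : IsOpen U) {θ' : Matrix (Fin 4) (Fin 4) (smoothFun U)} (hθ : RepM θ θ') :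
    Q.Lim k a r → Q.Lim l b s →
      Q.Lim (k + l + 1) (a * b - b * a) (Complex.I • pbr (partialDer hU) θ' r s) := by
  rintro ⟨a', rfl, ha⟩ ⟨b', rfl, hb⟩
  obtain ⟨c, hc, hs⟩ := Q.commutator a' b'
  refine ⟨Complex.I • c, ?_, fun y => ?_⟩
  · rw [hbar_pow_mul_mul, hbar_pow_mul_mul, add_comm l k, ← mul_sub, hc, ← mul_assoc, ← pow_succ]
  · rw [Q.symbol_smul _ _ y y.2, hs y y.2, rep_poissonBracket hU hθ ha hb y, map_smul, smul_eq_mul]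

end Quantization
end Quantize

end MatrixBrane

/-! ### The main theorem -/

theorem mainTheorem4 {D : ℕ} (U : Set MatrixBrane.Coord) (ε : Fin D → ℝ)
    (x : Fin D → MatrixBrane.Coord → ℝ) (θ : MatrixBrane.TensorField)
    (σ : MatrixBrane.Coord → ℂ) (hM : MatrixBrane.IsBrane U ε x θ σ) :
    -- the expression with commutators replaced by Poisson brackets
    (∀ y ∈ U, MatrixBrane.classicalCombination ε x θ y =
      -Complex.exp (3 * σ y) * MatrixBrane.intrinsicScalar
        (MatrixBrane.effectiveMetricInv θ (MatrixBrane.inducedMetric ε x) σ)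
        (MatrixBrane.inducedMetric ε x) σ y) ∧
    -- the semi-classical limit of the matrix expression, for every quantization
    (∀ (A : Type*) [Ring A] [Algebra ℂ A] (Q : MatrixBrane.Quantization U θ A) (X : Fin D → A),
      (∀ a, ∀ y ∈ U, Q.symbol (X a) y = (x a y : ℂ)) →
      Q.HasSemiclassicalLimit 6 (MatrixBrane.matCombination (fun Φ Ψ => Φ * Ψ - Ψ * Φ) ε X)
        (fun y => -Complex.exp (3 * σ y) * MatrixBrane.intrinsicScalar
          (MatrixBrane.effectiveMetricInv θ (MatrixBrane.inducedMetric ε x) σ)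
          (MatrixBrane.inducedMetric ε x) σ y)) ∧
    -- independence of the embedding
    (∀ (D' : ℕ) (ε' : Fin D' → ℝ) (x' : Fin D' → MatrixBrane.Coord → ℝ)
      (θ' : MatrixBrane.TensorField) (σ' : MatrixBrane.Coord → ℂ),
      MatrixBrane.IsBrane U ε' x' θ' σ' →
      (∀ y ∈ U, MatrixBrane.inducedMetric ε' x' y = MatrixBrane.inducedMetric ε x y) →
      (∀ y ∈ U, MatrixBrane.effectiveMetricInv θ' (MatrixBrane.inducedMetric ε' x') σ' y =
        MatrixBrane.effectiveMetricInv θ (MatrixBrane.inducedMetric ε x) σ y) →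
      (∀ y ∈ U, Complex.exp (σ' y) = Complex.exp (σ y)) →
      ∀ y ∈ U, MatrixBrane.classicalCombination ε' x' θ' y =
        MatrixBrane.classicalCombination ε x θ y) := by
  refine ⟨fun y hy => hM.classicalCombination_eq hy, fun A _ _ Q X hX => ?_,
    fun D' ε' x' θ' σ' hM' hg hP hE y hy => ?_⟩
  · obtain ⟨P, Q', θ', Ω, gi, E, Ei, X', h⟩ := hM.exists_braneRep
    obtain ⟨b, hb, hs⟩ := MatrixBrane.matCombination_rel Q.Lim
      MatrixBrane.Quantization.Lim.zero MatrixBrane.Quantization.Lim.add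
      MatrixBrane.Quantization.Lim.smul MatrixBrane.Quantization.Lim.mul
      (MatrixBrane.Quantization.Lim.bracket hM.isOpen h.poisson) ε
      (X := X) (Y := X') (fun a => ⟨X a, by rw [pow_zero, one_mul], fun y =>
        (hX a y y.2).trans (h.coord a y)⟩)
    exact ⟨b, hb, fun y hy => (hs ⟨y, hy⟩).trans (h.rep_limit hM.smooth_σ ⟨y, hy⟩).symm⟩
  · have h3 : Complex.exp (3 * σ' y) = Complex.exp (3 * σ y) := by
      have := congrArg (· ^ 3) (hE y hy)
      simp only [← Complex.exp_nat_mul] at this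
      exact_mod_cast this
    rw [hM'.classicalCombination_eq hy, hM.classicalCombination_eq hy, h3,
      hM.intrinsicScalar_congr hM'.smooth_σ hg hP hE hy]
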